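/- Let $\widehat{\mathcal A}=\mathbb Z[v^{\pm1},z,w^{\pm1}]$ with the operations $$a\circ b=v^2a+vwb,\quad a/b=v^{-2}a-v^{-1}wb,\quad a*b=v^2a+vzb,\quad a/\!/b=v^{-2}a-v^{-1}zb,$$ and $a_n=\left(\frac{v^{-1}-v}{w}\right)^{n-1}$ for $n\ge1$; this is a generalized Conway algebra. There is an invariant $\widehat W$ of (non-empty) classical oriented links, with values in $\widehat{\mathcal A}$, such that $\widehat W(L_+)=\widehat W(L_-)\circ\widehat W(L_0)$ at every self crossing, $\widehat W(L_+)=\widehat W(L_-)*\widehat W(L_0)$ at every mixed crossing, $\widehat W(T_n)=a_n$ for the trivial link $T_n$ of $n$ components, and $\widehat W(D)=a_n$ for every descending diagram $D$ with $n$ components; it is the only invariant with these properties (the generalized Conway type invariant). This invariant is weaker than (determined by) two variable Vassiliev invariants. Precisely, substitute $$v=e^{xyt},\qquad w=e^{-x}-e^{x},\qquad z=e^{-y}-e^{y}$$ with formal variables $x,y,t$; this defines a ring homomorphism from $\widehat{\mathcal A}$ to the field of fractions of $\mathbb Q[[x,y,t]]$. Then: 1. After the substitution $\widehat W(L)$ becomes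 a power series $F(L)\in\mathbb Q[[x,y,t]]$ for every oriented link $L$. 2. $F(L_+)-F(L_-)=x\,f(x,y,t)$ with $f\in\mathbb Q[[x,y,t]]$ at every self crossing, and $F(L_+)-F(L_-)=y\,g(x,y,t)$ with $g\in\mathbb Q[[x,y,t]]$ at every mixed crossing. 3. Extend a rational link invariant $u$ to singular links by $u(L_\times)=u(L_+)-u(L_-)$. Call $u$ a two variable Vassiliev invariant if there are $m,n$ such that $u$ vanishes on every singular link having more than $m$ double points between strands of one component or more than $n$ double points between strands of different components. Then for all $i,j,k\geq 0$ the coefficient of $x^iy^jt^k$ in $F$ is a two variable Vassiliev invariant; moreover it vanishes on every singular link with more than $i+j$ double points. 4. If $F(L)=F(L')$, then $\widehat W(L)=\widehat W(L')$. Consequently, if $u(L)=u(L')$ for all rational two variable Vassiliev invariants $u$, then $\widehat W(L)=\widehat W(L')$. -/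

import Mathlib

/-! ## Generalized Conway algebras -/

/-- A generalized Conway algebra: a set with four binary operations
`a ∘ b` (`circ`), `a / b` (`circInv`), `a * b` (`star`), `a // b` (`starInv`) and a sequence
`a₁, a₂, …` (the entry `a 0` plays no role). -/
structure GeneralizedConwayAlgebra (A : Type*) where
  circ : A → A → A
  circInv : A → A → A
  star : A → A → A
  starInv : A → A → A
  a : ℕ → A
  circ_circInv : ∀ x y, circInv (circ x y) y = x
  circInv_circ : ∀ x y, circ (circInv x y) y = x
  star_starInv : ∀ x y, starInv (star x y) y = x
  starInv_star : ∀ x y, star (starInv x y) y = x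
  a_eq : ∀ n, 1 ≤ n → a n = circ (a n) (a (n + 1))
  circ_circ_circ : ∀ x y s t, circ (circ x y) (circ s t) = circ (circ x s) (circ y t)
  star_star_star : ∀ x y s t, star (star x y) (star s t) = star (star x s) (star y t)
  circ_circ_star : ∀ x y s t, circ (circ x y) (star s t) = circ (circ x s) (star y t)
  star_star_circ : ∀ x y s t, star (star x y) (circ s t) = star (star x s) (circ y t)
  star_circ_circ : ∀ x y s t, star (circ x y) (circ s t) = circ (star x s) (star y t)

/-- The ring `ℤ[v^{±1}, z, w^{±1}]`, realised as `ℤ[z][w^{±1}][v^{±1}]`. -/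
abbrev HomflyptRing : Type :=
  LaurentPolynomial (LaurentPolynomial (Polynomial ℤ))

namespace HomflyptRing

noncomputable section

/-- The variable `v`. -/
def v : HomflyptRing := LaurentPolynomial.T 1

/-- The inverse of the variable `v`. -/
def vInv : HomflyptRing := LaurentPolynomial.T (-1)

/-- The variable `w`. -/
def w : HomflyptRing := LaurentPolynomial.C (LaurentPolynomial.T 1)

/-- The inverse of the variable `w`. -/
def wInv : HomflyptRing := LaurentPolynomial.C (LaurentPolynomial.T (-1))

/-- The variable `z`. -/
def z : HomflyptRing := LaurentPolynomial.C (LaurentPolynomial.C Polynomial.X)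

theorem v_mul_vInv : v * vInv = 1 := by
  unfold v vInv
  rw [← LaurentPolynomial.T_add]
  simp

theorem w_mul_wInv : w * wInv = 1 := by
  unfold w wInv
  rw [← map_mul, ← LaurentPolynomial.T_add]
  simp

end

end HomflyptRing

open HomflyptRing in
/-- The generalized Conway algebra on `ℤ[v^{±1}, z, w^{±1}]` with
`a ∘ b = v² a + v w b`, `a / b = v⁻² a - v⁻¹ w b`, `a * b = v² a + v z b`,
`a // b = v⁻² a - v⁻¹ z b` and `aₙ = ((v⁻¹ - v) / w)ⁿ⁻¹`. -/
noncomputable def homflyptConwayAlgebra : GeneralizedConwayAlgebra HomflyptRing where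
  circ x y := v ^ 2 * x + v * w * y
  circInv x y := vInv ^ 2 * x - vInv * w * y
  star x y := v ^ 2 * x + v * z * y
  starInv x y := vInv ^ 2 * x - vInv * z * y
  a n := ((vInv - v) * wInv) ^ (n - 1)
  circ_circInv x y := by
    linear_combination (x * (v * vInv + 1) + vInv * w * y) * v_mul_vInv
  circInv_circ x y := by
    linear_combination (x * (v * vInv + 1) - v * w * y) * v_mul_vInv
  star_starInv x y := by
    linear_combination (x * (v * vInv + 1) + vInv * z * y) * v_mul_vInv
  starInv_star x y := by
    linear_combination (x * (v * vInv + 1) - v * z * y) * v_mul_vInv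
  a_eq n hn := by
    obtain ⟨m, rfl⟩ := Nat.exists_eq_add_of_le' hn
    simp only [Nat.add_sub_cancel, pow_succ]
    linear_combination (-((vInv - v) * wInv) ^ m * v * (vInv - v)) * w_mul_wInv
      - ((vInv - v) * wInv) ^ m * v_mul_vInv
  circ_circ_circ x y s t := by ring
  star_star_star x y s t := by ring
  circ_circ_star x y s t := by ring
  star_star_circ x y s t := by ring
  star_circ_circ x y s t := by ring

/-! ## Oriented link diagrams -/

/-- A signed Gauss diagram with finitely many crossings: the data of an oriented link diagram up to
isotopy of the plane, for diagrams not yet required to be planar.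

Every crossing `x` is passed twice, once on its overcrossing strand, `(x, true)`, and once on its
undercrossing strand, `(x, false)`. The permutation `next` sends a pass to the pass that follows it
along the orientation, `sign x` is the sign (writhe) of the crossing, and `circles` is the number
of components that carry no crossing. -/
structure GaussDiagram where
  X : Type
  [fin : Finite X]
  sign : X → ℤˣ
  next : Equiv.Perm (X × Bool)
  circles : ℕ

attribute [instance] GaussDiagram.fin

namespace GaussDiagram

noncomputable section

/-- The number of components of the link. -/
def numComponents (D : GaussDiagram) : ℕ :=
  D.circles + Nat.card (Quotient (Equiv.Perm.SameCycle.setoid D.next))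

/-- A crossing is a self crossing if both of its strands belong to the same component; otherwise
it is a mixed crossing. -/
def IsSelf (D : GaussDiagram) (x : D.X) : Prop :=
  D.next.SameCycle (x, true) (x, false)

/-! ### Planarity -/

/-- The half-edges of the underlying 4-valent graph: `((x, s), true)` is the outgoing half-edge at
the pass `(x, s)` and `((x, s), false)` the incoming one. -/
abbrev HalfEdge (D : GaussDiagram) : Type := (D.X × Bool) × Bool

/-- The other half of the edge of a half-edge. -/
def opposite (D : GaussDiagram) (h : D.HalfEdge) : D.HalfEdge :=
  if h.2 = true then (D.next h.1, false) else (D.next.symm h.1, true)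

/-- Counterclockwise rotation about a crossing. The counterclockwise order is over-out, under-out,
over-in, under-in at a positive crossing, and under-out, over-out, under-in, over-in at a
negative one. -/
def rotate (D : GaussDiagram) (h : D.HalfEdge) : D.HalfEdge :=
  open scoped Classical in
  ((h.1.1, !h.1.2), if (D.sign h.1.1 = 1 ↔ h.1.2 = true) then h.2 else !h.2)

/-- The number of faces of the closed surface obtained by gluing discs to the ribbon surface of the
diagram: half-edges modulo the relation that identifies consecutive corners of a face. -/
def numFaces (D : GaussDiagram) : ℕ :=
  Nat.card (Quot fun h k : D.HalfEdge => D.rotate (D.opposite h) = k)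

/-- The number of connected pieces of the 4-valent graph formed by the crossings. -/
def numPieces (D : GaussDiagram) : ℕ :=
  Nat.card (Quot fun x y : D.X => ∃ s t, D.next (x, s) = (y, t))

/-- The diagram can be drawn in the plane (equivalently on the sphere): every connected piece has
Euler characteristic `2`. The graph has `Nat.card D.X` vertices and `2 * Nat.card D.X` edges. -/
def IsPlanar (D : GaussDiagram) : Prop :=
  (Nat.card D.X : ℤ) - 2 * Nat.card D.X + D.numFaces = 2 * D.numPieces

/-! ### Crossing changes and oriented smoothings -/

/-- Exchange of the two strands at the crossings of `S`. -/
def exchange {Y : Type} (S : Set Y) : Equiv.Perm (Y × Bool) :=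
  open scoped Classical in
  Function.Involutive.toPerm (fun p => (p.1, if p.1 ∈ S then !p.2 else p.2)) (by
    rintro ⟨x, b⟩
    by_cases h : x ∈ S <;> simp [h])

/-- Change all the crossings in `S`. -/
def switch (D : GaussDiagram) (S : Set D.X) : GaussDiagram where
  X := D.X
  sign x := open scoped Classical in if x ∈ S then -D.sign x else D.sign x
  next := exchange S * D.next * exchange S
  circles := D.circles

/-- Remove `p` from its cycle (so that `p` becomes a fixed point). -/
def bypass {Y : Type} (σ : Equiv.Perm Y) (p : Y) : Equiv.Perm Y :=
  open scoped Classical in Equiv.swap p (σ p) * σ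

theorem bypass_self {Y : Type} (σ : Equiv.Perm Y) (p : Y) : bypass σ p p = p := by
  simp [bypass]

theorem bypass_of_fixed {Y : Type} (σ : Equiv.Perm Y) (p q : Y) (h : σ q = q) :
    bypass σ p q = q := by
  classical
  by_cases hpq : q = p
  · subst hpq; exact bypass_self σ q
  · have h2 : q ≠ σ p := fun e => hpq (σ.injective (h.trans e))
    simp only [bypass, Equiv.Perm.mul_apply, h]
    exact Equiv.swap_apply_of_ne_of_ne hpq h2

theorem bypass_bypass_ne {Y : Type} (σ : Equiv.Perm (Y × Bool)) (c : Y) (p : Y × Bool) :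
    (bypass (bypass σ (c, true)) (c, false) p).1 ≠ c ↔ p.1 ≠ c := by
  set ρ := bypass (bypass σ (c, true)) (c, false) with hρ
  have hfix : ∀ b, ρ (c, b) = (c, b) := by
    intro b
    cases b
    · exact bypass_self _ _
    · exact bypass_of_fixed _ _ _ (bypass_self _ _)
  refine not_congr ⟨fun h => ?_, fun h => ?_⟩
  · have h1 : ρ p = (c, (ρ p).2) := Prod.ext h rfl
    have h2 : ρ p = ρ (c, (ρ p).2) := h1.trans (hfix _).symm
    exact congrArg Prod.fst (ρ.injective h2)
  · have h1 : p = (c, p.2) := Prod.ext h rfl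
    rw [h1, hfix]

/-- Erase the crossing `c`, keeping both strands; a component all of whose passes are erased
becomes a component without crossings. -/
def erase (D : GaussDiagram) (c : D.X) : GaussDiagram where
  X := {x : D.X // x ≠ c}
  sign x := D.sign x
  next := Equiv.prodSubtypeFstEquivSubtypeProd.permCongr
    ((bypass (bypass D.next (c, true)) (c, false)).subtypePerm
      (p := fun p => p.1 ≠ c) (bypass_bypass_ne D.next c))
  circles := open scoped Classical in D.circles
    + (if D.next (c, true) = (c, true) then 1 else 0)
    + (if D.next (c, false) = (c, false) then 1 else 0)
    + (if D.next (c, true) = (c, false) ∧ D.next (c, false) = (c, true) then 1 else 0)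

/-- The smoothing (splicing) of the crossing `c` respecting the orientation: the strand that enters
`c` above leaves along the outgoing lower strand, and vice versa. -/
def smooth (D : GaussDiagram) (c : D.X) : GaussDiagram :=
  open scoped Classical in
  erase { D with next := D.next * Equiv.swap (c, true) (c, false) } c

/-! ### Reidemeister moves -/

/-- The passes `p` and `q` are consecutive: `p` right before `q` if `ε = 1`, and `q` right before
`p` if `ε = -1`. -/
def Consecutive (D : GaussDiagram) (ε : ℤˣ) (p q : D.X × Bool) : Prop :=
  (ε = 1 ∧ D.next p = q) ∨ (ε = -1 ∧ D.next q = p)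

/-- Relabellings of crossings and the Reidemeister moves. -/
inductive Move : GaussDiagram → GaussDiagram → Prop
  /-- Relabelling of the crossings. -/
  | relabel (D D' : GaussDiagram) (e : D.X ≃ D'.X)
      (hsign : ∀ x, D'.sign (e x) = D.sign x)
      (hnext : ∀ x s, D'.next (e x, s) = (e (D.next (x, s)).1, (D.next (x, s)).2))
      (hcircles : D'.circles = D.circles) : Move D D'
  /-- First move: removal of a kink. -/
  | r1 (D : GaussDiagram) (c : D.X) (s : Bool) (h : D.next (c, s) = (c, !s)) :
      Move D (D.erase c)
  /-- Second move: removal of a bigon between an upper and a lower strand. -/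
  | r2 (D : GaussDiagram) (c d : D.X) (hcd : d ≠ c) (hsign : D.sign d = -D.sign c)
      (hover : D.next (c, true) = (d, true))
      (hunder : D.next (c, false) = (d, false) ∨ D.next (d, false) = (c, false)) :
      Move D ((D.erase c).erase ⟨d, hcd⟩)
  /-- Third move: a triangle with crossings `a` (top strand over middle strand), `b` (top over
  bottom) and `c` (middle over bottom). The signs `εt`, `εm`, `εb` record in which order the
  three strands meet the vertices of the triangle, and the conditions on the signs of the crossings
  say that the triangle is a face of the diagram (with orientation `κ`). The move reverses the order
  of the two crossings on each of the three strands. -/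
  | r3 (D : GaussDiagram) (a b c : D.X) (hab : a ≠ b) (hac : a ≠ c) (hbc : b ≠ c)
      (εt εm εb κ : ℤˣ)
      (htop : D.Consecutive εt (a, true) (b, true))
      (hmid : D.Consecutive εm (a, false) (c, true))
      (hbot : D.Consecutive εb (b, false) (c, false))
      (ha : D.sign a = κ * εt * εm) (hb : D.sign b = κ * εt * εb)
      (hc : D.sign c = κ * εm * εb)
      (τ : Equiv.Perm (D.X × Bool))
      (hτ : τ = open scoped Classical in
        Equiv.swap (a, true) (b, true) * Equiv.swap (a, false) (c, true)
          * Equiv.swap (b, false) (c, false)) :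
      Move D { D with next := τ * D.next * τ }

/-! ### Descending diagrams -/

/-- `l` is a way to walk along the diagram: a list of components, each traversed once along its
orientation from a base point, covering every component with crossings exactly once. -/
def IsTraversal (D : GaussDiagram) (l : List (List (D.X × Bool))) : Prop :=
  (∀ m ∈ l, m ≠ [] ∧ m.map D.next = m.rotate 1) ∧ l.flatten.Nodup ∧ ∀ p, p ∈ l.flatten

/-- For some order of the components and some base points, every crossing is first passed over and
then under. -/
def IsDescending (D : GaussDiagram) : Prop :=
  ∃ l, D.IsTraversal l ∧ ∀ x : D.X, [(x, true), (x, false)].Sublist l.flatten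

theorem exchange_exchange {Y : Type} (S : Set Y) (p : Y × Bool) :
    exchange S (exchange S p) = p :=
  (exchange S).left_inv p

theorem exchange_fst {Y : Type} (S : Set Y) (p : Y × Bool) : (exchange S p).1 = p.1 := rfl

theorem numPieces_switch (D : GaussDiagram) (S : Set D.X) :
    (D.switch S).numPieces = D.numPieces := by
  unfold numPieces
  congr 2
  funext x y
  refine propext ⟨?_, ?_⟩
  · rintro ⟨s, t, h⟩
    have h' : exchange S (D.next (exchange S (x, s))) = (y, t) := h
    have h2 := congrArg (exchange S) h'
    rw [exchange_exchange] at h2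
    exact ⟨(exchange S (x, s)).2, (exchange S (y, t)).2, h2⟩
  · rintro ⟨s, t, h⟩
    refine ⟨(exchange S (x, s)).2, (exchange S (y, t)).2, ?_⟩
    change exchange S (D.next (exchange S (exchange S (x, s)))) = exchange S (y, t)
    rw [exchange_exchange, h]

theorem numFaces_switch (D : GaussDiagram) (S : Set D.X) :
    (D.switch S).numFaces = D.numFaces := by
  classical
  have key : ∀ h : D.HalfEdge,
      (D.switch S).rotate ((D.switch S).opposite (exchange S h.1, h.2)) =
        (exchange S (D.rotate (D.opposite h)).1, (D.rotate (D.opposite h)).2) := by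
    have hr : ∀ h : D.HalfEdge, (D.switch S).rotate (exchange S h.1, h.2) =
        (exchange S (D.rotate h).1, (D.rotate h).2) := by
      rintro ⟨⟨x, b⟩, o⟩
      have hs := Int.units_eq_one_or (D.sign x)
      by_cases hx : x ∈ S <;> rcases hs with hs | hs <;> cases b <;>
        simp [rotate, switch, exchange, Function.Involutive.toPerm, hx, hs]
    have hn : ∀ p, (D.switch S).next (exchange S p) = exchange S (D.next p) := fun p =>
      congrArg (fun q => exchange S (D.next q)) (exchange_exchange S p)
    have hn' : ∀ p, (D.switch S).next.symm (exchange S p) = exchange S (D.next.symm p) := fun p =>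
      (Equiv.symm_apply_eq _).2 (((hn _).trans
        (congrArg (exchange S) (Equiv.apply_symm_apply D.next p))).symm)
    have ho : ∀ h : D.HalfEdge, (D.switch S).opposite (exchange S h.1, h.2) =
        (exchange S (D.opposite h).1, (D.opposite h).2) := by
      rintro ⟨p, o⟩
      cases o
      · exact congrArg (fun q => (q, true)) (hn' p)
      · exact congrArg (fun q => (q, false)) (hn p)
    exact fun h => (congrArg _ (ho h)).trans (hr _)
  let e : D.HalfEdge ≃ (D.switch S).HalfEdge := (exchange S).prodCongr (Equiv.refl Bool)
  refine (Nat.card_congr (Quot.congr e ?_)).symm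
  intro h k
  change _ ↔ (D.switch S).rotate ((D.switch S).opposite (exchange S h.1, h.2)) = e k
  rw [key]
  exact e.injective.eq_iff.symm

theorem IsPlanar.switch {D : GaussDiagram} (h : D.IsPlanar) (S : Set D.X) :
    (D.switch S).IsPlanar := by
  unfold IsPlanar at h ⊢
  rw [numPieces_switch, numFaces_switch]
  exact h

end

end GaussDiagram

/-! ## Links -/

/-- A (classical) oriented link diagram: a planar diagram with at least one component. -/
structure LinkDiagram where
  toGauss : GaussDiagram
  planar : toGauss.IsPlanar
  nonempty : Nonempty toGauss.X ∨ 0 < toGauss.circles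

/-- Oriented links: oriented link diagrams modulo the equivalence relation generated by the
Reidemeister moves. -/
def OrientedLink : Type 1 :=
  Quot fun D D' : LinkDiagram => D.toGauss.Move D'.toGauss

namespace LinkDiagram

/-- The crossings of a link diagram. -/
abbrev Crossing (D : LinkDiagram) : Type := D.toGauss.X

/-- The link represented by a diagram. -/
def link (D : LinkDiagram) : OrientedLink := Quot.mk _ D

/-- The diagram with all the crossings in `S` changed. -/
noncomputable def switch (D : LinkDiagram) (S : Set D.Crossing) : LinkDiagram where
  toGauss := D.toGauss.switch S
  planar := D.planar.switch S
  nonempty := D.nonempty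

/-- The standard diagram of the trivial link: `n ≥ 1` disjoint circles without crossings. -/
def trivial (n : ℕ) (hn : 1 ≤ n) : LinkDiagram where
  toGauss := { X := Empty, sign := Empty.elim, next := 1, circles := n }
  planar := by
    simp [GaussDiagram.IsPlanar, GaussDiagram.numFaces, GaussDiagram.numPieces]
  nonempty := Or.inr hn

end LinkDiagram

/-- `W` is a generalized Conway type invariant valued in `𝒜`. In the skein relations `D` is a diagram
with a positive crossing `c`, so that `L₊, L₋, L₀` are `D`, `D` with `c` changed, and `D` with `c`
smoothed. The last clause is the initial step of the recursive computation of `W`, in which all bad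
crossings are removed by skein relations; descending diagrams are diagrams of trivial links. -/
structure IsGeneralizedConwayInvariant {A : Type*} (𝒜 : GeneralizedConwayAlgebra A)
    (W : OrientedLink → A) : Prop where
  self_skein : ∀ (D D₀ : LinkDiagram) (c : D.Crossing), D.toGauss.sign c = 1 →
    D₀.toGauss = D.toGauss.smooth c → D.toGauss.IsSelf c →
    W D.link = 𝒜.circ (W (D.switch {c}).link) (W D₀.link)
  mixed_skein : ∀ (D D₀ : LinkDiagram) (c : D.Crossing), D.toGauss.sign c = 1 →
    D₀.toGauss = D.toGauss.smooth c → ¬ D.toGauss.IsSelf c →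
    W D.link = 𝒜.star (W (D.switch {c}).link) (W D₀.link)
  trivial_link : ∀ (n : ℕ) (hn : 1 ≤ n), W (LinkDiagram.trivial n hn).link = 𝒜.a n
  descending : ∀ D : LinkDiagram, D.toGauss.IsDescending →
    W D.link = 𝒜.a D.toGauss.numComponents

/-! ## Two variable Vassiliev invariants -/

/-- The value of a link invariant `u` on the singular link obtained from `D` by turning the crossings
in `S` into double points, each double point being resolved as
(positive crossing) − (negative crossing). -/
noncomputable def singularValue (u : OrientedLink → ℚ) (D : LinkDiagram) (S : Finset D.Crossing) :
    ℚ :=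
  ∑ T ∈ S.powerset,
    (∏ c ∈ S, (((D.switch (T : Set D.Crossing)).toGauss.sign c : ℤ) : ℚ)) *
      u (D.switch (T : Set D.Crossing)).link

open scoped Classical in
/-- A two variable Vassiliev invariant: for some `m` and `n` it vanishes on all singular links with
more than `m` double points between strands of the same component, or more than `n` double points
between strands of different components. -/
def IsTwoVariableVassiliev (u : OrientedLink → ℚ) : Prop :=
  ∃ m n : ℕ, ∀ (D : LinkDiagram) (S : Finset D.Crossing),
    (m < (S.filter fun c => D.toGauss.IsSelf c).card ∨
      n < (S.filter fun c => ¬ D.toGauss.IsSelf c).card) → singularValue u D S = 0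

/-! ## The substitution -/

namespace HomflyptRing

noncomputable section

/-- The power series `e^f` for a power series `f` in three variables without constant term. -/
def expOf (f : MvPowerSeries (Fin 3) ℚ) : MvPowerSeries (Fin 3) ℚ :=
  (PowerSeries.exp ℚ).subst f

/-- The variables `x`, `y`, `t` of the ring of power series are `X 0`, `X 1`, `X 2`. -/
abbrev xx : MvPowerSeries (Fin 3) ℚ := MvPowerSeries.X 0

abbrev yy : MvPowerSeries (Fin 3) ℚ := MvPowerSeries.X 1

abbrev tt : MvPowerSeries (Fin 3) ℚ := MvPowerSeries.X 2

/-- The field of fractions of `ℚ[[x, y, t]]`. -/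
abbrev SeriesField : Type := FractionRing (MvPowerSeries (Fin 3) ℚ)

/-- The series `e^{xyt}`, `e^{-x} - e^x` and `e^{-y} - e^y` substituted for `v`, `w`, `z`. -/
def vSeries : MvPowerSeries (Fin 3) ℚ := expOf (xx * yy * tt)

def wSeries : MvPowerSeries (Fin 3) ℚ := expOf (-xx) - expOf xx

def zSeries : MvPowerSeries (Fin 3) ℚ := expOf (-yy) - expOf yy

theorem coeff_expOf_linear (c : ℚ) :
    MvPowerSeries.coeff (Finsupp.single 0 1) (expOf (MvPowerSeries.C c * xx)) = c := by
  classical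
  have hs : PowerSeries.HasSubst (MvPowerSeries.C c * xx) := by
    apply PowerSeries.HasSubst.of_constantCoeff_zero
    simp
  rw [expOf, PowerSeries.coeff_subst hs, finsum_eq_single _ 1]
  · simp [PowerSeries.coeff_exp]
  · intro d hd
    rw [mul_pow, ← map_pow, MvPowerSeries.coeff_C_mul, MvPowerSeries.coeff_X_pow, if_neg, mul_zero,
      smul_zero]
    intro h
    have := congrArg (fun f => f 0) h
    simp at this
    exact hd this.symm

theorem wSeries_ne_zero : wSeries ≠ 0 := by
  intro h
  have h1 := coeff_expOf_linear (-1)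
  have h2 := coeff_expOf_linear 1
  have h3 := congrArg (MvPowerSeries.coeff (Finsupp.single (0 : Fin 3) 1)) h
  simp only [map_neg, map_one, neg_mul, one_mul] at h1 h2
  rw [wSeries, map_sub, h1, h2] at h3
  norm_num at h3

theorem constantCoeff_vSeries : MvPowerSeries.constantCoeff vSeries = 1 := by
  have hs : PowerSeries.HasSubst (xx * yy * tt) := by
    apply PowerSeries.HasSubst.of_constantCoeff_zero
    simp
  rw [vSeries, expOf, PowerSeries.constantCoeff_subst hs, finsum_eq_single _ 0]
  · simp
  · intro d hd
    simp [hd]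

theorem vSeries_ne_zero : vSeries ≠ 0 := by
  intro h
  have := constantCoeff_vSeries
  rw [h] at this
  simp at this

/-- The ring homomorphism from `ℤ[v^{±1}, z, w^{±1}]` given by `v ↦ e^{xyt}`,
`w ↦ e^{-x} - e^x`, `z ↦ e^{-y} - e^y`. -/
def substitution : HomflyptRing →+* SeriesField :=
  LaurentPolynomial.eval₂
    (LaurentPolynomial.eval₂
      (Polynomial.eval₂RingHom (Int.castRingHom SeriesField) (algebraMap _ SeriesField zSeries))
      (Units.mk0 (algebraMap _ SeriesField wSeries)
        ((map_ne_zero_iff _ (IsFractionRing.injective _ _)).2 wSeries_ne_zero)))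
    (Units.mk0 (algebraMap _ SeriesField vSeries)
      ((map_ne_zero_iff _ (IsFractionRing.injective _ _)).2 vSeries_ne_zero))

theorem substitution_v : substitution v = algebraMap _ SeriesField vSeries := by
  simp [substitution, v, LaurentPolynomial.eval₂_T]

theorem substitution_w : substitution w = algebraMap _ SeriesField wSeries := by
  simp [substitution, w, LaurentPolynomial.eval₂_T]

theorem substitution_z : substitution z = algebraMap _ SeriesField zSeries := by
  simp [substitution, z]

end

end HomflyptRing

/-! The skein relations force the value of a diagram. Along a traversal (an order of the components
with a base point on each) a crossing is bad if it is first passed under. Removing bad crossings by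
skein relations leads to descending diagrams, whose value is `aₙ`, and to smoothings, which have
fewer crossings. This gives uniqueness. Existence means that the recursion, `evalAlong`, depends
neither on its choices nor on Reidemeister moves.

The order in which bad crossings are removed is immaterial (`evalAlong_of_mem_bad`): resolving two
crossings in either order gives the same expansion, because the numbers of factors `w` and `z` are
governed by the numbers of components (`kindCoeff_smooth_comm`). The skein relation then holds at
every crossing.

Independence of the traversal (`independent`) is an induction on the number of crossings. The
smoothed terms do not involve the traversal, so the upper strands may be chosen conveniently
(`evalAlong_eq_of_setUpper`). A change of base point then amounts to `aₙ = aₙ ∘ aₙ₊₁`. A component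
with a self crossing is split there into two loops, each of which can be deleted. A component
without self crossings is pushed through the others, and the signs of the crossings changed on the
way add up to an intersection number of closed plane curves, which is zero.

Planarity enters only through `Balanced`, the vanishing of such intersection numbers in all
smoothings. It follows from the Euler characteristic by linear algebra: flows on the graph are
boundaries of faces (`isPlanar_iff_flowsBound`, `FlowsBound.balanced`).

Reidemeister moves are treated by `Matching`: if a traversal starts on the top strand of the move,
the crossings there are never bad, and both diagrams run through the same recursion.

For the Vassiliev statements, `L₊ - L₋ = (v² - 1) L₋ + v w L₀` (or `z` for `w`), and after the
substitution `v² - 1`, `w`, `z` all have positive degree in `x` and `y` together, so each double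
point raises the degree (`singularSum_mem_pow`). The `aₙ` become power series because `w` is `x`
times a unit and `x` divides `v² - 1`. Finally the substitution is injective
(`substitution_injective`): `z` involves only `y`, `w` only `x`, and `t` divides `v - 1`. -/

/-! ## Cyclic words of a permutation -/

section Words

variable {P : Type*}

/-- Following `σ` from `p` one meets the letters of the list and then `q`. -/
def Walk (σ : Equiv.Perm P) : P → List P → P → Prop
  | p, [], q => σ p = q
  | p, a :: m, q => σ p = a ∧ Walk σ a m q

theorem walk_append (σ : Equiv.Perm P) (m m' : List P) (p a q : P) :
    Walk σ p (m ++ a :: m') q ↔ Walk σ p m a ∧ Walk σ a m' q := by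
  induction m generalizing p with
  | nil => simp [Walk]
  | cons b m ih => simp [Walk, ih, and_assoc]

theorem map_cons_eq_iff_walk (σ : Equiv.Perm P) (m : List P) (p q : P) :
    (p :: m).map σ = m ++ [q] ↔ Walk σ p m q := by
  induction m generalizing p with
  | nil => simp [Walk]
  | cons b m ih =>
    rw [List.map_cons, List.cons_append, List.cons.injEq, ih, Walk]

/-- `w` lists a cycle of `σ` (the empty word is allowed). -/
def IsCycleWord (σ : Equiv.Perm P) (w : List P) : Prop := w.map σ = w.rotate 1

theorem isCycleWord_rotate (σ : Equiv.Perm P) (w : List P) (n : ℕ) :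
    IsCycleWord σ (w.rotate n) ↔ IsCycleWord σ w := by
  unfold IsCycleWord
  rw [List.map_rotate, List.rotate_rotate, add_comm, ← List.rotate_rotate]
  exact (List.rotate_injective n).eq_iff

theorem isCycleWord_append_comm (σ : Equiv.Perm P) (u r : List P) :
    IsCycleWord σ (u ++ r) ↔ IsCycleWord σ (r ++ u) := by
  rw [← List.rotate_append_length_eq u r, isCycleWord_rotate]

theorem isCycleWord_cons (σ : Equiv.Perm P) (p : P) (m : List P) :
    IsCycleWord σ (p :: m) ↔ Walk σ p m p := by
  unfold IsCycleWord
  rw [← map_cons_eq_iff_walk]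
  simp

theorem isCycleWord_append_cons (σ : Equiv.Perm P) (u r : List P) (p : P) :
    IsCycleWord σ (u ++ p :: r) ↔ Walk σ p (r ++ u) p := by
  rw [isCycleWord_append_comm, List.cons_append, isCycleWord_cons]

theorem isCycleWord_nil (σ : Equiv.Perm P) : IsCycleWord σ [] := by
  simp [IsCycleWord]

theorem IsCycleWord.apply_mem {σ : Equiv.Perm P} {w : List P} (h : IsCycleWord σ w) {p : P}
    (hp : p ∈ w) : σ p ∈ w := by
  have : σ p ∈ w.map σ := List.mem_map_of_mem hp
  rw [h] at this
  exact List.mem_rotate.1 this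

theorem IsCycleWord.apply_mem_iff {σ : Equiv.Perm P} {w : List P} (h : IsCycleWord σ w) {p : P} :
    σ p ∈ w ↔ p ∈ w := by
  refine ⟨fun hp => ?_, h.apply_mem⟩
  have : σ p ∈ w.map σ := by rw [h]; exact List.mem_rotate.2 hp
  obtain ⟨q, hq, hqp⟩ := List.mem_map.1 this
  exact σ.injective hqp ▸ hq

theorem Walk.sameCycle {σ : Equiv.Perm P} {p q : P} {m : List P} (h : Walk σ p m q) :
    σ.SameCycle p q ∧ ∀ a ∈ m, σ.SameCycle p a := by
  induction m generalizing p with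
  | nil =>
    have h : σ p = q := h
    exact ⟨⟨1, by simp [h]⟩, by simp⟩
  | cons b m ih =>
    obtain ⟨h1, h2⟩ := h
    have h3 : σ.SameCycle p b := ⟨1, by simp [h1]⟩
    obtain ⟨h4, h5⟩ := ih h2
    refine ⟨h3.trans h4, fun a ha => ?_⟩
    rcases List.mem_cons.1 ha with rfl | ha
    · exact h3
    · exact h3.trans (h5 a ha)

theorem IsCycleWord.sameCycle {σ : Equiv.Perm P} {w : List P} (h : IsCycleWord σ w) {p q : P}
    (hp : p ∈ w) (hq : q ∈ w) : σ.SameCycle p q := by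
  obtain ⟨u, r, rfl⟩ := List.append_of_mem hp
  rw [isCycleWord_append_cons] at h
  obtain ⟨h1, h2⟩ := h.sameCycle
  simp only [List.mem_append, List.mem_cons] at hq
  rcases hq with hq | rfl | hq
  · exact h2 q (by simp [hq])
  · exact h1
  · exact h2 q (by simp [hq])

theorem IsCycleWord.mem_of_sameCycle {σ : Equiv.Perm P} {w : List P} (h : IsCycleWord σ w) {p q : P}
    (hp : p ∈ w) (hpq : σ.SameCycle p q) : q ∈ w := by
  obtain ⟨i, rfl⟩ := hpq
  induction i with
  | zero => simpa using hp
  | succ i ih =>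
    rw [add_comm, zpow_add, zpow_one, Equiv.Perm.mul_apply]
    exact h.apply_mem ih
  | pred i ih =>
    rw [← h.apply_mem_iff, ← Equiv.Perm.mul_apply, ← zpow_one_add]
    convert ih using 3
    ring

/-- Multiplication by a transposition exchanges the continuations of a walk. -/
theorem Walk.mul_swap [DecidableEq P] {σ : Equiv.Perm P} {p p' q : P} {m : List P}
    (h : Walk σ p m q) (hp : p ∉ m) (hp' : p' ∉ m) :
    Walk (σ * Equiv.swap p p') p' m q := by
  -- Away from `p` and `p'` the two permutations agree, so only the first step of the walk, out of
  -- `p'`, sees the transposition.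
  have aux : ∀ (m : List P) (a : P), a ≠ p → a ≠ p' → p ∉ m → p' ∉ m → Walk σ a m q →
      Walk (σ * Equiv.swap p p') a m q := by
    intro m
    induction m with
    | nil =>
      intro a h1 h2 _ _ h
      change σ (Equiv.swap p p' a) = q
      rw [Equiv.swap_apply_of_ne_of_ne h1 h2]
      exact h
    | cons b m ih =>
      intro a h1 h2 h3 h4 h
      simp only [List.mem_cons, not_or] at h3 h4
      refine ⟨?_, ih b (Ne.symm h3.1) (Ne.symm h4.1) h3.2 h4.2 h.2⟩
      change σ (Equiv.swap p p' a) = b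
      rw [Equiv.swap_apply_of_ne_of_ne h1 h2]
      exact h.1
  cases m with
  | nil =>
    change σ (Equiv.swap p p' p') = q
    rw [Equiv.swap_apply_right]
    exact h
  | cons b m =>
    simp only [List.mem_cons, not_or] at hp hp'
    refine ⟨?_, aux m b (Ne.symm hp.1) (Ne.symm hp'.1) hp.2 hp'.2 h.2⟩
    change σ (Equiv.swap p p' p') = b
    rw [Equiv.swap_apply_right]
    exact h.1

theorem IsCycleWord.of_forall_eq {σ τ : Equiv.Perm P} {w : List P} (h : IsCycleWord σ w)
    (e : ∀ p ∈ w, τ p = σ p) : IsCycleWord τ w := by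
  unfold IsCycleWord at *
  rw [← h]
  exact List.map_congr_left e

/-! ## Traversals -/

/-- `l` lists the cycles of `σ`, together with some empty words. -/
structure IsTrav (σ : Equiv.Perm P) (l : List (List P)) : Prop where
  cyc : ∀ w ∈ l, IsCycleWord σ w
  nodup : l.flatten.Nodup
  mem : ∀ p, p ∈ l.flatten

/-- The words obtained by cutting the word `u p t p' r` at `p` and `p'`; `m` tells which of the two
pieces comes first. -/
def selfCut (m : Bool) (p p' : P) (L₁ : List (List P)) (u t r : List P) (L₂ : List (List P)) :
    List (List P) :=
  if m then L₁ ++ (u ++ p :: r) :: (t ++ [p']) :: L₂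
  else L₁ ++ (t ++ [p']) :: (u ++ p :: r) :: L₂

/-- The words obtained by merging the words `u p r` and `t p' s`; `m` tells the place of the merged
word. -/
def mixedCut (m : Bool) (p p' : P) (L₁ : List (List P)) (u r : List P) (L₂ : List (List P))
    (t s : List P) (L₃ : List (List P)) : List (List P) :=
  if m then L₁ ++ (u ++ p :: (s ++ t ++ p' :: r)) :: (L₂ ++ L₃)
  else L₁ ++ (L₂ ++ (t ++ p' :: (r ++ u ++ p :: s)) :: L₃)

/-- The transposition exchanges the successors of `p` and `p'`, so their common cycle falls into
two. The choice of `m` will keep an initial stretch (`true`) or a final stretch (`false`) of the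
traversal intact. -/
theorem IsTrav.selfCut [DecidableEq P] {σ : Equiv.Perm P} {p p' : P} {L₁ : List (List P)}
    {u t r : List P} {L₂ : List (List P)}
    (h : IsTrav σ (L₁ ++ (u ++ p :: (t ++ p' :: r)) :: L₂)) (m : Bool) :
    IsTrav (σ * Equiv.swap p p') (selfCut m p p' L₁ u t r L₂) := by
  have hperm : (_root_.selfCut m p p' L₁ u t r L₂).flatten.Perm
      (L₁ ++ (u ++ p :: (t ++ p' :: r)) :: L₂).flatten := by
    classical
    rw [List.perm_iff_count]
    intro a
    cases m <;> simp [_root_.selfCut, List.count_cons] <;> omega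
  have hnd := h.nodup
  have hnd' := hnd
  simp only [List.flatten_append, List.flatten_cons, List.nodup_append, List.nodup_cons,
    List.mem_append, List.mem_cons, List.append_assoc, List.cons_append] at hnd'
  obtain ⟨-, ⟨-, ⟨hp1, ⟨-, ⟨hq1, -⟩, ht2⟩⟩, hu⟩, hL⟩ := hnd'
  push Not at hp1 hq1
  have hc : IsCycleWord σ (u ++ p :: (t ++ p' :: r)) := h.cyc _ (by simp)
  rw [isCycleWord_append_cons, List.append_assoc, List.cons_append, walk_append] at hc
  obtain ⟨hc1, hc2⟩ := hc
  have hpu : p ∉ u := fun hh => hu p hh p (by simp) rfl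
  have hqu : p' ∉ u := fun hh => hu p' hh p' (by simp) rfl
  have hqt : p' ∉ t := fun hh => ht2 p' hh p' (by simp) rfl
  have e1 : IsCycleWord (σ * Equiv.swap p p') (u ++ p :: r) := by
    rw [isCycleWord_append_cons, Equiv.swap_comm]
    exact hc2.mul_swap (by simp [hq1, hqu]) (by simp [hp1, hpu])
  have e2 : IsCycleWord (σ * Equiv.swap p p') (t ++ [p']) := by
    rw [isCycleWord_append_cons]
    exact hc1.mul_swap (by simp [hp1]) (by simp [hqt])
  have hother : ∀ w ∈ L₁ ++ L₂, IsCycleWord (σ * Equiv.swap p p') w := by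
    intro w hw
    refine (h.cyc w (by simp only [List.mem_append, List.mem_cons] at hw ⊢; tauto)).of_forall_eq ?_
    intro q hq
    rw [Equiv.Perm.mul_apply, Equiv.swap_apply_of_ne_of_ne]
    · rintro rfl
      rcases List.mem_append.1 hw with hw | hw
      · exact hL q (List.mem_flatten.2 ⟨w, hw, hq⟩) q (by simp) rfl
      · exact hp1.2.2.2 (List.mem_flatten.2 ⟨w, hw, hq⟩)
    · rintro rfl
      rcases List.mem_append.1 hw with hw | hw
      · exact hL q (List.mem_flatten.2 ⟨w, hw, hq⟩) q (by simp) rfl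
      · exact hq1.2 (List.mem_flatten.2 ⟨w, hw, hq⟩)
  refine ⟨fun w hw => ?_, hperm.nodup_iff.2 hnd, fun q => hperm.mem_iff.2 (h.mem q)⟩
  have : w = u ++ p :: r ∨ w = t ++ [p'] ∨ w ∈ L₁ ++ L₂ := by
    cases m <;> simp [_root_.selfCut] at hw ⊢ <;> tauto
  rcases this with rfl | rfl | hw
  · exact e1
  · exact e2
  · exact hother w hw

/-- Exchanging the successors of letters in two cycles splices these into one; either place may be
given to the merged word, with the same purpose for `m` as in `IsTrav.selfCut`. -/
theorem IsTrav.mixedCut [DecidableEq P] {σ : Equiv.Perm P} {p p' : P} {L₁ : List (List P)}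
    {u r : List P} {L₂ : List (List P)} {t s : List P} {L₃ : List (List P)}
    (h : IsTrav σ (L₁ ++ (u ++ p :: r) :: (L₂ ++ (t ++ p' :: s) :: L₃))) (m : Bool) :
    IsTrav (σ * Equiv.swap p p') (mixedCut m p p' L₁ u r L₂ t s L₃) := by
  have hperm : (_root_.mixedCut m p p' L₁ u r L₂ t s L₃).flatten.Perm
      (L₁ ++ (u ++ p :: r) :: (L₂ ++ (t ++ p' :: s) :: L₃)).flatten := by
    classical
    rw [List.perm_iff_count]
    intro a
    cases m <;> simp [_root_.mixedCut, List.count_cons] <;> omega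
  have hnd := h.nodup
  have hnd' : (p :: p' :: (u ++ r ++ t ++ s ++ L₁.flatten ++ L₂.flatten ++ L₃.flatten)).Nodup := by
    refine (List.Perm.nodup_iff ?_).2 hnd
    classical
    rw [List.perm_iff_count]
    intro a
    simp [List.count_cons]; omega
  simp only [List.nodup_cons, List.mem_cons, List.mem_append, not_or] at hnd'
  obtain ⟨⟨hpp, ⟨⟨⟨⟨⟨hpu, hpr⟩, hpt⟩, hps⟩, hp1⟩, hp2⟩, hp3⟩,
    ⟨⟨⟨⟨⟨⟨hqu, hqr⟩, hqt⟩, hqs⟩, hq1⟩, hq2⟩, hq3⟩, -⟩ := hnd'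
  have hc : IsCycleWord σ (u ++ p :: r) := h.cyc _ (by simp)
  have hc' : IsCycleWord σ (t ++ p' :: s) := h.cyc _ (by simp)
  rw [isCycleWord_append_cons] at hc hc'
  have w1 : Walk (σ * Equiv.swap p p') p' (r ++ u) p :=
    hc.mul_swap (by simp [hpu, hpr]) (by simp [hqu, hqr])
  have w2 : Walk (σ * Equiv.swap p p') p (s ++ t) p' := by
    rw [Equiv.swap_comm]
    exact hc'.mul_swap (by simp [hqt, hqs]) (by simp [hpt, hps])
  have e1 : IsCycleWord (σ * Equiv.swap p p') (u ++ p :: (s ++ t ++ p' :: r)) := by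
    rw [isCycleWord_append_cons, List.append_assoc, List.cons_append, walk_append]
    exact ⟨w2, w1⟩
  have e2 : IsCycleWord (σ * Equiv.swap p p') (t ++ p' :: (r ++ u ++ p :: s)) := by
    rw [isCycleWord_append_cons, List.append_assoc, List.cons_append, walk_append]
    exact ⟨w1, w2⟩
  have hother : ∀ w ∈ L₁ ++ L₂ ++ L₃, IsCycleWord (σ * Equiv.swap p p') w := by
    intro w hw
    refine (h.cyc w (by simp only [List.mem_append, List.mem_cons] at hw ⊢; tauto)).of_forall_eq ?_
    intro q hq
    have hq' : q ∈ L₁.flatten ∨ q ∈ L₂.flatten ∨ q ∈ L₃.flatten := by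
      simp only [List.mem_append] at hw
      rcases hw with (hw | hw) | hw
      · exact Or.inl (List.mem_flatten.2 ⟨w, hw, hq⟩)
      · exact Or.inr (Or.inl (List.mem_flatten.2 ⟨w, hw, hq⟩))
      · exact Or.inr (Or.inr (List.mem_flatten.2 ⟨w, hw, hq⟩))
    rw [Equiv.Perm.mul_apply, Equiv.swap_apply_of_ne_of_ne]
    · rintro rfl; tauto
    · rintro rfl; tauto
  refine ⟨fun w hw => ?_, hperm.nodup_iff.2 hnd, fun q => hperm.mem_iff.2 (h.mem q)⟩
  have : w = u ++ p :: (s ++ t ++ p' :: r) ∨ w = t ++ p' :: (r ++ u ++ p :: s) ∨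
      w ∈ L₁ ++ L₂ ++ L₃ := by
    cases m
    · simp only [_root_.mixedCut, Bool.false_eq_true, if_false, List.mem_append, List.mem_cons] at hw ⊢
      tauto
    · simp only [_root_.mixedCut, if_true, List.mem_append, List.mem_cons] at hw ⊢
      tauto
  rcases this with rfl | rfl | hw
  · exact e1
  · exact e2
  · exact hother w hw

/-- Two letters lie in the same word or in different words of a list of words. -/
theorem exists_cut {l : List (List P)} {q q' : P} (hq : q ∈ l.flatten) (hq' : q' ∈ l.flatten)
    (hne : q ≠ q') :
    ∃ p p', ((p = q ∧ p' = q') ∨ (p = q' ∧ p' = q)) ∧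
      ((∃ L₁ u t r L₂, l = L₁ ++ (u ++ p :: (t ++ p' :: r)) :: L₂) ∨
        ∃ L₁ u r L₂ t s L₃, l = L₁ ++ (u ++ p :: r) :: (L₂ ++ (t ++ p' :: s) :: L₃)) := by
  obtain ⟨w, hw, hqw⟩ := List.mem_flatten.1 hq
  obtain ⟨w', hw', hqw'⟩ := List.mem_flatten.1 hq'
  have main : ∀ {a b : P} {u r : List P}, b ∈ r →
      ∃ t s, u ++ a :: r = u ++ a :: (t ++ b :: s) := by
    intro a b u r hb
    obtain ⟨t, s, rfl⟩ := List.append_of_mem hb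
    exact ⟨t, s, rfl⟩
  obtain ⟨M₁, M₂, rfl⟩ := List.append_of_mem hw
  obtain ⟨u, r, rfl⟩ := List.append_of_mem hqw
  simp only [List.mem_append, List.mem_cons] at hw'
  rcases hw' with hw' | rfl | hw'
  · obtain ⟨N₁, N₂, rfl⟩ := List.append_of_mem hw'
    obtain ⟨u', r', rfl⟩ := List.append_of_mem hqw'
    exact ⟨q', q, Or.inr ⟨rfl, rfl⟩, Or.inr ⟨N₁, u', r', N₂, u, r, M₂, by simp⟩⟩
  · simp only [List.mem_append, List.mem_cons] at hqw'
    rcases hqw' with h | h | h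
    · obtain ⟨t, s, rfl⟩ := List.append_of_mem h
      exact ⟨q', q, Or.inr ⟨rfl, rfl⟩, Or.inl ⟨M₁, t, s, r, M₂, by simp⟩⟩
    · exact absurd h.symm hne
    · obtain ⟨t, s, e⟩ := main (a := q) (u := u) h
      exact ⟨q, q', Or.inl ⟨rfl, rfl⟩, Or.inl ⟨M₁, u, t, s, M₂, by rw [e]⟩⟩
  · obtain ⟨N₁, N₂, rfl⟩ := List.append_of_mem hw'
    obtain ⟨u', r', rfl⟩ := List.append_of_mem hqw'
    exact ⟨q, q', Or.inl ⟨rfl, rfl⟩, Or.inr ⟨M₁, u, r, N₁, u', r', N₂, rfl⟩⟩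

theorem IsTrav.sameCycle_of_self {σ : Equiv.Perm P} {p p' : P} {L₁ : List (List P)}
    {u t r : List P} {L₂ : List (List P)}
    (h : IsTrav σ (L₁ ++ (u ++ p :: (t ++ p' :: r)) :: L₂)) : σ.SameCycle p p' :=
  (h.cyc (u ++ p :: (t ++ p' :: r)) (by simp)).sameCycle (by simp) (by simp)

theorem IsTrav.not_sameCycle_of_mixed {σ : Equiv.Perm P} {p p' : P} {L₁ : List (List P)}
    {u r : List P} {L₂ : List (List P)} {t s : List P} {L₃ : List (List P)}
    (h : IsTrav σ (L₁ ++ (u ++ p :: r) :: (L₂ ++ (t ++ p' :: s) :: L₃))) :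
    ¬ σ.SameCycle p p' := by
  intro hs
  have h1 := (h.cyc (u ++ p :: r) (by simp)).mem_of_sameCycle (by simp) hs
  have h2 := h.nodup
  simp only [List.flatten_append, List.flatten_cons, List.nodup_append] at h2
  exact h2.2.1.2.2 p' h1 p' (by simp) rfl

/-- Induction over a factorisation of `σ` into transpositions: each factor cuts or merges words, and
neither operation creates an empty word. The `k` appended empty words stand for components without
crossings, which `σ` does not see. -/
theorem exists_isTrav [Finite P] (σ : Equiv.Perm P) (k : ℕ) :
    ∃ l, IsTrav σ l ∧ ([] : List P) ∉ l ∧ IsTrav σ (l ++ List.replicate k []) := by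
  classical
  have key : ∃ l, IsTrav σ l ∧ ([] : List P) ∉ l := by
    induction σ using Equiv.Perm.swap_induction_on' with
    | one =>
      have := Fintype.ofFinite P
      refine ⟨Finset.univ.toList.map fun p => [p], ⟨?_, ?_, ?_⟩, by simp⟩
      · simp only [List.mem_map, Finset.mem_toList, Finset.mem_univ, true_and]
        rintro w ⟨p, rfl⟩
        simp [IsCycleWord]
      · have : ((Finset.univ : Finset P).toList.map fun p => [p]).flatten = Finset.univ.toList := by
          generalize (Finset.univ : Finset P).toList = L
          induction L with
          | nil => rfl
          | cons a L ih => simp_all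
        rw [this]
        exact Finset.nodup_toList _
      · intro p
        exact List.mem_flatten.2 ⟨[p], by simp⟩
    | mul_swap f x y hxy ih =>
      obtain ⟨l, hl, hne⟩ := ih
      obtain ⟨p, p', hp, hcut⟩ := exists_cut (hl.mem x) (hl.mem y) hxy
      have e : Equiv.swap x y = Equiv.swap p p' := by
        rcases hp with ⟨rfl, rfl⟩ | ⟨rfl, rfl⟩
        · rfl
        · exact Equiv.swap_comm _ _
      rw [e]
      rcases hcut with ⟨L₁, u, t, r, L₂, rfl⟩ | ⟨L₁, u, r, L₂, t, s, L₃, rfl⟩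
      · refine ⟨_, hl.selfCut true, ?_⟩
        simp [selfCut] at hne ⊢
        tauto
      · refine ⟨_, hl.mixedCut true, ?_⟩
        simp [mixedCut] at hne ⊢
        tauto
  obtain ⟨l, hl, hne⟩ := key
  refine ⟨l, hl, hne, ⟨?_, ?_, ?_⟩⟩
  · intro w hw
    rcases List.mem_append.1 hw with hw | hw
    · exact hl.cyc w hw
    · rw [List.eq_of_mem_replicate hw]
      exact isCycleWord_nil σ
  · simpa using hl.nodup
  · intro p
    simpa using hl.mem p

/-- Nonempty words correspond bijectively to cycles, by the cycle of the first letter. -/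
theorem IsTrav.length_eq {σ : Equiv.Perm P} {l : List (List P)}
    (h : IsTrav σ l) :
    l.length = l.countP List.isEmpty + Nat.card (Quotient (Equiv.Perm.SameCycle.setoid σ)) := by
  classical
  have h1 : l.length = l.countP List.isEmpty + (l.filter (· ≠ [])).length := by
    rw [List.length_eq_length_filter_add (l := l) List.isEmpty, List.countP_eq_length_filter]
    congr 2
    apply List.filter_congr
    intro x _
    cases x <;> simp
  have hnd : (l.filter (· ≠ [])).Nodup := by
    have h2 : l.Pairwise List.Disjoint := (List.nodup_flatten.1 h.nodup).2
    have h3 : (l.filter (· ≠ [])).Pairwise List.Disjoint := h2.sublist List.filter_sublist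
    refine List.Pairwise.imp_of_mem ?_ h3
    intro a b ha _ hab e
    subst e
    have : a ≠ [] := by simpa using (List.mem_filter.1 ha).2
    obtain ⟨x, hx⟩ := List.exists_mem_of_ne_nil a this
    exact hab hx hx
  have hne : ∀ w : {w // w ∈ (l.filter (· ≠ [])).toFinset}, w.1 ≠ [] := by
    rintro ⟨w, hw⟩
    simpa using (List.mem_filter.1 (List.mem_toFinset.1 hw)).2
  have hml : ∀ w : {w // w ∈ (l.filter (· ≠ [])).toFinset}, w.1 ∈ l := by
    rintro ⟨w, hw⟩
    exact (List.mem_filter.1 (List.mem_toFinset.1 hw)).1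
  let f : {w // w ∈ (l.filter (· ≠ [])).toFinset} → Quotient (Equiv.Perm.SameCycle.setoid σ) :=
    fun w => Quotient.mk _ (w.1.head (hne w))
  have hf : Function.Bijective f := by
    constructor
    · intro w w' e
      have e' : σ.SameCycle (w.1.head (hne w)) (w'.1.head (hne w')) := Quotient.exact e
      have h4 := (h.cyc _ (hml w)).mem_of_sameCycle (List.head_mem (hne w)) e'
      have h5 := List.head_mem (hne w')
      by_contra hc
      have hc' : w.1 ≠ w'.1 := fun hh => hc (Subtype.ext hh)
      have h2 : l.Pairwise List.Disjoint := (List.nodup_flatten.1 h.nodup).2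
      exact (have : Std.Symm (List.Disjoint (α := P)) := ⟨fun _ _ hd => hd.symm⟩
      h2.forall (hml w) (hml w') hc') h4 h5
    · intro c
      induction c using Quotient.inductionOn with
      | h p =>
        obtain ⟨w, hw, hp⟩ := List.mem_flatten.1 (h.mem p)
        have hw0 : w ≠ [] := List.ne_nil_of_mem hp
        refine ⟨⟨w, by simp [hw, hw0]⟩, Quotient.sound ?_⟩
        exact (h.cyc w hw).sameCycle (List.head_mem hw0) hp
  rw [h1, ← Nat.card_eq_of_bijective f hf, Nat.card_eq_fintype_card, Fintype.card_coe,
    List.toFinset_card_of_nodup hnd]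

theorem countP_selfCut (m : Bool) (p p' : P) (L₁ : List (List P))
    (u t r : List P) (L₂ : List (List P)) :
    (selfCut m p p' L₁ u t r L₂).countP List.isEmpty =
      (L₁ ++ (u ++ p :: (t ++ p' :: r)) :: L₂).countP List.isEmpty := by
  cases m <;> simp [selfCut]

theorem countP_mixedCut (m : Bool) (p p' : P) (L₁ : List (List P))
    (u r : List P) (L₂ : List (List P)) (t s : List P) (L₃ : List (List P)) :
    (mixedCut m p p' L₁ u r L₂ t s L₃).countP List.isEmpty =
      (L₁ ++ (u ++ p :: r) :: (L₂ ++ (t ++ p' :: s) :: L₃)).countP List.isEmpty := by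
  cases m <;> simp [mixedCut]

theorem length_selfCut (m : Bool) (p p' : P) (L₁ : List (List P))
    (u t r : List P) (L₂ : List (List P)) :
    (selfCut m p p' L₁ u t r L₂).length =
      (L₁ ++ (u ++ p :: (t ++ p' :: r)) :: L₂).length + 1 := by
  cases m <;> simp [selfCut] <;> omega

theorem length_mixedCut (m : Bool) (p p' : P) (L₁ : List (List P))
    (u r : List P) (L₂ : List (List P)) (t s : List P) (L₃ : List (List P)) :
    (mixedCut m p p' L₁ u r L₂ t s L₃).length + 1 =
      (L₁ ++ (u ++ p :: r) :: (L₂ ++ (t ++ p' :: s) :: L₃)).length := by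
  cases m <;> simp [mixedCut] <;> omega

theorem IsTrav.perm {σ : Equiv.Perm P} {l l' : List (List P)} (h : IsTrav σ l) (hp : l.Perm l') :
    IsTrav σ l' :=
  ⟨fun w hw => h.cyc w (hp.mem_iff.2 hw), hp.flatten.nodup_iff.1 h.nodup,
    fun p => hp.flatten.mem_iff.1 (h.mem p)⟩

theorem IsTrav.rotate_word {σ : Equiv.Perm P} {L₁ L₂ : List (List P)} {u r : List P}
    (h : IsTrav σ (L₁ ++ (u ++ r) :: L₂)) : IsTrav σ (L₁ ++ (r ++ u) :: L₂) := by
  have hp : (L₁ ++ (u ++ r) :: L₂).flatten.Perm (L₁ ++ (r ++ u) :: L₂).flatten := by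
    simp only [List.flatten_append, List.flatten_cons]
    exact (List.perm_append_comm.append_right _).append_left _
  refine ⟨fun w hw => ?_, hp.nodup_iff.1 h.nodup, fun p => hp.mem_iff.1 (h.mem p)⟩
  simp only [List.mem_append, List.mem_cons] at hw
  rcases hw with hw | rfl | hw
  · exact h.cyc w (by simp [hw])
  · exact (isCycleWord_append_comm σ u r).1 (h.cyc _ (by simp))
  · exact h.cyc w (by simp [hw])

/-! ### Order of two letters -/

theorem pair_sublist_append {p q : P} {A B : List P} :
    [p, q].Sublist (A ++ B) ↔ [p, q].Sublist A ∨ [p, q].Sublist B ∨ (p ∈ A ∧ q ∈ B) := by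
  constructor
  · intro h
    obtain ⟨a, b, hab, ha, hb⟩ := List.sublist_append_iff.1 h
    match a, hab with
    | [], hab => exact Or.inr (Or.inl (by simpa [hab] using hb))
    | [x], hab =>
      simp only [List.cons_append, List.nil_append, List.cons.injEq] at hab
      obtain ⟨rfl, rfl⟩ := hab
      exact Or.inr (Or.inr ⟨by simpa using ha, by simpa using hb⟩)
    | [x, y], hab =>
      simp only [List.cons_append, List.nil_append, List.cons.injEq] at hab
      obtain ⟨rfl, rfl, -⟩ := hab
      exact Or.inl ha
    | x :: y :: z :: a, hab => simp at hab
  · rintro (h | h | ⟨h1, h2⟩)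
    · exact h.trans (List.sublist_append_left A B)
    · exact h.trans (List.sublist_append_right A B)
    · have := (List.singleton_sublist.2 h1).append (List.singleton_sublist.2 h2)
      simpa using this

theorem pair_sublist_asymm {p q : P} {A : List P} (hA : A.Nodup) (h : [p, q].Sublist A) :
    ¬ [q, p].Sublist A := by
  induction A with
  | nil => simp at h
  | cons a A ih =>
    intro h'
    rw [List.nodup_cons] at hA
    rcases h with _ | h | h
    · rename_i h
      rcases h' with _ | h' | h'
      · rename_i h'
        exact ih hA.2 h h'
      · rename_i h'
        exact hA.1 (h.subset (by simp))
    · rename_i h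
      rcases h' with _ | h' | h'
      · rename_i h'
        exact hA.1 (h'.subset (by simp))
      · rename_i h'
        exact hA.1 (by simpa using h)

theorem pair_sublist_total {p q : P} {A : List P} (hp : p ∈ A) (hq : q ∈ A) (hne : p ≠ q) :
    [p, q].Sublist A ∨ [q, p].Sublist A := by
  obtain ⟨u, r, rfl⟩ := List.append_of_mem hp
  simp only [List.mem_append, List.mem_cons] at hq
  rcases hq with hq | hq | hq
  · exact Or.inr (pair_sublist_append.2 (Or.inr (Or.inr ⟨hq, by simp⟩)))
  · exact absurd hq.symm hne
  · refine Or.inl (pair_sublist_append.2 (Or.inr (Or.inl ?_)))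
    simpa using hq

theorem pair_sublist_filter {p q : P} {A : List P} {f : P → Bool} (hp : f p) (hq : f q) :
    [p, q].Sublist A ↔ [p, q].Sublist (A.filter f) := by
  refine ⟨fun h => ?_, fun h => h.trans List.filter_sublist⟩
  have := h.filter f
  simpa [hp, hq] using this

theorem pair_sublist_left {p q : P} {A B : List P} (h : [p, q].Sublist (A ++ B))
    (hnd : (A ++ B).Nodup) (hq : q ∈ A) : [p, q].Sublist A := by
  have hd := (List.nodup_append.1 hnd).2.2
  rcases pair_sublist_append.1 h with h | h | ⟨-, h⟩
  · exact h
  · exact absurd rfl (hd q hq q (h.subset (by simp)))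
  · exact absurd rfl (hd q hq q h)

theorem pair_sublist_right {p q : P} {A B : List P} (h : [p, q].Sublist (A ++ B))
    (hnd : (A ++ B).Nodup) (hp : p ∈ B) : [p, q].Sublist B := by
  have hd := (List.nodup_append.1 hnd).2.2
  rcases pair_sublist_append.1 h with h | h | ⟨h, -⟩
  · exact absurd rfl (hd p (h.subset (by simp)) p hp)
  · exact h
  · exact absurd rfl (hd p h p hp)

theorem prefix_of_not_mem {s A B : List P} {p : P} (h : s <+: A ++ p :: B) (hp : p ∉ s) :
    s <+: A := by
  rcases Nat.lt_or_ge A.length s.length with hl | hl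
  · exfalso
    have h2 : A ++ [p] <+: s :=
      List.prefix_of_prefix_length_le ⟨B, by simp⟩ h (by simpa using hl)
    exact hp (h2.subset (by simp))
  · exact List.prefix_of_prefix_length_le h ⟨p :: B, rfl⟩ hl

theorem suffix_of_not_mem {s A B : List P} {p : P} (h : s <:+ A ++ p :: B) (hp : p ∉ s) :
    s <:+ B := by
  rw [← List.reverse_prefix] at h ⊢
  refine prefix_of_not_mem (A := B.reverse) (B := A.reverse) (p := p) ?_ (by simpa using hp)
  simpa using h

end Words

/-! ## Marked diagrams -/

/-- A Gauss diagram in which only some crossings are active; the passes of the others merely mark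
points on the strands. The sign of the flat crossing refers to the pass `(x, true)` being the upper
one, and `upper x` tells which pass is the upper one. -/
@[ext]
structure MarkedDiagram (Y : Type) where
  next : Equiv.Perm (Y × Bool)
  flat : Y → ℤˣ
  upper : Y → Bool
  active : Finset Y
  circles : ℕ

/-- The coefficients of a linear skein relation. -/
structure SkeinData (R : Type*) [CommRing R] where
  v : R
  vInv : R
  w : R
  z : R
  a : ℕ → R
  v_mul_vInv : v * vInv = 1
  a_eq : ∀ n, 1 ≤ n → a n = v ^ 2 * a n + v * w * a (n + 1)

namespace MarkedDiagram

variable {Y : Type} [DecidableEq Y]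

/-- The sign of a crossing. -/
def sgn (D : MarkedDiagram Y) (x : Y) : ℤˣ := D.flat x * if D.upper x then 1 else -1

/-- Both passes of the crossing lie on one component. -/
def IsSelf (D : MarkedDiagram Y) (x : Y) : Prop := D.next.SameCycle (x, true) (x, false)

/-- The crossing change at `x`. -/
def flip (D : MarkedDiagram Y) (x : Y) : MarkedDiagram Y :=
  { D with upper := Function.update D.upper x (!D.upper x) }

/-- The smoothing of the crossing `x`. -/
def smooth (D : MarkedDiagram Y) (x : Y) : MarkedDiagram Y :=
  { D with
    next := D.next * Equiv.swap (x, true) (x, false)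
    -- Resetting `upper` makes the smoothing forget which strand was on top, so that `D` and `D.flip
    -- x` have literally the same smoothing.
    upper := Function.update D.upper x true
    active := D.active.erase x }

/-- Deactivate the crossings in `E`. -/
def delete (D : MarkedDiagram Y) (E : Finset Y) : MarkedDiagram Y :=
  { D with active := D.active \ E }

/-- The number of components. -/
noncomputable def ncomp (D : MarkedDiagram Y) : ℕ :=
  D.circles + Nat.card (Quotient (Equiv.Perm.SameCycle.setoid D.next))

/-- The list contains every component once, circles being represented by empty words. -/
def IsTraversal (D : MarkedDiagram Y) (l : List (List (Y × Bool))) : Prop :=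
  IsTrav D.next l ∧ l.countP List.isEmpty = D.circles

/-- Some traversal. -/
noncomputable def trav (D : MarkedDiagram Y) : List (List (Y × Bool)) :=
  -- A genuine traversal once `Y` is finite; for balanced diagrams it will not matter which one.
  Classical.epsilon D.IsTraversal

/-- The crossings that are first passed under. -/
def bad (D : MarkedDiagram Y) (l : List (List (Y × Bool))) : Finset Y :=
  D.active.filter fun x => [(x, !D.upper x), (x, D.upper x)].Sublist l.flatten

/-- All intersection numbers of pairs of cycles obtained by smoothing crossings vanish. -/
def Balanced (D : MarkedDiagram Y) : Prop :=
  -- The functions `c₁` and `c₂` are constant along the cycles of the diagram smoothed at `S`.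
  -- Quantifying over `S` makes the condition hereditary.
  ∀ S : Finset Y, S ⊆ D.active → ∀ c₁ c₂ : Y × Bool → ℤ,
    (∀ p, c₁ (D.next (GaussDiagram.exchange (S : Set Y) p)) = c₁ p) →
    (∀ p, c₂ (D.next (GaussDiagram.exchange (S : Set Y) p)) = c₂ p) →
    ∑ x ∈ D.active \ S, (D.flat x : ℤ) *
      (c₁ (x, true) * c₂ (x, false) - c₂ (x, true) * c₁ (x, false)) = 0

theorem exists_isTraversal [Finite Y] (D : MarkedDiagram Y) : ∃ l, D.IsTraversal l := by
  obtain ⟨l, -, h1, h2⟩ := exists_isTrav D.next D.circles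
  refine ⟨_, h2, ?_⟩
  rw [List.countP_append, List.countP_eq_zero.2, List.countP_replicate]
  · simp
  · intro w hw hw'
    exact h1 (by rwa [List.isEmpty_iff.1 hw'] at hw)

theorem isTraversal_trav [Finite Y] (D : MarkedDiagram Y) : D.IsTraversal D.trav :=
  Classical.epsilon_spec D.exists_isTraversal

theorem IsTraversal.length_eq {D : MarkedDiagram Y} {l : List (List (Y × Bool))}
    (h : D.IsTraversal l) : l.length = D.ncomp := by
  rw [h.1.length_eq, h.2, ncomp]

@[simp] theorem flip_upper_self (D : MarkedDiagram Y) (x : Y) :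
    (D.flip x).upper x = !D.upper x := by simp [flip]

theorem flip_upper_of_ne (D : MarkedDiagram Y) {x y : Y} (h : y ≠ x) :
    (D.flip x).upper y = D.upper y := by simp [flip, h]

theorem smooth_upper_of_ne (D : MarkedDiagram Y) {x y : Y} (h : y ≠ x) :
    (D.smooth x).upper y = D.upper y := by simp [smooth, h]

@[simp] theorem flip_active (D : MarkedDiagram Y) (x : Y) : (D.flip x).active = D.active := rfl

@[simp] theorem smooth_active (D : MarkedDiagram Y) (x : Y) :
    (D.smooth x).active = D.active.erase x := rfl

@[simp] theorem delete_active (D : MarkedDiagram Y) (E : Finset Y) :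
    (D.delete E).active = D.active \ E := rfl

@[simp] theorem flip_flip (D : MarkedDiagram Y) (x : Y) : (D.flip x).flip x = D := by
  ext1 <;> simp [flip]

theorem flip_comm (D : MarkedDiagram Y) {x y : Y} (h : x ≠ y) :
    (D.flip x).flip y = (D.flip y).flip x := by
  ext1 <;> simp only [flip]
  rw [Function.update_of_ne h.symm, Function.update_of_ne h, Function.update_comm h]

@[simp] theorem smooth_flip_self (D : MarkedDiagram Y) (x : Y) :
    (D.flip x).smooth x = D.smooth x := by
  ext1 <;> simp [flip, smooth]

theorem smooth_flip (D : MarkedDiagram Y) {x y : Y} (h : x ≠ y) :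
    (D.flip x).smooth y = (D.smooth y).flip x := by
  ext1 <;> simp only [flip, smooth]
  rw [Function.update_of_ne h, Function.update_comm h]

theorem smooth_smooth (D : MarkedDiagram Y) {x y : Y} (h : x ≠ y) :
    (D.smooth x).smooth y = (D.smooth y).smooth x := by
  ext1 <;> simp only [smooth]
  · rw [mul_assoc, mul_assoc]
    congr 1
    refine (Equiv.Perm.Disjoint.commute fun p => ?_).eq
    by_cases hp : p.1 = x
    · right
      refine Equiv.swap_apply_of_ne_of_ne ?_ ?_ <;> rintro rfl <;> exact h hp.symm
    · left
      refine Equiv.swap_apply_of_ne_of_ne ?_ ?_ <;> rintro rfl <;> exact hp rfl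
  · rw [Function.update_comm h]
  · rw [Finset.erase_right_comm]

@[simp] theorem sgn_flip_self (D : MarkedDiagram Y) (x : Y) : (D.flip x).sgn x = - D.sgn x := by
  have : (D.flip x).flat x = D.flat x := rfl
  rw [sgn, sgn, flip_upper_self, this]
  cases D.upper x <;> simp

theorem sgn_flip_of_ne (D : MarkedDiagram Y) {x y : Y} (h : y ≠ x) :
    (D.flip x).sgn y = D.sgn y := by
  have : (D.flip x).flat y = D.flat y := rfl
  rw [sgn, sgn, flip_upper_of_ne D h, this]

theorem sgn_smooth_of_ne (D : MarkedDiagram Y) {x y : Y} (h : y ≠ x) :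
    (D.smooth x).sgn y = D.sgn y := by
  have : (D.smooth x).flat y = D.flat y := rfl
  rw [sgn, sgn, smooth_upper_of_ne D h, this]

@[simp] theorem isSelf_flip (D : MarkedDiagram Y) (x y : Y) : (D.flip x).IsSelf y ↔ D.IsSelf y :=
  Iff.rfl

theorem swap_eq (x : Y) (b : Bool) :
    Equiv.swap (x, true) (x, false) = Equiv.swap (x, b) (x, !b) := by
  cases b
  · exact Equiv.swap_comm _ _
  · rfl

theorem isSelf_iff (D : MarkedDiagram Y) (x : Y) (b : Bool) :
    D.IsSelf x ↔ D.next.SameCycle (x, b) (x, !b) := by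
  cases b
  · exact Equiv.Perm.sameCycle_comm
  · rfl

/-- The two passes of a crossing lie in one word or in two words of a traversal. -/
theorem IsTraversal.exists_cut {D : MarkedDiagram Y} {l : List (List (Y × Bool))}
    (h : D.IsTraversal l) (x : Y) : ∃ b,
      (D.IsSelf x ∧ ∃ L₁ u t r L₂, l = L₁ ++ (u ++ (x, b) :: (t ++ (x, !b) :: r)) :: L₂) ∨
      (¬ D.IsSelf x ∧
        ∃ L₁ u r L₂ t s L₃, l = L₁ ++ (u ++ (x, b) :: r) :: (L₂ ++ (t ++ (x, !b) :: s) :: L₃)) := by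
  obtain ⟨p, p', hp, hc⟩ := _root_.exists_cut (h.1.mem (x, true)) (h.1.mem (x, false)) (by simp)
  have key : ∃ b, p = (x, b) ∧ p' = (x, !b) := by
    rcases hp with ⟨rfl, rfl⟩ | ⟨rfl, rfl⟩
    · exact ⟨true, rfl, rfl⟩
    · exact ⟨false, rfl, rfl⟩
  obtain ⟨b, rfl, rfl⟩ := key
  refine ⟨b, ?_⟩
  rcases hc with ⟨L₁, u, t, r, L₂, rfl⟩ | ⟨L₁, u, r, L₂, t, s, L₃, rfl⟩
  · exact Or.inl ⟨(D.isSelf_iff x b).2 h.1.sameCycle_of_self, L₁, u, t, r, L₂, rfl⟩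
  · exact Or.inr ⟨fun hs => h.1.not_sameCycle_of_mixed ((D.isSelf_iff x b).1 hs),
      L₁, u, r, L₂, t, s, L₃, rfl⟩

theorem IsTraversal.selfCut {D : MarkedDiagram Y} {x : Y} {b : Bool}
    {L₁ : List (List (Y × Bool))} {u t r : List (Y × Bool)} {L₂ : List (List (Y × Bool))}
    (h : D.IsTraversal (L₁ ++ (u ++ (x, b) :: (t ++ (x, !b) :: r)) :: L₂)) (m : Bool) :
    (D.smooth x).IsTraversal (_root_.selfCut m (x, b) (x, !b) L₁ u t r L₂) := by
  refine ⟨?_, (countP_selfCut _ _ _ _ _ _ _ _).trans h.2⟩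
  change IsTrav (D.next * Equiv.swap (x, true) (x, false)) _
  rw [swap_eq x b]
  exact h.1.selfCut m

theorem IsTraversal.mixedCut {D : MarkedDiagram Y} {x : Y} {b : Bool}
    {L₁ : List (List (Y × Bool))} {u r : List (Y × Bool)} {L₂ : List (List (Y × Bool))}
    {t s : List (Y × Bool)} {L₃ : List (List (Y × Bool))}
    (h : D.IsTraversal (L₁ ++ (u ++ (x, b) :: r) :: (L₂ ++ (t ++ (x, !b) :: s) :: L₃)))
    (m : Bool) :
    (D.smooth x).IsTraversal (_root_.mixedCut m (x, b) (x, !b) L₁ u r L₂ t s L₃) := by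
  refine ⟨?_, (countP_mixedCut _ _ _ _ _ _ _ _ _ _).trans h.2⟩
  change IsTrav (D.next * Equiv.swap (x, true) (x, false)) _
  rw [swap_eq x b]
  exact h.1.mixedCut m

theorem ncomp_smooth_of_isSelf [Finite Y] {D : MarkedDiagram Y} {x : Y} (h : D.IsSelf x) :
    (D.smooth x).ncomp = D.ncomp + 1 := by
  have ht := D.isTraversal_trav
  obtain ⟨b, ⟨-, L₁, u, t, r, L₂, e⟩ | ⟨hn, -⟩⟩ := ht.exists_cut x
  · rw [e] at ht
    rw [← (ht.selfCut true).length_eq, ← ht.length_eq, length_selfCut]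
  · exact absurd h hn

theorem ncomp_smooth_of_not_isSelf [Finite Y] {D : MarkedDiagram Y} {x : Y} (h : ¬ D.IsSelf x) :
    (D.smooth x).ncomp + 1 = D.ncomp := by
  have ht := D.isTraversal_trav
  obtain ⟨b, ⟨hn, -⟩ | ⟨-, L₁, u, r, L₂, t, s, L₃, e⟩⟩ := ht.exists_cut x
  · exact absurd hn h
  · rw [e] at ht
    rw [← (ht.mixedCut true).length_eq, ← ht.length_eq, length_mixedCut]

/-- Intersection numbers do not see which strand is on top. -/
theorem Balanced.flip {D : MarkedDiagram Y} (h : D.Balanced) (x : Y) : (D.flip x).Balanced := h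

theorem exchange_insert {S : Finset Y} {x : Y} (hx : x ∉ S) (p : Y × Bool) :
    GaussDiagram.exchange ((insert x S : Finset Y) : Set Y) p =
      Equiv.swap (x, true) (x, false) (GaussDiagram.exchange (S : Set Y) p) := by
  obtain ⟨y, b⟩ := p
  by_cases hy : y = x
  · subst hy
    cases b <;> simp [GaussDiagram.exchange, hx]
  · rw [Equiv.swap_apply_of_ne_of_ne]
    · simp [GaussDiagram.exchange, hy]
    · intro e
      exact hy (congrArg Prod.fst e)
    · intro e
      exact hy (congrArg Prod.fst e)

/-- Smoothing `S` after `x` is smoothing `insert x S` at once, so the condition is an instance of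
the one for `D`. -/
theorem Balanced.smooth {D : MarkedDiagram Y} (h : D.Balanced) {x : Y} (hx : x ∈ D.active) :
    (D.smooth x).Balanced := by
  intro S hS c₁ c₂ h1 h2
  have hxS : x ∉ S := fun hh => by simpa using hS hh
  have hsub : insert x S ⊆ D.active :=
    Finset.insert_subset hx (hS.trans (Finset.erase_subset _ _))
  have := h (insert x S) hsub c₁ c₂ (fun p => by rw [exchange_insert hxS]; exact h1 p)
    (fun p => by rw [exchange_insert hxS]; exact h2 p)
  have e : D.active.erase x \ S = D.active \ insert x S := by
    ext y
    simp
    tauto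
  exact (congrArg (fun T => ∑ x ∈ T, (D.flat x : ℤ) *
      (c₁ (x, true) * c₂ (x, false) - c₂ (x, true) * c₁ (x, false))) e).trans this

theorem mem_bad_flip_of_ne {D : MarkedDiagram Y} {l : List (List (Y × Bool))} {x y : Y}
    (h : y ≠ x) : y ∈ (D.flip x).bad l ↔ y ∈ D.bad l := by
  simp [bad, flip_upper_of_ne D h]

/-- In a list without repetitions exactly one of the two passes comes first, so a crossing change
toggles badness. -/
theorem mem_bad_flip_self {D : MarkedDiagram Y} {l : List (List (Y × Bool))}
    (hl : IsTrav D.next l) {x : Y} (hx : x ∈ D.active) :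
    x ∈ (D.flip x).bad l ↔ x ∉ D.bad l := by
  have hne : (x, D.upper x) ≠ (x, !D.upper x) := by cases D.upper x <;> simp
  simp only [bad, Finset.mem_filter, flip_active, hx, true_and, flip_upper_self, Bool.not_not]
  constructor
  · exact fun h => pair_sublist_asymm hl.nodup h
  · intro h
    exact (pair_sublist_total (hl.mem _) (hl.mem _) hne).resolve_right h

theorem bad_flip {D : MarkedDiagram Y} {l : List (List (Y × Bool))}
    (hl : IsTrav D.next l) {x : Y} (hx : x ∈ D.bad l) :
    (D.flip x).bad l = (D.bad l).erase x := by
  ext y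
  by_cases h : y = x
  · subst h
    rw [mem_bad_flip_self hl (Finset.mem_filter.1 hx).1]
    simp [hx]
  · rw [mem_bad_flip_of_ne h]
    simp [h]

end MarkedDiagram

/-! ## Resolution along a traversal -/

namespace SkeinData

open MarkedDiagram

variable {Y : Type} [DecidableEq Y] {R : Type*} [CommRing R] (K : SkeinData R)

/-- The coefficient of the diagram with the crossing changed. -/
def switchCoeff (ε : ℤˣ) : R := if ε = 1 then K.v ^ 2 else K.vInv ^ 2

/-- The coefficient of the smoothed diagram, up to the factor `w` or `z`. -/
def smoothCoeff (ε : ℤˣ) : R := if ε = 1 then K.v else -K.vInv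

open scoped Classical in
/-- The factor `w` or `z`. -/
noncomputable def kindCoeff (D : MarkedDiagram Y) (x : Y) : R := if D.IsSelf x then K.w else K.z

/-- The right hand side of the skein relation that expresses the value of `D` by the values of the
diagram with `x` changed and of the diagram with `x` smoothed. -/
noncomputable def combine (D : MarkedDiagram Y) (x : Y) (α β : R) : R :=
  K.switchCoeff (D.sgn x) * α + K.smoothCoeff (D.sgn x) * K.kindCoeff D x * β

open scoped Classical in
/-- The value of `D` computed by making `D` descending along the traversal `l`. -/
noncomputable def evalAlong (D : MarkedDiagram Y) (l : List (List (Y × Bool))) : R :=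
  -- With repetitions in `l` a crossing could stay bad after being changed; testing `IsTrav` secures
  -- termination.
  if h : IsTrav D.next l ∧ (D.bad l).Nonempty then
    K.combine D h.2.choose (evalAlong (D.flip h.2.choose) l)
      -- The smoothed diagram restarts along a traversal of its own, so this term depends on `l`
      -- only through the choice of the crossing.
      (evalAlong (D.smooth h.2.choose) (D.smooth h.2.choose).trav)
  else K.a l.length
termination_by (D.active.card, (D.bad l).card)
decreasing_by
  · apply Prod.Lex.right
    rw [bad_flip h.1 h.2.choose_spec]
    exact Finset.card_erase_lt_of_mem h.2.choose_spec
  · apply Prod.Lex.left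
    exact Finset.card_erase_lt_of_mem (Finset.mem_filter.1 h.2.choose_spec).1

/-- The value of a diagram. -/
noncomputable def eval (D : MarkedDiagram Y) : R := K.evalAlong D D.trav

/-- The value of diagrams with less than `n` crossings does not depend on the traversal. -/
def Independent (Y : Type) [DecidableEq Y] (n : ℕ) : Prop :=
  ∀ D : MarkedDiagram Y, D.Balanced → D.active.card < n → ∀ l l', D.IsTraversal l →
    D.IsTraversal l' → K.evalAlong D l = K.evalAlong D l'

theorem evalAlong_of_bad_eq_empty {D : MarkedDiagram Y} {l : List (List (Y × Bool))}
    (h : D.bad l = ∅) : K.evalAlong D l = K.a l.length := by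
  rw [evalAlong, dif_neg]
  simp [h]

theorem exists_evalAlong_eq {D : MarkedDiagram Y} {l : List (List (Y × Bool))}
    (hl : D.IsTraversal l) (h : (D.bad l).Nonempty) : ∃ x ∈ D.bad l,
      K.evalAlong D l = K.combine D x (K.evalAlong (D.flip x) l) (K.eval (D.smooth x)) := by
  refine ⟨h.choose, h.choose_spec, ?_⟩
  rw [evalAlong, dif_pos ⟨hl.1, h⟩]
  rfl

theorem kindCoeff_flip (D : MarkedDiagram Y) (x y : Y) :
    K.kindCoeff (D.flip x) y = K.kindCoeff D y := rfl

/-- Smoothing a self crossing adds a component, smoothing a mixed one removes one. Both orders end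
at the same diagram, hence use equally many factors `w` and `z`, although smoothing one crossing may
change the kind of the other. -/
theorem kindCoeff_smooth_comm [Finite Y] (D : MarkedDiagram Y) {x y : Y} (h : x ≠ y) :
    K.kindCoeff D x * K.kindCoeff (D.smooth x) y =
      K.kindCoeff D y * K.kindCoeff (D.smooth y) x := by
  have e := congrArg ncomp (D.smooth_smooth h)
  have key : ∀ (E : MarkedDiagram Y) (y : Y),
      (K.kindCoeff E y = K.w ∧ (E.smooth y).ncomp = E.ncomp + 1) ∨
        (K.kindCoeff E y = K.z ∧ (E.smooth y).ncomp + 1 = E.ncomp) := by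
    intro E y
    by_cases hy : E.IsSelf y
    · exact Or.inl ⟨if_pos hy, ncomp_smooth_of_isSelf hy⟩
    · exact Or.inr ⟨if_neg hy, ncomp_smooth_of_not_isSelf hy⟩
  rcases key D x with ⟨e1, f1⟩ | ⟨e1, f1⟩ <;> rcases key D y with ⟨e2, f2⟩ | ⟨e2, f2⟩ <;>
    rcases key (D.smooth x) y with ⟨e3, f3⟩ | ⟨e3, f3⟩ <;>
    rcases key (D.smooth y) x with ⟨e4, f4⟩ | ⟨e4, f4⟩ <;> rw [e1, e2, e3, e4] <;>
    first
      | ring1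
      | (exfalso; omega)

/-- Both sides expand into the four resolutions of `x` and `y`; only the coefficient of the doubly
smoothed one is not visibly symmetric. -/
theorem combine_comm [Finite Y] (D : MarkedDiagram Y) {x y : Y} (h : x ≠ y) (α β γ δ : R) :
    K.combine D x (K.combine (D.flip x) y α β) (K.combine (D.smooth x) y γ δ) =
      K.combine D y (K.combine (D.flip y) x α γ) (K.combine (D.smooth y) x β δ) := by
  have e := K.kindCoeff_smooth_comm D h
  simp only [combine, kindCoeff_flip, sgn_flip_of_ne D h, sgn_flip_of_ne D h.symm,
    sgn_smooth_of_ne D h, sgn_smooth_of_ne D h.symm]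
  linear_combination K.smoothCoeff (D.sgn x) * K.smoothCoeff (D.sgn y) * δ * e

/-- The relation at a negative crossing is the one at a positive crossing solved for the changed
diagram. -/
theorem combine_flip (D : MarkedDiagram Y) (x : Y) (α β : R) :
    K.combine D x (K.combine (D.flip x) x α β) β = α := by
  have e := K.v_mul_vInv
  simp only [combine, kindCoeff_flip, sgn_flip_self]
  rcases Int.units_eq_one_or (D.sgn x) with hs | hs
  · rw [hs]
    simp only [switchCoeff, smoothCoeff, if_true, if_neg (show ¬ (-1 : ℤˣ) = 1 by decide)]
    linear_combination ((K.v * K.vInv + 1) * α - K.v * K.kindCoeff D x * β) * e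
  · rw [hs, neg_neg]
    simp only [switchCoeff, smoothCoeff, if_true, if_neg (show ¬ (-1 : ℤˣ) = 1 by decide)]
    linear_combination ((K.v * K.vInv + 1) * α + K.vInv * K.kindCoeff D x * β) * e

/-- The skein relation at a bad crossing yields the skein relation at every crossing. -/
theorem evalAlong_eq_of_bad {D : MarkedDiagram Y} {l : List (List (Y × Bool))}
    (hl : D.IsTraversal l) {x : Y} (hx : x ∈ D.active)
    (h1 : x ∈ D.bad l →
      K.evalAlong D l = K.combine D x (K.evalAlong (D.flip x) l) (K.eval (D.smooth x)))
    (h2 : x ∈ (D.flip x).bad l →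
      K.evalAlong (D.flip x) l =
        K.combine (D.flip x) x (K.evalAlong ((D.flip x).flip x) l) (K.eval ((D.flip x).smooth x))) :
    K.evalAlong D l = K.combine D x (K.evalAlong (D.flip x) l) (K.eval (D.smooth x)) := by
  by_cases hb : x ∈ D.bad l
  · exact h1 hb
  -- Here `x` is bad after the change, and the relation known there is inverted.
  · rw [h2 ((mem_bad_flip_self hl.1 hx).2 hb), MarkedDiagram.flip_flip, smooth_flip_self, combine_flip]

/-- The recursion may use any bad crossing. The outer induction, on the number of crossings,
supplies the full skein relation for smoothed diagrams; the inner one, on the number of bad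
crossings, allows the crossing `x₀` picked by the definition and the given `x` to be resolved in
either order. -/
theorem evalAlong_of_mem_bad [Finite Y] (D : MarkedDiagram Y) (l : List (List (Y × Bool)))
    (hl : D.IsTraversal l) (x : Y) (hx : x ∈ D.bad l) :
    K.evalAlong D l = K.combine D x (K.evalAlong (D.flip x) l) (K.eval (D.smooth x)) := by
  induction hN : D.active.card using Nat.strong_induction_on generalizing D l x with
  | _ N ih =>
  subst hN
  have skein : ∀ D' : MarkedDiagram Y, D'.active.card < D.active.card → ∀ y ∈ D'.active,
      K.eval D' = K.combine D' y (K.eval (D'.flip y)) (K.eval (D'.smooth y)) := by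
    intro D' hlt y hy
    exact K.evalAlong_eq_of_bad D'.isTraversal_trav hy
      (fun hb => ih _ hlt D' _ D'.isTraversal_trav y hb rfl)
      (fun hb => ih _ hlt (D'.flip y) _ D'.isTraversal_trav y hb rfl)
  clear ih
  induction hM : (D.bad l).card using Nat.strong_induction_on generalizing D x with
  | _ M ih =>
  subst hM
  obtain ⟨x₀, hx₀, e⟩ := K.exists_evalAlong_eq hl ⟨x, hx⟩
  by_cases hxx : x = x₀
  · rw [hxx]; exact e
  have ha : x ∈ D.active := (Finset.mem_filter.1 hx).1
  have ha₀ : x₀ ∈ D.active := (Finset.mem_filter.1 hx₀).1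
  have lt : ∀ y ∈ D.bad l, ((D.flip y).bad l).card < (D.bad l).card := by
    intro y hy
    rw [bad_flip hl.1 hy]
    exact Finset.card_erase_lt_of_mem hy
  rw [e, ih _ (lt x₀ hx₀) (D.flip x₀) hl x ((mem_bad_flip_of_ne hxx).2 hx) skein rfl,
    ih _ (lt x hx) (D.flip x) hl x₀ ((mem_bad_flip_of_ne (Ne.symm hxx)).2 hx₀) skein rfl,
    skein (D.smooth x₀) (Finset.card_erase_lt_of_mem ha₀) x (by simp [hxx, ha]),
    skein (D.smooth x) (Finset.card_erase_lt_of_mem ha) x₀ (by simp [Ne.symm hxx, ha₀]),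
    K.combine_comm D (Ne.symm hxx), MarkedDiagram.flip_comm D hxx, smooth_flip D hxx,
    smooth_flip D (Ne.symm hxx), smooth_smooth D hxx]

/-- The skein relation along a fixed traversal. -/
theorem evalAlong_skein [Finite Y] {D : MarkedDiagram Y} {l : List (List (Y × Bool))}
    (hl : D.IsTraversal l) {x : Y} (hx : x ∈ D.active) :
    K.evalAlong D l = K.combine D x (K.evalAlong (D.flip x) l) (K.eval (D.smooth x)) :=
  K.evalAlong_eq_of_bad hl hx (K.evalAlong_of_mem_bad D l hl x)
    (K.evalAlong_of_mem_bad (D.flip x) l hl x)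

/-- The skein relation. -/
theorem eval_skein [Finite Y] (D : MarkedDiagram Y) {x : Y} (hx : x ∈ D.active) :
    K.eval D = K.combine D x (K.eval (D.flip x)) (K.eval (D.smooth x)) :=
  K.evalAlong_skein D.isTraversal_trav hx

end SkeinData

/-! ## Comparison of diagrams -/

theorem List.Forall₂.exists_of_append_cons {α β : Type*} {R : α → β → Prop} {A : List α} {a : α}
    {B : List α} {l : List β} (h : List.Forall₂ R (A ++ a :: B) l) :
    ∃ A' a' B', l = A' ++ a' :: B' ∧ List.Forall₂ R A A' ∧ R a a' ∧ List.Forall₂ R B B' := by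
  induction A generalizing l with
  | nil =>
    cases h with
    | cons h1 h2 => exact ⟨[], _, _, rfl, .nil, h1, h2⟩
  | cons c A ih =>
    cases h with
    | cons h1 h2 =>
      obtain ⟨A', a', B', rfl, h3, h4, h5⟩ := ih h2
      exact ⟨_ :: A', a', B', rfl, .cons h1 h3, h4, h5⟩

theorem List.Forall₂.append' {α β : Type*} {R : α → β → Prop} {A B : List α} {A' B' : List β}
    (h : List.Forall₂ R A A') (h' : List.Forall₂ R B B') : List.Forall₂ R (A ++ B) (A' ++ B') := by
  induction h with
  | nil => exact h'
  | cons h1 _ ih => exact .cons h1 ih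

namespace MarkedDiagram

variable {Y Y' : Type} [DecidableEq Y] [DecidableEq Y']

/-- The map of passes that covers `f` and exchanges the strands at the crossings with `e y = true`. -/
def passMap (f : Y' → Y) (e : Y' → Bool) (p : Y' × Bool) : Y × Bool := (f p.1, p.2 ^^ e p.1)

theorem passMap_injective {f : Y' → Y} (hf : Function.Injective f) (e : Y' → Bool) :
    Function.Injective (passMap f e) := by
  rintro ⟨y, b⟩ ⟨y', b'⟩ h
  simp only [passMap, Prod.mk.injEq] at h
  obtain ⟨h1, h2⟩ := h
  obtain rfl := hf h1
  simpa using h2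

/-- The words agree up to the passes of crossings outside `C`. -/
def SameWord (f : Y' → Y) (e : Y' → Bool) (C : Finset Y') (w : List (Y × Bool))
    (w' : List (Y' × Bool)) : Prop :=
  w.filter (fun p => p.1 ∈ C.image f) = (w'.filter (fun p => p.1 ∈ C)).map (passMap f e)

section SameWord

variable {f : Y' → Y} {e : Y' → Bool} {C : Finset Y'}

theorem SameWord.append {u r : List (Y × Bool)} {u' r' : List (Y' × Bool)}
    (h : SameWord f e C u u') (h' : SameWord f e C r r') :
    SameWord f e C (u ++ r) (u' ++ r') := by
  unfold SameWord at *
  rw [List.filter_append, List.filter_append, List.map_append, h, h']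

theorem SameWord.cons_of_notMem {p : Y × Bool} {p' : Y' × Bool} {r : List (Y × Bool)}
    {r' : List (Y' × Bool)} (hp : p.1 ∉ C.image f) (hp' : p'.1 ∉ C) (h' : SameWord f e C r r') :
    SameWord f e C (p :: r) (p' :: r') := by
  unfold SameWord at *
  rw [List.filter_cons_of_neg (by simpa using hp), List.filter_cons_of_neg (by simpa using hp'), h']

theorem SameWord.mono (hf : Function.Injective f) {C' : Finset Y'} {w : List (Y × Bool)}
    {w' : List (Y' × Bool)} (h : SameWord f e C w w') (hC : C' ⊆ C) : SameWord f e C' w w' := by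
  unfold SameWord at *
  have h1 : w.filter (fun p => p.1 ∈ C'.image f) =
      (w.filter (fun p => p.1 ∈ C.image f)).filter (fun p => p.1 ∈ C'.image f) := by
    rw [List.filter_filter]
    apply List.filter_congr
    intro p _
    have := Finset.image_subset_image (f := f) hC
    by_cases hp : p.1 ∈ C'.image f
    · have h2 := this hp
      simp only [hp, h2, decide_true, Bool.and_self]
    · simp only [hp, decide_false, Bool.false_and]
  have h2 : w'.filter (fun p => p.1 ∈ C') =
      (w'.filter (fun p => p.1 ∈ C)).filter (fun p => p.1 ∈ C') := by
    rw [List.filter_filter]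
    apply List.filter_congr
    intro p _
    by_cases hp : p.1 ∈ C'
    · simp [hp, hC hp]
    · simp [hp]
  rw [h1, h2, h, List.filter_map]
  congr 1
  apply List.filter_congr
  intro p _
  simp [passMap, hf.eq_iff]

theorem SameWord.exists_of_append_cons {u r : List (Y × Bool)} {p : Y × Bool}
    {w' : List (Y' × Bool)} (h : SameWord f e C (u ++ p :: r) w') (hp : p.1 ∈ C.image f) :
    ∃ u' p' r', w' = u' ++ p' :: r' ∧ passMap f e p' = p ∧ p'.1 ∈ C ∧ SameWord f e C u u' ∧
      SameWord f e C r r' := by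
  unfold SameWord at h
  rw [List.filter_append, List.filter_cons_of_pos (by simpa using hp)] at h
  obtain ⟨a, b, h1, h2, h3⟩ := List.map_eq_append_iff.1 h.symm
  obtain ⟨c, b, rfl, h4, h5⟩ := List.map_eq_cons_iff.1 h3
  obtain ⟨a', b', rfl, h6, h7⟩ := List.filter_eq_append_iff.1 h1
  obtain ⟨a'', b'', rfl, h8, h9, h10⟩ := List.filter_eq_cons_iff.1 h7
  refine ⟨a' ++ a'', c, b'', by simp, h4, by simpa using h9, ?_, ?_⟩
  · unfold SameWord
    rw [List.filter_append, h6, List.filter_eq_nil_iff.2 h8, List.append_nil, h2]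
  · unfold SameWord
    rw [h10, h5]

theorem SameWord.flatten {l : List (List (Y × Bool))} {l' : List (List (Y' × Bool))}
    (h : List.Forall₂ (SameWord f e C) l l') : SameWord f e C l.flatten l'.flatten := by
  induction h with
  | nil => rfl
  | cons h1 _ ih => exact h1.append ih

end SameWord

/-! ### Shielded segments and matching traversals -/

/-- An initial (`m = true`) or final (`m = false`) part of the traversal in which every crossing it
meets is passed over first, and that meets all active crossings outside `C`. -/
def Shielded (m : Bool) (D : MarkedDiagram Y) (L : List (Y × Bool)) (C : Finset Y) : Prop :=
  ∃ s, (if m then s <+: L else s <:+ L) ∧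
    (∀ x ∈ D.active, (x, D.upper x ^^ m) ∈ s → [(x, D.upper x), (x, !D.upper x)].Sublist s) ∧
    ∀ x ∈ D.active, x ∉ C → (x, D.upper x ^^ !m) ∈ s

theorem shielded_of_subset {m : Bool} {D : MarkedDiagram Y} {L : List (Y × Bool)} {C : Finset Y}
    (h : D.active ⊆ C) : Shielded m D L C :=
  ⟨[], by cases m <;> simp, by simp, fun _ hx hx' => absurd (h hx) hx'⟩

/-- Take an initial segment. The lower pass of a bad crossing is not in `s`, where the upper one
would precede it; hence neither is the upper pass, which comes later still. For a final segment the
passes exchange roles. -/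
theorem notMem_of_bad {m : Bool} {D : MarkedDiagram Y} {L s : List (Y × Bool)}
    (hL : L.Nodup) (hs : if m then s <+: L else s <:+ L)
    (hg : ∀ x ∈ D.active, (x, D.upper x ^^ m) ∈ s → [(x, D.upper x), (x, !D.upper x)].Sublist s)
    {x : Y} (hx : x ∈ D.active) (hb : [(x, !D.upper x), (x, D.upper x)].Sublist L) (b : Bool) :
    (x, b) ∉ s := by
  have hsub : s.Sublist L := by
    cases m
    · exact List.IsSuffix.sublist (by simpa using hs)
    · exact List.IsPrefix.sublist (by simpa using hs)
  have h1 : (x, D.upper x ^^ m) ∉ s := fun h =>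
    pair_sublist_asymm hL hb ((hg x hx h).trans hsub)
  have h2 : (x, D.upper x ^^ !m) ∉ s := by
    intro h
    cases m
    · simp only [Bool.false_eq_true, if_false, Bool.not_false, Bool.xor_true, Bool.xor_false]
        at hs h h1
      obtain ⟨A, rfl⟩ := hs
      exact h1 ((pair_sublist_right hb hL h).subset (by simp))
    · simp only [if_true, Bool.not_true, Bool.xor_true, Bool.xor_false] at hs h h1
      obtain ⟨A, rfl⟩ := hs
      exact h1 ((pair_sublist_left hb hL h).subset (by simp))
  have : b = (D.upper x ^^ m) ∨ b = (D.upper x ^^ !m) := by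
    cases b <;> cases m <;> cases D.upper x <;> simp
  rcases this with rfl | rfl
  · exact h1
  · exact h2

theorem Shielded.mem_of_bad {m : Bool} {D : MarkedDiagram Y} {l : List (List (Y × Bool))}
    {C : Finset Y} (h : Shielded m D l.flatten C) (hl : IsTrav D.next l) {x : Y}
    (hx : x ∈ D.bad l) : x ∈ C := by
  obtain ⟨s, h1, h2, h3⟩ := h
  obtain ⟨hx1, hx2⟩ := Finset.mem_filter.1 hx
  by_contra hC
  exact notMem_of_bad hl.nodup h1 h2 hx1 hx2 _ (h3 x hx1 hC)

theorem Shielded.flip {m : Bool} {D : MarkedDiagram Y} {l : List (List (Y × Bool))}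
    {C : Finset Y} (h : Shielded m D l.flatten C) (hl : IsTrav D.next l) {x : Y}
    (hx : x ∈ D.bad l) : Shielded m (D.flip x) l.flatten C := by
  have hxC := h.mem_of_bad hl hx
  obtain ⟨s, h1, h2, h3⟩ := h
  obtain ⟨hx1, hx2⟩ := Finset.mem_filter.1 hx
  have hns := notMem_of_bad hl.nodup h1 h2 hx1 hx2
  refine ⟨s, h1, fun y hy => ?_, fun y hy hyC => ?_⟩
  · by_cases hyx : y = x
    · subst hyx
      exact fun hh => absurd hh (hns _)
    · rw [flip_upper_of_ne D hyx]
      exact h2 y hy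
  · rw [flip_upper_of_ne D (by rintro rfl; exact hyC hxC)]
    exact h3 y hy hyC

/-- The cut is at a pass `p` of a bad crossing, hence outside `s`. So `s` lies entirely before `p`
(or after it, for a final segment), and that part of the traversal is copied unchanged into the new
one. -/
theorem Shielded.smooth {m : Bool} {D : MarkedDiagram Y} {l l₁ : List (List (Y × Bool))}
    {C : Finset Y} (h : Shielded m D l.flatten C) (hl : IsTrav D.next l) {x : Y}
    (hx : x ∈ D.bad l) {A A' B B' : List (Y × Bool)} {p p' : Y × Bool} (hp : p.1 = x)
    (e : l.flatten = A ++ p :: B) (e₁ : l₁.flatten = A' ++ p' :: B')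
    (hm : if m then A' = A else B' = B) :
    Shielded m (D.smooth x) l₁.flatten (C.erase x) := by
  obtain ⟨s, h1, h2, h3⟩ := h
  obtain ⟨hx1, hx2⟩ := Finset.mem_filter.1 hx
  have hns : p ∉ s := by
    obtain ⟨y, b⟩ := p
    subst hp
    exact notMem_of_bad hl.nodup h1 h2 hx1 hx2 _
  refine ⟨s, ?_, fun y hy => ?_, fun y hy hyC => ?_⟩
  · rw [e] at h1
    rw [e₁]
    cases m
    · simp only [Bool.false_eq_true, if_false] at h1 hm ⊢
      rw [hm]
      exact ((suffix_of_not_mem h1 hns).trans (List.suffix_cons _ _)).trans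
        (List.suffix_append _ _)
    · simp only [if_true] at h1 hm ⊢
      rw [hm]
      exact (prefix_of_not_mem h1 hns).trans (List.prefix_append _ _)
  · obtain ⟨hyx, hy⟩ := Finset.mem_erase.1 hy
    rw [smooth_upper_of_ne D hyx]
    exact h2 y hy
  · obtain ⟨hyx, hy⟩ := Finset.mem_erase.1 hy
    rw [smooth_upper_of_ne D hyx]
    exact h3 y hy fun hh => hyC (Finset.mem_erase.2 ⟨hyx, hh⟩)

/-- The diagrams `D` and `D'` and their traversals agree up to shielded crossings; `C` consists of
the common crossings. -/
structure Matching (m : Bool) (f : Y' → Y) (e : Y' → Bool) (C : Finset Y')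
    (D : MarkedDiagram Y) (l : List (List (Y × Bool)))
    (D' : MarkedDiagram Y') (l' : List (List (Y' × Bool))) : Prop where
  inj : Function.Injective f
  isTraversal : D.IsTraversal l
  isTraversal' : D'.IsTraversal l'
  image_subset : C.image f ⊆ D.active
  subset : C ⊆ D'.active
  upper : ∀ y ∈ C, D.upper (f y) = (D'.upper y ^^ e y)
  sgn : ∀ y ∈ C, D.sgn (f y) = D'.sgn y
  words : List.Forall₂ (SameWord f e C) l l'
  shielded : Shielded m D l.flatten (C.image f)
  shielded' : Shielded m D' l'.flatten C

namespace Matching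

variable {m : Bool} {f : Y' → Y} {e : Y' → Bool} {C : Finset Y'} {D : MarkedDiagram Y}
  {l : List (List (Y × Bool))} {D' : MarkedDiagram Y'} {l' : List (List (Y' × Bool))}

/-- Badness of a common crossing is the order of its two passes, which the filtered words retain,
and `passMap` carries upper passes to upper passes. -/
theorem mem_bad_iff (h : Matching m f e C D l D' l') {y : Y'} (hy : y ∈ C) :
    f y ∈ D.bad l ↔ y ∈ D'.bad l' := by
  have h1 : f y ∈ D.active := h.image_subset (Finset.mem_image_of_mem f hy)
  have h2 : y ∈ D'.active := h.subset hy
  have hw : SameWord f e C l.flatten l'.flatten := SameWord.flatten h.words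
  rw [bad, bad, Finset.mem_filter, Finset.mem_filter, h.upper y hy]
  simp only [h1, h2, true_and]
  rw [pair_sublist_filter (f := fun p => p.1 ∈ C.image f)
      (by simpa using ⟨y, hy, rfl⟩) (by simpa using ⟨y, hy, rfl⟩),
    pair_sublist_filter (p := (y, !D'.upper y)) (f := fun p => p.1 ∈ C)
      (by simpa using hy) (by simpa using hy)]
  unfold SameWord at hw
  rw [hw]
  have e1 : [(f y, !(D'.upper y ^^ e y)), (f y, D'.upper y ^^ e y)] =
      [(y, !D'.upper y), (y, D'.upper y)].map (passMap f e) := by simp [passMap]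
  rw [e1]
  refine ⟨fun hs => ?_, fun hs => hs.map _⟩
  obtain ⟨l₁, hl₁, e2⟩ := List.sublist_map_iff.1 hs
  rwa [(List.map_injective_iff.2 (passMap_injective h.inj e)) e2]

theorem bad_subset (h : Matching m f e C D l D' l') : D.bad l ⊆ C.image f :=
  fun _ hx => h.shielded.mem_of_bad h.isTraversal.1 hx

theorem bad_subset' (h : Matching m f e C D l D' l') : D'.bad l' ⊆ C :=
  fun _ hx => h.shielded'.mem_of_bad h.isTraversal'.1 hx

theorem flip (h : Matching m f e C D l D' l') {y : Y'} (hy : y ∈ C) (hb : f y ∈ D.bad l) :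
    Matching m f e C (D.flip (f y)) l (D'.flip y) l' where
  inj := h.inj
  isTraversal := h.isTraversal
  isTraversal' := h.isTraversal'
  image_subset := h.image_subset
  subset := h.subset
  upper y' hy' := by
    by_cases hyy : y' = y
    · subst hyy
      rw [flip_upper_self, flip_upper_self, h.upper y' hy', Bool.not_xor]
    · rw [flip_upper_of_ne _ hyy, flip_upper_of_ne _ (h.inj.ne hyy), h.upper y' hy']
  sgn y' hy' := by
    by_cases hyy : y' = y
    · subst hyy
      rw [sgn_flip_self, sgn_flip_self, h.sgn y' hy']
    · rw [sgn_flip_of_ne _ hyy, sgn_flip_of_ne _ (h.inj.ne hyy), h.sgn y' hy']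
  words := h.words
  shielded := h.shielded.flip h.isTraversal.1 hb
  shielded' := h.shielded'.flip h.isTraversal'.1 ((h.mem_bad_iff hy).1 hb)

/-- Corresponding words contain corresponding passes, so both traversals are cut or merged in the
same way. Using the same `m` as for the shields keeps both shielding segments. -/
theorem smooth (h : Matching m f e C D l D' l') {y : Y'} (hy : y ∈ C) (hb : f y ∈ D.bad l) :
    (D.IsSelf (f y) ↔ D'.IsSelf y) ∧
      ∃ l₁ l₁', Matching m f e (C.erase y) (D.smooth (f y)) l₁ (D'.smooth y) l₁' := by
  have hb' := (h.mem_bad_iff hy).1 hb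
  have him : (C.erase y).image f = (C.image f).erase (f y) := by
    rw [Finset.image_erase h.inj]
  have hfy : ∀ b, ((f y, b) : Y × Bool).1 ∈ C.image f := fun b => Finset.mem_image_of_mem f hy
  have hpass : ∀ (b : Bool) (q : Y' × Bool), passMap f e q = (f y, b) → q = (y, b ^^ e y) := by
    rintro b ⟨y', b'⟩ hq
    simp only [passMap, Prod.mk.injEq] at hq
    obtain ⟨h1, h2⟩ := hq
    obtain rfl := h.inj h1
    simp [← h2]
  have hmono : ∀ {w w'}, SameWord f e C w w' → SameWord f e (C.erase y) w w' :=
    fun hw => hw.mono h.inj (Finset.erase_subset _ _)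
  have hmono₂ : ∀ {L L'}, List.Forall₂ (SameWord f e C) L L' →
      List.Forall₂ (SameWord f e (C.erase y)) L L' :=
    fun hL => hL.imp fun _ _ hw => hmono hw
  have hcons : ∀ {b b' r r'}, SameWord f e (C.erase y) r r' →
      SameWord f e (C.erase y) ((f y, b) :: r) ((y, b') :: r') :=
    fun hr => hr.cons_of_notMem (by simp [him]) (by simp)
  -- it suffices to describe the new traversals
  have build : ∀ (l₁ : List (List (Y × Bool))) (l₁' : List (List (Y' × Bool))),
      (D.smooth (f y)).IsTraversal l₁ → (D'.smooth y).IsTraversal l₁' →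
      List.Forall₂ (SameWord f e (C.erase y)) l₁ l₁' →
      Shielded m (D.smooth (f y)) l₁.flatten ((C.image f).erase (f y)) →
      Shielded m (D'.smooth y) l₁'.flatten (C.erase y) →
      Matching m f e (C.erase y) (D.smooth (f y)) l₁ (D'.smooth y) l₁' := by
    intro l₁ l₁' t1 t2 t3 t4 t5
    refine ⟨h.inj, t1, t2, ?_, ?_, ?_, ?_, t3, ?_, t5⟩
    · rw [him]
      exact Finset.erase_subset_erase _ h.image_subset
    · exact Finset.erase_subset_erase _ h.subset
    · intro y' hy'
      obtain ⟨hyy, hy'⟩ := Finset.mem_erase.1 hy'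
      rw [smooth_upper_of_ne _ hyy, smooth_upper_of_ne _ (h.inj.ne hyy), h.upper y' hy']
    · intro y' hy'
      obtain ⟨hyy, hy'⟩ := Finset.mem_erase.1 hy'
      rw [sgn_smooth_of_ne _ hyy, sgn_smooth_of_ne _ (h.inj.ne hyy), h.sgn y' hy']
    · rw [him]; exact t4
  obtain ⟨b, ⟨hs, L₁, u, t, r, L₂, rfl⟩ | ⟨hs, L₁, u, r, L₂, t, s, L₃, rfl⟩⟩ :=
    h.isTraversal.exists_cut (f y)
  · obtain ⟨L₁', w', L₂', rfl, hL₁, hw, hL₂⟩ := h.words.exists_of_append_cons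
    obtain ⟨u', p', w', rfl, hp', -, hu, hw⟩ := hw.exists_of_append_cons (hfy b)
    obtain ⟨t', q', r', rfl, hq', -, ht, hr⟩ := hw.exists_of_append_cons (hfy (!b))
    obtain rfl := hpass _ _ hp'
    obtain rfl := hpass _ _ hq'
    have ht' := h.isTraversal'
    rw [Bool.not_xor] at ht'
    have hs' : D'.IsSelf y := (D'.isSelf_iff y _).2 ht'.1.sameCycle_of_self
    refine ⟨iff_of_true hs hs', _, _,
      build _ _ (h.isTraversal.selfCut m) (ht'.selfCut m) ?_ ?_ ?_⟩
    · have a1 := (hmono hu).append (hcons (b := b) (b' := b ^^ e y) (hmono hr))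
      have a2 := (hmono ht).append (hcons (b := !b) (b' := !(b ^^ e y)) (r := []) (r' := []) rfl)
      cases m
      · exact (hmono₂ hL₁).append' (.cons a2 (.cons a1 (hmono₂ hL₂)))
      · exact (hmono₂ hL₁).append' (.cons a1 (.cons a2 (hmono₂ hL₂)))
    -- For a final segment the cut is made at the second pass and what follows it is kept; for an
    -- initial segment it is made at the first pass and what precedes it is kept.
    · cases m
      · refine h.shielded.smooth h.isTraversal.1 hb (p := (f y, !b)) (p' := (f y, b)) rfl
          (A := L₁.flatten ++ u ++ (f y, b) :: t) (B := r ++ L₂.flatten)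
          (A' := L₁.flatten ++ (t ++ [(f y, !b)]) ++ u) (B' := r ++ L₂.flatten) ?_ ?_ rfl
        · simp
        · simp [selfCut]
      · refine h.shielded.smooth h.isTraversal.1 hb (p := (f y, b)) (p' := (f y, b)) rfl
          (A := L₁.flatten ++ u) (B := t ++ (f y, !b) :: (r ++ L₂.flatten))
          (A' := L₁.flatten ++ u) (B' := r ++ (t ++ [(f y, !b)]) ++ L₂.flatten) ?_ ?_ rfl
        · simp
        · simp [selfCut]
    · have hsh := h.shielded'
      rw [Bool.not_xor] at hsh hb'
      cases m
      · refine hsh.smooth ht'.1 hb' (p := (y, !(b ^^ e y))) (p' := (y, b ^^ e y)) rfl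
          (A := L₁'.flatten ++ u' ++ (y, b ^^ e y) :: t') (B := r' ++ L₂'.flatten)
          (A' := L₁'.flatten ++ (t' ++ [(y, !(b ^^ e y))]) ++ u') (B' := r' ++ L₂'.flatten)
          ?_ ?_ rfl
        · simp
        · simp [selfCut]
      · refine hsh.smooth ht'.1 hb' (p := (y, b ^^ e y)) (p' := (y, b ^^ e y)) rfl
          (A := L₁'.flatten ++ u') (B := t' ++ (y, !(b ^^ e y)) :: (r' ++ L₂'.flatten))
          (A' := L₁'.flatten ++ u') (B' := r' ++ (t' ++ [(y, !(b ^^ e y))]) ++ L₂'.flatten)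
          ?_ ?_ rfl
        · simp
        · simp [selfCut]
  · obtain ⟨L₁', w', L₂', rfl, hL₁, hw, hL₂⟩ := h.words.exists_of_append_cons
    obtain ⟨L₂', w'', L₃', rfl, hK, hw', hL₃⟩ := hL₂.exists_of_append_cons
    obtain ⟨u', p', r', rfl, hp', -, hu, hr⟩ := hw.exists_of_append_cons (hfy b)
    obtain ⟨t', q', s', rfl, hq', -, ht, hst⟩ := hw'.exists_of_append_cons (hfy (!b))
    obtain rfl := hpass _ _ hp'
    obtain rfl := hpass _ _ hq'
    have ht' := h.isTraversal'
    rw [Bool.not_xor] at ht'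
    have hs' : ¬ D'.IsSelf y := fun hh =>
      ht'.1.not_sameCycle_of_mixed ((D'.isSelf_iff y _).1 hh)
    refine ⟨iff_of_false hs hs', _, _,
      build _ _ (h.isTraversal.mixedCut m) (ht'.mixedCut m) ?_ ?_ ?_⟩
    · have a1 := (hmono hu).append (hcons (b := b) (b' := b ^^ e y)
        (((hmono hst).append (hmono ht)).append
          (hcons (b := !b) (b' := !(b ^^ e y)) (hmono hr))))
      have a2 := (hmono ht).append (hcons (b := !b) (b' := !(b ^^ e y))
        (((hmono hr).append (hmono hu)).append
          (hcons (b := b) (b' := b ^^ e y) (hmono hst))))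
      cases m
      · exact (hmono₂ hL₁).append' ((hmono₂ hK).append' (.cons a2 (hmono₂ hL₃)))
      · exact (hmono₂ hL₁).append' (.cons a1 ((hmono₂ hK).append' (hmono₂ hL₃)))
    · cases m
      · refine h.shielded.smooth h.isTraversal.1 hb (p := (f y, !b)) (p' := (f y, b)) rfl
          (A := L₁.flatten ++ (u ++ (f y, b) :: r) ++ L₂.flatten ++ t) (B := s ++ L₃.flatten)
          (A' := L₁.flatten ++ L₂.flatten ++ t ++ (f y, !b) :: (r ++ u)) (B' := s ++ L₃.flatten)
          ?_ ?_ rfl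
        · simp
        · simp [mixedCut]
      · refine h.shielded.smooth h.isTraversal.1 hb (p := (f y, b)) (p' := (f y, b)) rfl
          (A := L₁.flatten ++ u)
          (B := r ++ (L₂.flatten ++ (t ++ (f y, !b) :: (s ++ L₃.flatten))))
          (A' := L₁.flatten ++ u)
          (B' := s ++ t ++ (f y, !b) :: (r ++ (L₂.flatten ++ L₃.flatten))) ?_ ?_ rfl
        · simp
        · simp [mixedCut]
    · have hsh := h.shielded'
      rw [Bool.not_xor] at hsh hb'
      cases m
      · refine hsh.smooth ht'.1 hb' (p := (y, !(b ^^ e y))) (p' := (y, b ^^ e y)) rfl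
          (A := L₁'.flatten ++ (u' ++ (y, b ^^ e y) :: r') ++ L₂'.flatten ++ t')
          (B := s' ++ L₃'.flatten)
          (A' := L₁'.flatten ++ L₂'.flatten ++ t' ++ (y, !(b ^^ e y)) :: (r' ++ u'))
          (B' := s' ++ L₃'.flatten) ?_ ?_ rfl
        · simp
        · simp [mixedCut]
      · refine hsh.smooth ht'.1 hb' (p := (y, b ^^ e y)) (p' := (y, b ^^ e y)) rfl
          (A := L₁'.flatten ++ u')
          (B := r' ++ (L₂'.flatten ++ (t' ++ (y, !(b ^^ e y)) :: (s' ++ L₃'.flatten))))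
          (A' := L₁'.flatten ++ u')
          (B' := s' ++ t' ++ (y, !(b ^^ e y)) :: (r' ++ (L₂'.flatten ++ L₃'.flatten)))
          ?_ ?_ rfl
        · simp
        · simp [mixedCut]

end Matching

end MarkedDiagram

/-! ### Values of matching diagrams -/

namespace SkeinData

open MarkedDiagram

variable {Y Y' : Type} [DecidableEq Y] [DecidableEq Y'] {R : Type*} [CommRing R]
  (K : SkeinData R)

/-- Matching diagrams have the same value along the matching traversals, provided that the values
of diagrams with fewer crossings do not depend on traversals. -/
theorem evalAlong_eq_of_matching [Finite Y] [Finite Y'] {n n' : ℕ} (hn : K.Independent Y n)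
    (hn' : K.Independent Y' n') {m : Bool} {f : Y' → Y} {e : Y' → Bool} {C : Finset Y'}
    {D : MarkedDiagram Y} {l : List (List (Y × Bool))} {D' : MarkedDiagram Y'}
    {l' : List (List (Y' × Bool))} (h : Matching m f e C D l D' l') (hD : D.Balanced)
    (hD' : D'.Balanced) (hc : D.active.card ≤ n) (hc' : D'.active.card ≤ n') :
    K.evalAlong D l = K.evalAlong D' l' := by
  -- Shielded crossings are never bad, so both diagrams follow the same recursion: changing a common
  -- bad crossing shrinks the bad set, smoothing it shrinks `C`.
  induction hC : C.card using Nat.strong_induction_on generalizing C D l D' l' with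
  | _ N ihC =>
  subst hC
  induction hM : (D.bad l).card using Nat.strong_induction_on generalizing D D' with
  | _ M ihM =>
  subst hM
  rcases (D.bad l).eq_empty_or_nonempty with hb | ⟨x, hx⟩
  · have hb' : D'.bad l' = ∅ := by
      rw [Finset.eq_empty_iff_forall_notMem]
      intro y hy
      have := (h.mem_bad_iff (h.bad_subset' hy)).2 hy
      simp [hb] at this
    rw [K.evalAlong_of_bad_eq_empty hb, K.evalAlong_of_bad_eq_empty hb', h.words.length_eq]
  · obtain ⟨y, hy, rfl⟩ := Finset.mem_image.1 (h.bad_subset hx)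
    have hy' := (h.mem_bad_iff hy).1 hx
    have ha : f y ∈ D.active := (Finset.mem_filter.1 hx).1
    have ha' : y ∈ D'.active := (Finset.mem_filter.1 hy').1
    obtain ⟨hself, l₁, l₁', hs⟩ := h.smooth hy hx
    have e1 := ihM _ (by
      rw [bad_flip h.isTraversal.1 hx]
      exact Finset.card_erase_lt_of_mem hx) (h.flip hy hx) (hD.flip _) (hD'.flip _) hc hc' rfl
    have c1 : (D.smooth (f y)).active.card < D.active.card := Finset.card_erase_lt_of_mem ha
    have c2 : (D'.smooth y).active.card < D'.active.card := Finset.card_erase_lt_of_mem ha'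
    have e2 := ihC _ (Finset.card_erase_lt_of_mem hy) hs (hD.smooth ha) (hD'.smooth ha')
      (c1.le.trans hc) (c2.le.trans hc') rfl
    -- The recursion uses `trav` for smoothings; with fewer than `n` crossings the matching
    -- traversal may take its place.
    have e3 : K.eval (D.smooth (f y)) = K.evalAlong (D.smooth (f y)) l₁ :=
      hn _ (hD.smooth ha) (c1.trans_le hc) _ _ (isTraversal_trav _) hs.isTraversal
    have e4 : K.eval (D'.smooth y) = K.evalAlong (D'.smooth y) l₁' :=
      hn' _ (hD'.smooth ha') (c2.trans_le hc') _ _ (isTraversal_trav _) hs.isTraversal'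
    rw [K.evalAlong_skein h.isTraversal ha, K.evalAlong_skein h.isTraversal' ha', e1, e3, e4, e2]
    unfold combine kindCoeff
    rw [h.sgn y hy]
    congr 2
    by_cases hh : D'.IsSelf y
    · rw [if_pos hh, if_pos (hself.2 hh)]
    · rw [if_neg hh, if_neg (hself.not.2 hh)]

end SkeinData

/-! ## Independence of the traversal -/

section Lists

variable {P : Type*}

theorem pair_sublist_congr {p q : P} {A B : List P} (f : P → Bool) (hp : f p) (hq : f q)
    (h : A.filter f = B.filter f) : [p, q].Sublist A ↔ [p, q].Sublist B := by
  rw [pair_sublist_filter hp hq, h, ← pair_sublist_filter hp hq]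

theorem pair_sublist_replace {p q : P} {A K K' B : List P} (h : [p, q].Sublist (A ++ (K ++ B)))
    (hK : ¬ (p ∈ K ∧ q ∈ K)) (hKK : ∀ z ∈ K, z ∈ K') : [p, q].Sublist (A ++ (K' ++ B)) := by
  simp only [pair_sublist_append, List.mem_append] at h ⊢
  rcases h with h | (h | h | ⟨h, h'⟩) | ⟨h, h' | h'⟩
  · exact Or.inl h
  · exact absurd ⟨h.subset (by simp), h.subset (by simp)⟩ hK
  · exact Or.inr (Or.inl (Or.inr (Or.inl h)))
  · exact Or.inr (Or.inl (Or.inr (Or.inr ⟨hKK _ h, h'⟩)))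
  · exact Or.inr (Or.inr ⟨h, Or.inl (hKK _ h')⟩)
  · exact Or.inr (Or.inr ⟨h, Or.inr h'⟩)

theorem List.exists_of_flatten_eq_append_cons {L : List (List P)} {A B : List P} {u : P}
    (h : L.flatten = A ++ u :: B) : ∃ L₁ u₀ r₀ L₂, L = L₁ ++ (u₀ ++ u :: r₀) :: L₂ ∧
      A = L₁.flatten ++ u₀ ∧ B = r₀ ++ L₂.flatten := by
  induction L generalizing A with
  | nil => simp at h
  | cons w L ih =>
    rw [List.flatten_cons, List.append_eq_append_iff] at h
    rcases h with ⟨a, rfl, h⟩ | ⟨c, rfl, h⟩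
    · obtain ⟨L₁, u₀, r₀, L₂, rfl, rfl, rfl⟩ := ih h
      exact ⟨w :: L₁, u₀, r₀, L₂, rfl, by simp, rfl⟩
    · cases c with
      | nil =>
        obtain ⟨L₁, u₀, r₀, L₂, rfl, h1, rfl⟩ := ih (A := []) (by simpa using h.symm)
        exact ⟨A :: L₁, u₀, r₀, L₂, by simp, by simp [List.append_assoc, ← h1], rfl⟩
      | cons c cs =>
        simp only [List.cons_append, List.cons.injEq] at h
        obtain ⟨rfl, rfl⟩ := h
        exact ⟨[], A, cs, L, by simp, by simp, rfl⟩

theorem Walk.unique {σ : Equiv.Perm P} {p q : P} {m m' : List P} (h : Walk σ p m q)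
    (h' : Walk σ p m' q) (hq : q ∉ m) (hq' : q ∉ m') : m = m' := by
  induction m generalizing p m' with
  | nil =>
    cases m' with
    | nil => rfl
    | cons a m' =>
      have h1 : σ p = q := h
      exact absurd (by simp [← h1, h'.1]) hq'
  | cons a m ih =>
    cases m' with
    | nil =>
      have h1 : σ p = q := h'
      exact absurd (by simp [← h1, h.1]) hq
    | cons a' m' =>
      obtain rfl : a = a' := h.1.symm.trans h'.1
      simp only [List.mem_cons, not_or] at hq hq'
      rw [ih h.2 h'.2 hq.2 hq'.2]

theorem Walk.apply_mem {σ : Equiv.Perm P} {p q r : P} {m : List P} (h : Walk σ p m q) :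
    σ r ∈ m ++ [q] ↔ r ∈ p :: m := by
  rw [← (map_cons_eq_iff_walk σ m p q).2 h, List.mem_map]
  exact ⟨fun ⟨r', h1, h2⟩ => σ.injective h2 ▸ h1, fun h1 => ⟨r, h1, rfl⟩⟩

theorem Walk.eq_of_forall {σ : Equiv.Perm P} {p q : P} {m : List P} (h : Walk σ p m q)
    {β : Type*} {c : P → β} (hc : ∀ r ∈ p :: m, c (σ r) = c r) : c q = c p := by
  induction m generalizing p with
  | nil =>
    have h : σ p = q := h
    rw [← h, hc p (by simp)]
  | cons a m ih =>
    rw [ih h.2 fun r hr => hc r (List.mem_cons_of_mem _ hr), ← h.1, hc p (by simp)]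

end Lists

/-! ### Deletion of a loop, and choice of the upper passes -/

namespace MarkedDiagram

variable {Y : Type} [DecidableEq Y]

/-- Deleting all the crossings met by a closed path preserves balancedness. -/
theorem Balanced.delete {D : MarkedDiagram Y} (h : D.Balanced) {c : Y} {b : Bool}
    {γ : List (Y × Bool)} (hw : Walk D.next (c, b) γ (c, !b)) (hb : (c, b) ∉ γ)
    (hb' : (c, !b) ∉ γ) {E : Finset Y} (hcE : c ∈ E) (hc : c ∈ D.active)
    (hE : ∀ x ∈ D.active, x ∉ E → ∀ b', (x, b') ∉ γ)
    (hE' : ∀ x ∈ E, x ≠ c → ∃ b', (x, b') ∈ γ) : (D.delete E).Balanced := by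
  intro S hS c₁ c₂ h1 h2
  have hSA : ∀ {x}, x ∈ S → x ∈ D.active ∧ x ∉ E := fun hx => by simpa using hS hx
  have hcS : c ∉ S := fun hh => (hSA hh).2 hcE
  have hins : insert c S ⊆ D.active := Finset.insert_subset hc fun x hx => (hSA hx).1
  have hγc : ∀ p ∈ γ, p.1 ≠ c := by
    rintro ⟨x, b'⟩ hp rfl
    by_cases e : b' = b
    · exact hb (e ▸ hp)
    · have : b' = !b := by cases b <;> cases b' <;> simp_all
      exact hb' (this ▸ hp)
  have hγS : ∀ p ∈ γ, p.1 ∉ S := by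
    rintro ⟨x, b'⟩ hp hx
    exact hE x (hSA hx).1 (hSA hx).2 b' hp
  have hex : ∀ (T : Finset Y) (p : Y × Bool), p.1 ∉ T →
      GaussDiagram.exchange (T : Set Y) p = p := by
    rintro T ⟨x, b'⟩ hp
    simp [GaussDiagram.exchange, Function.Involutive.toPerm, show x ∉ T from hp]
  have hexc : ∀ b', GaussDiagram.exchange ((insert c S : Finset Y) : Set Y) (c, b') = (c, !b') := by
    intro b'
    simp [GaussDiagram.exchange, Function.Involutive.toPerm]
  have hexne : ∀ p : Y × Bool, p.1 ≠ c → GaussDiagram.exchange ((insert c S : Finset Y) : Set Y) p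
      = GaussDiagram.exchange (S : Set Y) p := by
    rintro ⟨x, b'⟩ hp
    simp [GaussDiagram.exchange, Function.Involutive.toPerm, show x ≠ c from hp]
  -- Smoothing `c` splits off the closed path `γ` together with `(c, !b)`. A cycle function set to
  -- zero on this path is a cycle function of the diagram smoothed at `insert c S`.
  have key : ∀ k : Y × Bool → ℤ,
      (∀ p, k ((D.delete E).next (GaussDiagram.exchange (S : Set Y) p)) = k p) →
      ∀ p, (fun p => if p ∈ γ ++ [(c, !b)] then 0 else k p)
        (D.next (GaussDiagram.exchange ((insert c S : Finset Y) : Set Y) p)) =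
        (fun p => if p ∈ γ ++ [(c, !b)] then 0 else k p) p := by
    intro k hk p
    have hk' : ∀ p, k (D.next (GaussDiagram.exchange (S : Set Y) p)) = k p := hk
    dsimp only
    by_cases hp : p ∈ γ ++ [(c, !b)]
    · rw [if_pos hp, if_pos]
      rw [hw.apply_mem]
      rcases List.mem_append.1 hp with hp | hp
      · rw [hex _ _ (by simpa using ⟨hγc p hp, hγS p hp⟩)]
        exact List.mem_cons_of_mem _ hp
      · rw [List.mem_singleton.1 hp, hexc]
        simp
    · rw [if_neg hp]
      by_cases hpc : p.1 = c
      · have hpb : p = (c, b) := by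
          obtain ⟨x, b'⟩ := p
          obtain rfl : x = c := hpc
          by_cases e : b' = b
          · rw [e]
          · have : b' = !b := by cases b <;> cases b' <;> simp_all
            exact absurd (by simp [this]) hp
        rw [hpb, hexc, if_neg]
        · have e1 := hk' (c, !b)
          rw [hex _ _ hcS] at e1
          rw [e1]
          refine hw.eq_of_forall (c := k) fun r hr => ?_
          have e2 := hk' r
          rwa [hex] at e2
          rcases List.mem_cons.1 hr with rfl | hr
          · exact hcS
          · exact hγS r hr
        · rw [hw.apply_mem]
          simpa using hb'
      · rw [hexne p hpc, if_neg, hk']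
        rw [hw.apply_mem, List.mem_cons, not_or]
        refine ⟨fun e => hpc (congrArg Prod.fst e), fun e => ?_⟩
        have e1 : p.1 ∉ S := by
          have := hγS _ e
          rwa [GaussDiagram.exchange_fst] at this
        rw [hex _ _ e1] at e
        exact hp (by simp [e])
  have := h (insert c S) hins (fun p => if p ∈ γ ++ [(c, !b)] then 0 else c₁ p)
    (fun p => if p ∈ γ ++ [(c, !b)] then 0 else c₂ p) (key c₁ h1) (key c₂ h2)
  rw [← this]
  have hsub : (D.delete E).active \ S ⊆ D.active \ insert c S := by
    intro x hx
    simp only [delete_active, Finset.mem_sdiff, Finset.mem_insert, not_or] at hx ⊢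
    refine ⟨hx.1.1, ?_, hx.2⟩
    rintro rfl
    exact hx.1.2 hcE
  refine (Finset.sum_congr rfl fun x hx => ?_).trans (Finset.sum_subset hsub fun x hx hx' => ?_)
  · simp only [delete_active, Finset.mem_sdiff] at hx
    have hxc : x ≠ c := by
      rintro rfl
      exact hx.1.2 hcE
    have : ∀ b', (x, b') ∉ γ ++ [(c, !b)] := by
      intro b' hh
      rcases List.mem_append.1 hh with hh | hh
      · exact hE x hx.1.1 hx.1.2 b' hh
      · simp [hxc] at hh
    simp only [if_neg (this _)]
    rfl
  · simp only [delete_active, Finset.mem_sdiff, Finset.mem_insert, not_or, not_and,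
      not_not] at hx hx'
    have hxE : x ∈ E := by
      by_contra hh
      exact hx.2.2 (hx' ⟨hx.1, hh⟩)
    -- Both modified functions vanish at the pass of `x` on the path, and each product in the
    -- summand contains a value at that pass.
    obtain ⟨b', hb'⟩ := hE' x hxE hx.2.1
    have : (x, b') ∈ γ ++ [(c, !b)] := by simp [hb']
    cases b' <;> simp only [if_pos this, mul_zero, zero_mul, sub_zero]

/-- Choose the upper passes of a diagram. -/
def setUpper (D : MarkedDiagram Y) (o : Y → Bool) : MarkedDiagram Y := { D with upper := o }

open scoped Classical in
/-- The upper passes for which the active crossings are first passed over in the list `H`. -/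
noncomputable def firstPass (D : MarkedDiagram Y) (H : List (Y × Bool)) (x : Y) : Bool :=
  if x ∈ D.active then decide ([(x, true), (x, false)].Sublist H) else D.upper x

theorem firstPass_spec (D : MarkedDiagram Y) {H : List (Y × Bool)} (hH : ∀ p, p ∈ H)
    {x : Y} (hx : x ∈ D.active) :
    [(x, D.firstPass H x), (x, !D.firstPass H x)].Sublist H := by
  unfold firstPass
  rw [if_pos hx]
  by_cases h : [(x, true), (x, false)].Sublist H
  · simp [h]
  · simpa [h] using (pair_sublist_total (hH (x, true)) (hH (x, false)) (by simp)).resolve_left h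

theorem firstPass_eq (D : MarkedDiagram Y) {H : List (Y × Bool)} (hH : H.Nodup)
    {x : Y} (hx : x ∈ D.active) {b : Bool} (h : [(x, b), (x, !b)].Sublist H) :
    D.firstPass H x = b := by
  unfold firstPass
  rw [if_pos hx]
  cases b
  · simpa using pair_sublist_asymm hH h
  · simpa using h

theorem firstPass_congr (D : MarkedDiagram Y) {H H' : List (Y × Bool)} {x : Y}
    (f : Y × Bool → Bool) (h1 : f (x, true)) (h2 : f (x, false)) (h : H.filter f = H'.filter f) :
    D.firstPass H x = D.firstPass H' x := by
  unfold firstPass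
  simp only [pair_sublist_congr f h1 h2 h]

theorem bad_eq_empty {D : MarkedDiagram Y} {l : List (List (Y × Bool))} (hl : l.flatten.Nodup)
    (h : ∀ x ∈ D.active, [(x, D.upper x), (x, !D.upper x)].Sublist l.flatten) : D.bad l = ∅ := by
  rw [Finset.eq_empty_iff_forall_notMem]
  intro x hx
  obtain ⟨h1, h2⟩ := Finset.mem_filter.1 hx
  exact pair_sublist_asymm hl h2 (h x h1)

theorem bad_setUpper_firstPass {D : MarkedDiagram Y} {l : List (List (Y × Bool))}
    (hl : IsTrav D.next l) : (D.setUpper (D.firstPass l.flatten)).bad l = ∅ :=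
  bad_eq_empty hl.nodup fun _ hx => D.firstPass_spec hl.mem hx

theorem IsTraversal.perm {D : MarkedDiagram Y} {l l' : List (List (Y × Bool))}
    (h : D.IsTraversal l) (hp : l.Perm l') : D.IsTraversal l' :=
  ⟨h.1.perm hp, (hp.countP_eq _).symm.trans h.2⟩

theorem IsTraversal.rotate_word {D : MarkedDiagram Y} {L₁ L₂ : List (List (Y × Bool))}
    {u r : List (Y × Bool)} (h : D.IsTraversal (L₁ ++ (u ++ r) :: L₂)) :
    D.IsTraversal (L₁ ++ (r ++ u) :: L₂) := by
  refine ⟨h.1.rotate_word, Eq.trans ?_ h.2⟩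
  have : (r ++ u).isEmpty = (u ++ r).isEmpty := by
    cases u <;> cases r <;> simp
  simp [List.countP_append, List.countP_cons, this]

theorem sameWord_refl {C : Finset Y} (w : List (Y × Bool)) :
    SameWord id (fun _ => false) C w w := by
  have : passMap (id : Y → Y) (fun _ => false) = id := by
    funext p
    simp [passMap]
  unfold SameWord
  rw [this, List.map_id, Finset.image_id]

/-- Shielded crossings may be dropped while the traversal is kept; in the diagram without `E`
nothing is left to shield. -/
theorem matching_delete {m : Bool} {D : MarkedDiagram Y} {l : List (List (Y × Bool))}
    (hl : D.IsTraversal l) {E : Finset Y} (h : Shielded m D l.flatten (D.active \ E)) :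
    Matching m id (fun _ => false) (D.active \ E) D l (D.delete E) l where
  inj := Function.injective_id
  isTraversal := hl
  isTraversal' := hl
  image_subset := by simp
  subset := subset_rfl
  upper y _ := by simp [delete]
  sgn _ _ := rfl
  words := List.forall₂_same.2 fun w _ => sameWord_refl w
  shielded := by simpa using h
  shielded' := shielded_of_subset subset_rfl

end MarkedDiagram

/-! ### Change of base point, and components with a self crossing -/

namespace SkeinData

open MarkedDiagram

variable {Y : Type} [DecidableEq Y] [Finite Y] {R : Type*} [CommRing R] (K : SkeinData R)

/-- To compare two traversals the crossings may be chosen at will. -/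
theorem evalAlong_eq_of_setUpper {D : MarkedDiagram Y} {l l' : List (List (Y × Bool))}
    (hl : D.IsTraversal l) (hl' : D.IsTraversal l') {o : Y → Bool}
    (ho : ∀ x, x ∉ D.active → o x = D.upper x)
    (h : K.evalAlong (D.setUpper o) l = K.evalAlong (D.setUpper o) l') :
    K.evalAlong D l = K.evalAlong D l' := by
  induction hN : (D.active.filter fun x => o x ≠ D.upper x).card generalizing D with
  | zero =>
    have : D.setUpper o = D := by
      ext1 <;> try rfl
      funext x
      by_cases hx : x ∈ D.active
      · by_contra hne
        rw [Finset.card_eq_zero, Finset.filter_eq_empty_iff] at hN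
        exact hN hx hne
      · exact ho x hx
    rwa [this] at h
  | succ N ih =>
    obtain ⟨x, hx⟩ := Finset.card_pos.1 (by rw [hN]; exact N.succ_pos)
    obtain ⟨hx1, hx2⟩ := Finset.mem_filter.1 hx
    -- Both expansions have the same smoothed term, which does not involve the traversal, so one
    -- disagreement with `o` is removed on both sides at once.
    rw [K.evalAlong_skein hl hx1, K.evalAlong_skein hl' hx1]
    refine congrArg (fun α => K.combine D x α _) ?_
    refine ih (D := D.flip x) hl hl' (fun y hy => ?_) h ?_
    · rw [flip_upper_of_ne, ho y hy]
      rintro rfl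
      exact hy hx1
    · have : ((D.flip x).active.filter fun y => o y ≠ (D.flip x).upper y) =
          (D.active.filter fun y => o y ≠ D.upper y).erase x := by
        ext y
        by_cases hyx : y = x
        · subst hyx
          simp only [Finset.mem_filter, flip_upper_self, Finset.mem_erase, ne_eq, not_true_eq_false,
            false_and, iff_false, not_and, not_not]
          intro _
          cases h1 : o y <;> cases h2 : D.upper y <;> simp_all
        · simp [flip_upper_of_ne _ hyx, hyx]
      rw [this, Finset.card_erase_of_mem hx, hN]
      rfl

/-- This is `aₙ = aₙ ∘ aₙ₊₁`; at a negative crossing, the same equation solved for the changed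
diagram. -/
theorem combine_descending {D : MarkedDiagram Y} {x : Y} (hx : D.IsSelf x) {n : ℕ} (hn : 1 ≤ n) :
    K.combine D x (K.a n) (K.a (n + 1)) = K.a n := by
  have e1 := K.a_eq n hn
  have e2 := K.v_mul_vInv
  unfold combine kindCoeff
  rw [if_pos hx]
  rcases Int.units_eq_one_or (D.sgn x) with hs | hs
  · rw [hs]
    simp only [switchCoeff, smoothCoeff, if_true]
    exact e1.symm
  · rw [hs]
    simp only [switchCoeff, smoothCoeff, if_neg (show ¬ (-1 : ℤˣ) = 1 by decide)]
    linear_combination K.vInv ^ 2 * e1 + (K.a n * (K.v * K.vInv + 1)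
      + K.vInv * K.w * K.a (n + 1)) * e2

/-- Independence of the base point of a component. -/
theorem evalAlong_rotate_one {n : ℕ} (hn : K.Independent Y n) {D : MarkedDiagram Y}
    (hD : D.Balanced) (hc : D.active.card ≤ n) {L₁ L₂ : List (List (Y × Bool))} {p : Y × Bool}
    {m : List (Y × Bool)} (hl : D.IsTraversal (L₁ ++ (p :: m) :: L₂)) :
    K.evalAlong D (L₁ ++ (p :: m) :: L₂) = K.evalAlong D (L₁ ++ (m ++ [p]) :: L₂) := by
  have hl' : D.IsTraversal (L₁ ++ (m ++ [p]) :: L₂) := hl.rotate_word (u := [p])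
  -- Make the diagram descending along the first traversal. When `p` moves to the end of its
  -- component, only the crossing of `p` can become bad.
  refine K.evalAlong_eq_of_setUpper hl hl'
    (o := D.firstPass (L₁ ++ (p :: m) :: L₂).flatten) (fun x hx => if_neg hx) ?_
  have hspec := fun x => D.firstPass_spec (x := x) hl.1.mem
  have hfirst := fun x b (hx : x ∈ D.active) => D.firstPass_eq (b := b) hl.1.nodup hx
  rw [K.evalAlong_of_bad_eq_empty (bad_setUpper_firstPass hl.1)]
  set D₀ := D.setUpper (D.firstPass (L₁ ++ (p :: m) :: L₂).flatten) with hD₀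
  have hlen : (L₁ ++ (m ++ [p]) :: L₂).length = (L₁ ++ (p :: m) :: L₂).length := by simp
  have hspec' : ∀ x ∈ D.active, [(x, D₀.upper x), (x, !D₀.upper x)].Sublist
    (L₁ ++ (p :: m) :: L₂).flatten := fun x hx => hspec x hx
  obtain ⟨x, b⟩ := p
  have hother : ∀ y ∈ D.active, y ≠ x → [(y, D₀.upper y), (y, !D₀.upper y)].Sublist
      (L₁ ++ (m ++ [(x, b)]) :: L₂).flatten := by
    intro y hy hyx
    refine (pair_sublist_congr (fun q => q.1 ≠ x) (by simpa using hyx) (by simpa using hyx) ?_).1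
      (hspec' y hy)
    simp
  -- If the other pass is on the same component, it now comes first: changing the bad self crossing
  -- `x` gives a descending diagram, and smoothing it gives a descending one with one more
  -- component. Otherwise no active crossing changes its order.
  by_cases hx : x ∈ D.active ∧ (x, !b) ∈ m
  · obtain ⟨hxa, hxm⟩ := hx
    obtain ⟨t, r, rfl⟩ := List.append_of_mem hxm
    have hfl : (L₁ ++ ((x, b) :: (t ++ (x, !b) :: r)) :: L₂).flatten =
        L₁.flatten ++ ((x, b) :: (t ++ (x, !b) :: (r ++ L₂.flatten))) := by simp
    have hxb : D₀.upper x = b := by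
      refine hfirst x b hxa ?_
      rw [hfl]
      refine (List.Sublist.cons_cons _ ?_).trans (List.sublist_append_right _ _)
      exact List.singleton_sublist.2 (by simp)
    have hself : D₀.IsSelf x := (D₀.isSelf_iff x b).2
      (IsTrav.sameCycle_of_self (L₁ := L₁) (u := []) hl.1)
    -- With `m = false` the piece `t` precedes `r`, as in the old word, so the other crossings keep
    -- their order.
    have hcut : (D₀.smooth x).IsTraversal _ :=
      IsTraversal.selfCut (D := D₀) (L₁ := L₁) (u := []) hl false
    rw [K.evalAlong_skein (D := D₀) hl' hxa]
    have e1 : K.evalAlong (D₀.flip x) (L₁ ++ (t ++ (x, !b) :: r ++ [(x, b)]) :: L₂) =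
        K.a (L₁ ++ ((x, b) :: (t ++ (x, !b) :: r)) :: L₂).length := by
      rw [← hlen]
      refine K.evalAlong_of_bad_eq_empty (bad_eq_empty hl'.1.nodup fun y hy => ?_)
      by_cases hyx : y = x
      · subst hyx
        rw [flip_upper_self, hxb, Bool.not_not]
        simp only [List.flatten_append, List.flatten_cons, pair_sublist_append]
        right; left; left; right; right
        simp
      · rw [flip_upper_of_ne _ hyx]
        exact hother y hy hyx
    have e2 : K.eval (D₀.smooth x) =
        K.a ((L₁ ++ ((x, b) :: (t ++ (x, !b) :: r)) :: L₂).length + 1) := by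
      rw [eval, hn (D₀.smooth x) (Balanced.smooth (D := D₀) hD hxa)
        ((Finset.card_erase_lt_of_mem hxa).trans_le hc) _ _ (isTraversal_trav _) hcut]
      rw [K.evalAlong_of_bad_eq_empty, length_selfCut]
      · rfl
      refine bad_eq_empty hcut.1.nodup fun y hy => ?_
      obtain ⟨hyx, hy⟩ := Finset.mem_erase.1 hy
      rw [smooth_upper_of_ne _ hyx]
      refine (pair_sublist_congr (fun q => q.1 ≠ x) (by simpa using hyx) (by simpa using hyx) ?_).1
        (hspec' y hy)
      simp [selfCut]
    rw [e1, e2, K.combine_descending hself (by simp; omega)]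
  · rw [K.evalAlong_of_bad_eq_empty, hlen]
    refine bad_eq_empty hl'.1.nodup fun y hy => ?_
    by_cases hyx : y = x
    · subst hyx
      have hxm : (y, !b) ∉ m := fun hh => hx ⟨hy, hh⟩
      have hxm' : (y, b) ∉ m := by
        have := hl.1.nodup
        simp [List.nodup_append] at this
        tauto
      have hm : ∀ b', (y, b') ∉ m := by
        intro b'
        by_cases e : b' = b
        · rwa [e]
        · have : b' = !b := by cases b <;> cases b' <;> simp_all
          rwa [this]
      refine (pair_sublist_congr (fun q => decide (q ∉ m)) (by simpa using hm _)
        (by simpa using hm _) ?_).1 (hspec' y hy)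
      have : m.filter (fun q => decide (q ∉ m)) = [] := by
        rw [List.filter_eq_nil_iff]
        intro q hq
        simpa using hq
      simp only [List.flatten_append, List.flatten_cons, List.filter_append, List.filter_cons,
        List.filter_nil, this, hxm']
      simp
    · exact hother y hy hyx

theorem evalAlong_rotate {n : ℕ} (hn : K.Independent Y n) {D : MarkedDiagram Y}
    (hD : D.Balanced) (hc : D.active.card ≤ n) {L₁ L₂ : List (List (Y × Bool))}
    {u r : List (Y × Bool)} (hl : D.IsTraversal (L₁ ++ (u ++ r) :: L₂)) :
    K.evalAlong D (L₁ ++ (u ++ r) :: L₂) = K.evalAlong D (L₁ ++ (r ++ u) :: L₂) := by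
  induction u generalizing r with
  | nil => simp
  | cons p u ih =>
    have h1 : D.IsTraversal (L₁ ++ (u ++ r ++ [p]) :: L₂) := hl.rotate_word (u := [p])
    have h2 := ih (r := r ++ [p]) (by simpa using h1)
    have h3 := K.evalAlong_rotate_one hn hD hc (p := p) (m := u ++ r) hl
    rw [List.append_assoc] at h3
    exact (h3.trans h2).trans (by simp)

/-- Moving a component with a self crossing to the front. -/
theorem evalAlong_front_of_self {n : ℕ} (hn : K.Independent Y n) {D : MarkedDiagram Y}
    (hD : D.Balanced) (hc : D.active.card ≤ n) {U V : List (List (Y × Bool))} {c : Y} {b : Bool}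
    {γ δ : List (Y × Bool)} (hca : c ∈ D.active)
    (hl : D.IsTraversal (U ++ ((c, b) :: (γ ++ (c, !b) :: δ)) :: V)) :
    K.evalAlong D (U ++ ((c, b) :: (γ ++ (c, !b) :: δ)) :: V) =
      K.evalAlong D (((c, b) :: (γ ++ (c, !b) :: δ)) :: (U ++ V)) := by
  have hl' : D.IsTraversal (((c, b) :: (γ ++ (c, !b) :: δ)) :: (U ++ V)) :=
    hl.perm List.perm_middle
  set l := U ++ ((c, b) :: (γ ++ (c, !b) :: δ)) :: V with hldef
  set l' := ((c, b) :: (γ ++ (c, !b) :: δ)) :: (U ++ V) with hldef'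
  -- The diagram is made descending for the order: first loop at `c`, then `U`, then the second
  -- loop, then `V`. Along `l'` the first loop is an initial segment and can be deleted, after which
  -- `H` agrees with `l`. Along `l` the second loop can be deleted from the end, after which `H`
  -- agrees with `l'`. In both cases `c` disappears, so the inductive hypothesis permits the change
  -- of traversal.
  set H := ((c, b) :: (γ ++ [(c, !b)])) ++ (U.flatten ++ (δ ++ V.flatten)) with hH
  have hlf : l.flatten = U.flatten ++ ((c, b) :: (γ ++ (c, !b) :: (δ ++ V.flatten))) := by
    simp [hldef]
  have hlf' : l'.flatten = ((c, b) :: (γ ++ [(c, !b)])) ++ (δ ++ (U.flatten ++ V.flatten)) := by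
    simp [hldef']
  have hHp : H.Perm l.flatten := by
    rw [List.perm_iff_count]
    intro a
    simp [hH, hlf, List.count_cons]
    omega
  have hHnd : H.Nodup := hHp.nodup_iff.2 hl.1.nodup
  have hHm : ∀ p, p ∈ H := fun p => hHp.mem_iff.2 (hl.1.mem p)
  have hnd2 : ((c, b) :: (c, !b) :: (γ ++ δ)).Nodup := by
    have : ((c, b) :: (γ ++ (c, !b) :: δ)).Nodup :=
      (List.nodup_flatten.1 hl.1.nodup).1 _ (by simp [hldef])
    refine (List.Perm.nodup_iff ?_).1 this
    exact List.Perm.cons _ List.perm_middle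
  simp only [List.nodup_cons, List.mem_cons, List.mem_append, not_or] at hnd2
  obtain ⟨⟨-, hbγ, hbδ⟩, ⟨hbγ', hbδ'⟩, -⟩ := hnd2
  have hcyc : IsCycleWord D.next ((c, b) :: (γ ++ (c, !b) :: δ)) := hl.1.cyc _ (by simp [hldef])
  rw [isCycleWord_cons, walk_append] at hcyc
  obtain ⟨hw1, hw2⟩ := hcyc
  refine K.evalAlong_eq_of_setUpper hl hl' (o := D.firstPass H) (fun x hx => if_neg hx) ?_
  have hspec := fun x hx => D.firstPass_spec (x := x) hHm hx
  have hupc : D.firstPass H c = b := by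
    refine D.firstPass_eq hHnd hca ?_
    rw [hH, List.cons_append]
    exact List.Sublist.cons_cons _ (List.singleton_sublist.2 (by simp))
  set D₀ := D.setUpper (D.firstPass H) with hD₀
  have hup : ∀ x, D₀.upper x = D.firstPass H x := fun _ => rfl
  have hspec : ∀ x ∈ D₀.active, [(x, D₀.upper x), (x, !D₀.upper x)].Sublist H := hspec
  have hDb : D₀.Balanced := hD
  have hlen : l'.length = l.length := by simp [hldef, hldef']; omega
  -- deletion of the first loop
  have eq1 : K.evalAlong D₀ l' = K.a l.length := by
    set E := D.active.filter (fun x => ∃ b', (x, b') ∈ (c, b) :: (γ ++ [(c, !b)])) with hE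
    have hcE : c ∈ E := Finset.mem_filter.2 ⟨hca, b, by simp⟩
    have hbal : (D₀.delete E).Balanced := by
      refine hDb.delete hw1 hbγ hbγ' hcE hca (fun x hx hxE b' hh => ?_) fun x hx hxc => ?_
      · exact hxE (Finset.mem_filter.2 ⟨hx, b', by simp [hh]⟩)
      · obtain ⟨-, b', hh⟩ := Finset.mem_filter.1 hx
        refine ⟨b', ?_⟩
        simpa [hxc] using hh
    have hshield : Shielded true D₀ l'.flatten (D₀.active \ E) := by
      refine ⟨(c, b) :: (γ ++ [(c, !b)]), ?_, fun x hx hh => ?_, fun x hx hxE => ?_⟩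
      · rw [hlf']
        exact List.prefix_append _ _
      · rw [Bool.xor_true] at hh
        exact pair_sublist_left (hspec x hx) hHnd hh
      · have hxE : x ∈ E := by
          by_contra hh
          exact hxE (Finset.mem_sdiff.2 ⟨hx, hh⟩)
        obtain ⟨-, b', hh⟩ := Finset.mem_filter.1 hxE
        simp only [Bool.not_true, Bool.xor_false]
        by_cases e : b' = D₀.upper x
        · rwa [← e]
        · have e' : b' = !D₀.upper x := by cases b' <;> cases h : D₀.upper x <;> simp_all
          rw [e'] at hh
          exact (pair_sublist_left (hspec x hx) hHnd hh).subset (by simp)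
    have hlt : (D₀.delete E).active.card < D.active.card := by
      refine Finset.card_lt_card ((Finset.ssubset_iff_of_subset Finset.sdiff_subset).2 ⟨c, hca, ?_⟩)
      simp [hcE]
    rw [K.evalAlong_eq_of_matching hn hn (matching_delete (D := D₀) hl' hshield) hDb hbal hc
      (hlt.le.trans hc), hn (D₀.delete E) hbal (hlt.trans_le hc) l' l hl' hl]
    refine K.evalAlong_of_bad_eq_empty (bad_eq_empty hl.1.nodup fun x hx => ?_)
    obtain ⟨hx, hxE⟩ := Finset.mem_sdiff.1 hx
    have hx1 : ∀ b', (x, b') ∉ (c, b) :: (γ ++ [(c, !b)]) := fun b' hh =>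
      hxE (Finset.mem_filter.2 ⟨hx, b', hh⟩)
    have h1 := (pair_sublist_filter (f := fun q => decide (q ∉ (c, b) :: (γ ++ [(c, !b)])))
      (decide_eq_true (hx1 _)) (decide_eq_true (hx1 _))).1 (hspec x hx)
    refine h1.trans ?_
    have h2 : ((c, b) :: (γ ++ [(c, !b)])).filter
        (fun q => decide (q ∉ (c, b) :: (γ ++ [(c, !b)]))) = [] := by
      rw [List.filter_eq_nil_iff]
      intro q hq
      rw [decide_eq_true_eq, not_not]
      exact hq
    rw [hH, List.filter_append, h2, List.nil_append]
    refine List.filter_sublist.trans ?_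
    rw [hlf]
    refine List.Sublist.append_left ?_ _
    refine List.Sublist.cons _ ?_
    exact (List.sublist_cons_self _ _).trans (List.sublist_append_right _ _)
  -- deletion of the second loop
  have eq2 : K.evalAlong D₀ l = K.a l.length := by
    set E := D.active.filter (fun x => ∃ b', (x, b') ∈ (c, !b) :: δ) with hE
    have hcE : c ∈ E := Finset.mem_filter.2 ⟨hca, !b, by simp⟩
    have hbal : (D₀.delete E).Balanced := by
      have hw2' : Walk D₀.next (c, !b) δ (c, !!b) := by rw [Bool.not_not]; exact hw2
      refine hDb.delete hw2' hbδ' (by rwa [Bool.not_not]) hcE hca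
        (fun x hx hxE b' hh => ?_) fun x hx hxc => ?_
      · exact hxE (Finset.mem_filter.2 ⟨hx, b', by simp [hh]⟩)
      · obtain ⟨-, b', hh⟩ := Finset.mem_filter.1 hx
        refine ⟨b', ?_⟩
        simpa [hxc] using hh
    have hright : ∀ x ∈ D₀.active, (x, D₀.upper x) ∈ δ ++ V.flatten →
        [(x, D₀.upper x), (x, !D₀.upper x)].Sublist (δ ++ V.flatten) := by
      intro x hx hh
      have h1 := hspec x hx
      rw [hH, ← List.append_assoc] at h1
      refine pair_sublist_right h1 ?_ hh
      rw [List.append_assoc]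
      exact hHnd
    have hshield : Shielded false D₀ l.flatten (D₀.active \ E) := by
      -- The segment must reach the end of the traversal, hence includes `V`; it starts with the
      -- lower pass of `c`, which shields `c` itself.
      refine ⟨(c, !b) :: (δ ++ V.flatten), ?_, fun x hx hh => ?_, fun x hx hxE => ?_⟩
      · rw [hlf]
        exact ⟨U.flatten ++ (c, b) :: γ, by simp⟩
      · rw [Bool.xor_false] at hh
        rcases List.mem_cons.1 hh with hh | hh
        · exfalso
          obtain ⟨rfl, h2⟩ := Prod.mk.inj hh
          rw [hup, hupc] at h2
          cases b <;> simp at h2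
        · exact (hright x hx hh).trans (List.sublist_cons_self _ _)
      · have hxE : x ∈ E := by
          by_contra hh
          exact hxE (Finset.mem_sdiff.2 ⟨hx, hh⟩)
        obtain ⟨-, b', hh⟩ := Finset.mem_filter.1 hxE
        simp only [Bool.not_false, Bool.xor_true]
        rcases List.mem_cons.1 hh with hh | hh
        · obtain ⟨rfl, -⟩ := Prod.mk.inj hh
          rw [hup, hupc]
          simp
        · by_cases e : b' = D₀.upper x
          · rw [e] at hh
            exact List.mem_cons_of_mem _
              ((hright x hx (List.mem_append_left _ hh)).subset (by simp))
          · have e' : b' = !D₀.upper x := by cases b' <;> cases h : D₀.upper x <;> simp_all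
            rw [← e']
            simp [hh]
    have hlt : (D₀.delete E).active.card < D.active.card := by
      refine Finset.card_lt_card ((Finset.ssubset_iff_of_subset Finset.sdiff_subset).2 ⟨c, hca, ?_⟩)
      simp [hcE]
    rw [K.evalAlong_eq_of_matching hn hn (matching_delete (D := D₀) hl hshield) hDb hbal hc
      (hlt.le.trans hc), hn (D₀.delete E) hbal (hlt.trans_le hc) l l' hl hl', ← hlen]
    refine K.evalAlong_of_bad_eq_empty (bad_eq_empty hl'.1.nodup fun x hx => ?_)
    obtain ⟨hx, hxE⟩ := Finset.mem_sdiff.1 hx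
    have hx1 : ∀ b', (x, b') ∉ δ := fun b' hh =>
      hxE (Finset.mem_filter.2 ⟨hx, b', by simp [hh]⟩)
    have h1 := (pair_sublist_filter (f := fun q => decide (q ∉ δ))
      (decide_eq_true (hx1 _)) (decide_eq_true (hx1 _))).1 (hspec x hx)
    refine h1.trans ?_
    have h2 : δ.filter (fun q => decide (q ∉ δ)) = [] := by
      rw [List.filter_eq_nil_iff]
      intro q hq
      rw [decide_eq_true_eq, not_not]
      exact hq
    rw [hH, List.filter_append, List.filter_append, List.filter_append δ, h2, List.nil_append, hlf']
    refine List.filter_sublist.append ?_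
    exact (List.filter_sublist.append List.filter_sublist).trans (List.sublist_append_right _ _)
  rw [eq1, eq2]

end SkeinData

/-! ### Components without self crossings, and independence of the traversal -/

namespace SkeinData

open MarkedDiagram

variable {Y : Type} [DecidableEq Y] [Finite Y] {R : Type*} [CommRing R] (K : SkeinData R)

/-- The skein relation at a positive mixed crossing as a bijection. -/
def starEquiv (β : R) : Equiv.Perm R where
  toFun α := K.v ^ 2 * α + K.v * K.z * β
  invFun α := K.vInv ^ 2 * α - K.vInv * K.z * β
  left_inv α := by linear_combination (α * (K.v * K.vInv + 1) + K.vInv * K.z * β) * K.v_mul_vInv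
  right_inv α := by linear_combination (α * (K.v * K.vInv + 1) - K.v * K.z * β) * K.v_mul_vInv

/-- With the smoothed value fixed, mixed crossing changes of both signs act by powers of one
permutation, so the exponents of successive changes add up. -/
theorem combine_of_not_isSelf {D : MarkedDiagram Y} {x : Y} (h : ¬ D.IsSelf x) (α β : R) :
    K.combine D x α β = (K.starEquiv β ^ (D.sgn x : ℤ)) α := by
  unfold combine kindCoeff
  rw [if_neg h]
  rcases Int.units_eq_one_or (D.sgn x) with hs | hs
  · rw [hs]
    simp [switchCoeff, smoothCoeff, starEquiv]
  · rw [hs]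
    simp only [switchCoeff, smoothCoeff, if_neg (show ¬ (-1 : ℤˣ) = 1 by decide), Units.val_neg,
      Units.val_one, zpow_neg, zpow_one]
    change _ = K.vInv ^ 2 * α - K.vInv * K.z * β
    ring

/-- The contribution of a pass to the linking number with the word `k`. -/
def linkingTerm (D : MarkedDiagram Y) (k : List (Y × Bool)) (q : Y × Bool) : ℤ :=
  -- The sign is that of the crossing when the strand of `k` is on top.
  if q.1 ∈ D.active ∧ (q.1, !q.2) ∈ k then (D.flat q.1 : ℤ) * (if q.2 then -1 else 1) else 0

/-- Up to sign this is the intersection number of `k` with the components in `U`: apply `Balanced`,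
with `S = ∅`, to the two indicator functions. -/
theorem sum_linkingTerm {D : MarkedDiagram Y} (hD : D.Balanced) {U V : List (List (Y × Bool))}
    {k : List (Y × Bool)} (hl : D.IsTraversal (U ++ k :: V)) :
    (U.flatten.map (linkingTerm D k)).sum = 0 := by
  have hU : U.flatten.Nodup := by
    have := hl.1.nodup
    rw [List.flatten_append] at this
    exact (List.nodup_append.1 this).1
  have hUcyc : ∀ p, D.next p ∈ U.flatten ↔ p ∈ U.flatten := by
    intro p
    simp only [List.mem_flatten]
    refine exists_congr fun w => and_congr_right fun hw => ?_
    exact (hl.1.cyc w (by simp [hw])).apply_mem_iff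
  have hkcyc : ∀ p, D.next p ∈ k ↔ p ∈ k := fun p => (hl.1.cyc k (by simp)).apply_mem_iff
  have hex : ∀ p : Y × Bool, GaussDiagram.exchange ((∅ : Finset Y) : Set Y) p = p := fun p => by
    simp [GaussDiagram.exchange, Function.Involutive.toPerm]
  have hbal := hD ∅ (by simp) (fun p => if p ∈ U.flatten then 1 else 0)
    (fun p => if p ∈ k then 1 else 0) (fun p => by simp only [hex, hUcyc])
    (fun p => by simp only [hex, hkcyc])
  rw [Finset.sdiff_empty] at hbal
  rw [← List.sum_toFinset _ hU]
  have h1 : ∑ q ∈ U.flatten.toFinset, linkingTerm D k q =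
      ∑ q ∈ D.active ×ˢ Finset.univ, if q ∈ U.flatten then linkingTerm D k q else 0 := by
    rw [← Finset.sum_filter]
    symm
    refine Finset.sum_subset (fun q hq => ?_) fun q hq hq' => ?_
    · exact List.mem_toFinset.2 (Finset.mem_filter.1 hq).2
    · rw [linkingTerm, if_neg]
      rintro ⟨h1, -⟩
      exact hq' (Finset.mem_filter.2 ⟨by simp [h1], List.mem_toFinset.1 hq⟩)
  rw [h1, Finset.sum_product, ← neg_eq_zero, ← Finset.sum_neg_distrib]
  refine Eq.trans ?_ hbal
  refine Finset.sum_congr rfl fun x hx => ?_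
  rw [Fintype.sum_bool]
  simp only [linkingTerm, hx, true_and, Bool.not_true, Bool.not_false]
  by_cases h1 : (x, true) ∈ U.flatten <;> by_cases h2 : (x, false) ∈ U.flatten <;>
    by_cases h3 : (x, true) ∈ k <;> by_cases h4 : (x, false) ∈ k <;>
    simp only [h1, h2, h3, h4, if_true, if_false] <;> norm_num

/-- Moving a component without self crossings to the front. -/
theorem evalAlong_front_of_no_self {n : ℕ} (hn : K.Independent Y n) {D : MarkedDiagram Y}
    (hD : D.Balanced) (hc : D.active.card ≤ n) {U V : List (List (Y × Bool))}
    {k : List (Y × Bool)} (hk : ∀ x ∈ D.active, ∀ b, (x, b) ∈ k → (x, !b) ∉ k)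
    (hl : D.IsTraversal (U ++ k :: V)) :
    K.evalAlong D (U ++ k :: V) = K.evalAlong D (k :: (U ++ V)) := by
  have hl' : D.IsTraversal (k :: (U ++ V)) := hl.perm List.perm_middle
  -- In the order `H A B` the passes of `A` come before `k` and those of `B` after it. Passes of `U`
  -- are moved from `B` to `A` one at a time; each of the two extreme choices is descending along
  -- one of the two traversals.
  set H : List (Y × Bool) → List (Y × Bool) → List (Y × Bool) := fun A B =>
    A ++ (k ++ (B ++ V.flatten)) with hH
  have hperm : ∀ A B, A ++ B = U.flatten → (H A B).Perm (U ++ k :: V).flatten := by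
    intro A B h
    rw [hH, List.flatten_append, List.flatten_cons, ← h, List.append_assoc]
    refine List.Perm.append_left _ ?_
    rw [← List.append_assoc, ← List.append_assoc]
    exact List.perm_append_comm.append_right _
  have hnd : ∀ A B, A ++ B = U.flatten → (H A B).Nodup := fun A B h =>
    (hperm A B h).nodup_iff.2 hl.1.nodup
  have hmem : ∀ A B, A ++ B = U.flatten → ∀ p, p ∈ H A B := fun A B h p =>
    (hperm A B h).mem_iff.2 (hl.1.mem p)
  refine K.evalAlong_eq_of_setUpper hl hl' (o := D.firstPass (H [] U.flatten))
    (fun x hx => if_neg hx) ?_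
  have e1 : K.evalAlong (D.setUpper (D.firstPass (H [] U.flatten))) (k :: (U ++ V)) =
      K.a (U ++ k :: V).length := by
    rw [K.evalAlong_of_bad_eq_empty]
    · simp; rfl
    · have := bad_setUpper_firstPass hl'.1
      simpa [hH] using this
  have e2 : K.evalAlong (D.setUpper (D.firstPass (H U.flatten []))) (U ++ k :: V) =
      K.a (U ++ k :: V).length := by
    rw [K.evalAlong_of_bad_eq_empty]
    have := bad_setUpper_firstPass hl.1
    simpa [hH] using this
  have step : ∀ A B q, A ++ q :: B = U.flatten →
      K.evalAlong (D.setUpper (D.firstPass (H A (q :: B)))) (U ++ k :: V) =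
        (K.starEquiv (K.a (U ++ V).length) ^ linkingTerm D k q)
          (K.evalAlong (D.setUpper (D.firstPass (H (A ++ [q]) B))) (U ++ k :: V)) := by
    intro A B q hAB
    obtain ⟨x, b⟩ := q
    have hAB' : (A ++ [(x, b)]) ++ B = U.flatten := by simpa using hAB
    have hnd1 := hnd _ _ hAB
    have hnd2 := hnd _ _ hAB'
    have hqk : (x, b) ∉ k := by
      intro hh
      have := hnd1
      simp only [hH, List.cons_append] at this
      rw [List.nodup_append] at this
      exact (List.nodup_append.1 this.2.1).2.2 _ hh _ (by simp) rfl
    have hne : ∀ y, y ≠ x → D.firstPass (H A ((x, b) :: B)) y =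
        D.firstPass (H (A ++ [(x, b)]) B) y := by
      intro y hy
      refine D.firstPass_congr (fun q => q.1 ≠ x) (by simpa using hy) (by simpa using hy) ?_
      simp [hH]
    -- Moving `q` past `k` affects only the crossing of `q`, and only if its other pass is on `k`;
    -- then a single mixed crossing is changed.
    by_cases hx : x ∈ D.active ∧ (x, !b) ∈ k
    · obtain ⟨hxa, hxk⟩ := hx
      have f1 : D.firstPass (H A ((x, b) :: B)) x = !b := by
        refine D.firstPass_eq hnd1 hxa ?_
        refine List.Sublist.trans ?_ (List.sublist_append_right _ _)
        rw [pair_sublist_append]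
        exact Or.inr (Or.inr ⟨hxk, by simp⟩)
      have f2 : D.firstPass (H (A ++ [(x, b)]) B) x = b := by
        refine D.firstPass_eq hnd2 hxa ?_
        rw [pair_sublist_append]
        exact Or.inr (Or.inr ⟨by simp, by simp [hxk]⟩)
      have hflip : (D.setUpper (D.firstPass (H A ((x, b) :: B)))).flip x =
          D.setUpper (D.firstPass (H (A ++ [(x, b)]) B)) := by
        ext1 <;> try rfl
        funext y
        by_cases hy : y = x
        · subst hy
          rw [flip_upper_self]
          change (!D.firstPass (H A ((y, b) :: B)) y) = D.firstPass (H (A ++ [(y, b)]) B) y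
          rw [f1, f2, Bool.not_not]
        · rw [flip_upper_of_ne _ hy]
          exact hne y hy
      obtain ⟨L₁, u₀, r₀, L₂, hU, hA, hB⟩ := List.exists_of_flatten_eq_append_cons hAB.symm
      obtain ⟨t, s, hts⟩ := List.append_of_mem hxk
      have hl2 : D.IsTraversal (L₁ ++ (u₀ ++ (x, b) :: r₀) :: (L₂ ++ (t ++ (x, !b) :: s) :: V)) := by
        have := hl
        rw [hU, hts] at this
        simpa using this
      have hns : ¬ D.IsSelf x := fun hh =>
        hl2.1.not_sameCycle_of_mixed ((D.isSelf_iff x b).1 hh)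
      set D₀ := D.setUpper (D.firstPass (H A ((x, b) :: B))) with hD₀
      have hcut : (D₀.smooth x).IsTraversal _ := IsTraversal.mixedCut (D := D₀) hl2 true
      -- The smoothed diagram is descending along the merged traversal. Its value is the same at
      -- every step, so one permutation `starEquiv` serves throughout.
      have e3 : K.eval (D₀.smooth x) = K.a (U ++ V).length := by
        rw [eval, hn (D₀.smooth x) (Balanced.smooth (D := D₀) hD hxa)
          ((Finset.card_erase_lt_of_mem hxa).trans_le hc) _ _ (isTraversal_trav _) hcut]
        rw [K.evalAlong_of_bad_eq_empty]
        · congr 1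
          simp [_root_.mixedCut, hU]
        refine bad_eq_empty hcut.1.nodup fun y hy => ?_
        obtain ⟨hyx, hy⟩ := Finset.mem_erase.1 hy
        rw [smooth_upper_of_ne _ hyx]
        have h1 : [(y, D₀.upper y), (y, !D₀.upper y)].Sublist
            (A ++ ((x, b) :: k ++ (B ++ V.flatten))) := by
          have h2 := D.firstPass_spec (hmem _ _ hAB') hy
          have h3 : D₀.upper y = D.firstPass (H (A ++ [(x, b)]) B) y := hne y hyx
          rw [← h3] at h2
          simpa [hH] using h2
        -- The merge replaces the block formed by `(x, b)` and `k` by one with `k` rotated. As `k`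
        -- has no self crossings, the two passes of `y` never both lie in that block.
        have h2 := pair_sublist_replace (K' := (x, b) :: (s ++ t ++ [(x, !b)])) h1 ?_ ?_
        · have e : (_root_.mixedCut true (x, b) (x, !b) L₁ u₀ r₀ L₂ t s V).flatten =
              A ++ ((x, b) :: (s ++ t ++ [(x, !b)]) ++ (B ++ V.flatten)) := by
            simp [_root_.mixedCut, hA, hB]
          rw [e]
          exact h2
        · rintro ⟨h3, h4⟩
          rcases List.mem_cons.1 h3 with h3 | h3
          · exact hyx (congrArg Prod.fst h3)
          rcases List.mem_cons.1 h4 with h4 | h4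
          · exact hyx (congrArg Prod.fst h4)
          exact hk y hy _ h3 h4
        · intro q hq
          rw [hts] at hq
          simp only [List.mem_cons, List.mem_append] at hq ⊢
          tauto
      rw [K.evalAlong_skein (D := D₀) hl hxa, hflip, e3, K.combine_of_not_isSelf (D := D₀) hns]
      have : (D₀.sgn x : ℤ) = linkingTerm D k (x, b) := by
        have : D₀.upper x = !b := f1
        have e4 : linkingTerm D k (x, b) = (D.flat x : ℤ) * (if b then -1 else 1) :=
          if_pos ⟨hxa, hxk⟩
        rw [sgn, this, e4]
        have : D₀.flat x = D.flat x := rfl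
        rw [this]
        cases b <;> simp
      rw [this]
    · have : D.firstPass (H A ((x, b) :: B)) = D.firstPass (H (A ++ [(x, b)]) B) := by
        funext y
        by_cases hy : y = x
        · subst hy
          by_cases hya : y ∈ D.active
          · have hyk : ∀ b', (y, b') ∉ k := by
              intro b'
              by_cases e : b' = b
              · rwa [e]
              · have : b' = !b := by cases b <;> cases b' <;> simp_all
                rw [this]
                exact fun hh => hx ⟨hya, hh⟩
            refine D.firstPass_congr (fun q => decide (q ∉ k)) (decide_eq_true (hyk _))
              (decide_eq_true (hyk _)) ?_
            have h2 : k.filter (fun q => decide (q ∉ k)) = [] := by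
              rw [List.filter_eq_nil_iff]
              intro q hq
              rw [decide_eq_true_eq, not_not]
              exact hq
            simp only [hH, List.filter_append, h2, List.filter_cons, List.filter_nil]
            simp [hqk]
          · rw [firstPass, firstPass, if_neg hya, if_neg hya]
        · exact hne y hy
      rw [this, linkingTerm, if_neg hx]
      rfl
  have chain : ∀ B A, A ++ B = U.flatten →
      K.evalAlong (D.setUpper (D.firstPass (H A B))) (U ++ k :: V) =
        (K.starEquiv (K.a (U ++ V).length) ^ (B.map (linkingTerm D k)).sum)
          (K.a (U ++ k :: V).length) := by
    intro B
    induction B with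
    | nil =>
      intro A hA
      rw [List.append_nil] at hA
      rw [hA, e2]
      rfl
    | cons q B ih =>
      intro A hA
      rw [step A B q hA, ih (A ++ [q]) (by simpa using hA), List.map_cons, List.sum_cons, zpow_add]
      rfl
  rw [chain _ [] rfl, e1, sum_linkingTerm hD hl]
  rfl

/-- Moving a component to the front. -/
theorem evalAlong_front {n : ℕ} (hn : K.Independent Y n) {D : MarkedDiagram Y}
    (hD : D.Balanced) (hc : D.active.card ≤ n) {U V : List (List (Y × Bool))}
    {k : List (Y × Bool)} (hl : D.IsTraversal (U ++ k :: V)) :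
    K.evalAlong D (U ++ k :: V) = K.evalAlong D (k :: (U ++ V)) := by
  by_cases hk : ∀ x ∈ D.active, ∀ b, (x, b) ∈ k → (x, !b) ∉ k
  · exact K.evalAlong_front_of_no_self hn hD hc hk hl
  · push Not at hk
    obtain ⟨x, hx, b, h1, h2⟩ := hk
    -- Rotate the component to start at a pass of the self crossing, move it to the front, and
    -- rotate back.
    obtain ⟨u, r, rfl⟩ := List.append_of_mem h1
    have h3 : (x, !b) ∈ r ++ u := by
      simp only [List.mem_append, List.mem_cons, Prod.mk.injEq, true_and] at h2
      rw [List.mem_append]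
      rcases h2 with h | h | h
      · exact Or.inr h
      · cases b <;> simp at h
      · exact Or.inl h
    obtain ⟨γ, δ, h4⟩ := List.append_of_mem h3
    have e : (x, b) :: r ++ u = (x, b) :: (γ ++ (x, !b) :: δ) := by
      rw [List.cons_append, h4]
    have hl2 := hl.rotate_word
    have hl3 : D.IsTraversal ((u ++ (x, b) :: r) :: (U ++ V)) := hl.perm List.perm_middle
    rw [K.evalAlong_rotate hn hD hc hl]
    rw [e] at hl2 ⊢
    rw [K.evalAlong_front_of_self hn hD hc hx hl2, ← e]
    exact (K.evalAlong_rotate hn hD hc (L₁ := []) hl3).symm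

/-- Traversals differ by rotations of words and a reordering. The target `l'` is assembled from its
end: the next component is rotated to the required base point and moved to the front of what has
been built. -/
theorem independent_succ {n : ℕ} (hn : K.Independent Y n) : K.Independent Y (n + 1) := by
  intro D hD hc l l' hl hl'
  have hc : D.active.card ≤ n := Nat.lt_succ_iff.1 hc
  have key : ∀ s t, l' = t ++ s → ∃ u, D.IsTraversal (s ++ u) ∧
      K.evalAlong D l = K.evalAlong D (s ++ u) := by
    intro s
    induction s with
    | nil => exact fun t _ => ⟨l, hl, rfl⟩
    | cons w s ih =>
      intro t ht
      obtain ⟨u, hu, hu'⟩ := ih (t ++ [w]) (by simpa using ht)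
      suffices ∃ u₁ k₁ k₂ u₂, u = u₁ ++ (k₁ ++ k₂) :: u₂ ∧ w = k₂ ++ k₁ by
        obtain ⟨u₁, k₁, k₂, u₂, rfl, rfl⟩ := this
        rw [← List.append_assoc] at hu hu'
        have h2 := hu.rotate_word
        refine ⟨u₁ ++ u₂, ?_, ?_⟩
        · refine h2.perm ?_
          rw [List.append_assoc, List.cons_append, ← List.append_assoc, ← List.append_assoc]
          exact List.perm_middle
        · rw [hu', K.evalAlong_rotate hn hD hc hu, K.evalAlong_front hn hD hc h2]
          simp
      cases w with
      | nil =>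
        -- Circles are interchangeable empty words; one is left in `u` since both traversals contain
        -- equally many.
        have h1 : [] ∈ u := by
          by_contra hh
          have h2 : u.countP List.isEmpty = 0 := by
            rw [List.countP_eq_zero]
            intro m hm hm'
            exact hh (List.isEmpty_iff.1 hm' ▸ hm)
          have h3 := hu.2
          have h4 := hl'.2
          rw [List.countP_append] at h3
          rw [ht, List.countP_append, List.countP_cons] at h4
          simp at h4
          omega
        obtain ⟨u₁, u₂, rfl⟩ := List.append_of_mem h1
        exact ⟨u₁, [], [], u₂, rfl, rfl⟩
      | cons p m =>
        have hnd := hl'.1.nodup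
        rw [ht, List.flatten_append, List.flatten_cons] at hnd
        have hnd := (List.nodup_append.1 hnd).2.1
        have hps : p ∉ s.flatten := fun hh => (List.nodup_append.1 hnd).2.2 p (by simp) p hh rfl
        have hpm : p ∉ m := (List.nodup_cons.1 (List.nodup_append.1 hnd).1).1
        have hpu := hu.1.mem p
        rw [List.flatten_append, List.mem_append] at hpu
        obtain ⟨k, hk, hpk⟩ := List.mem_flatten.1 (hpu.resolve_left hps)
        obtain ⟨u₁, u₂, rfl⟩ := List.append_of_mem hk
        obtain ⟨k₁, k₂, rfl⟩ := List.append_of_mem hpk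
        refine ⟨u₁, k₁, p :: k₂, u₂, rfl, ?_⟩
        have c1 : IsCycleWord D.next (p :: m) := hl'.1.cyc _ (by simp [ht])
        have c2 : IsCycleWord D.next (k₁ ++ p :: k₂) := hu.1.cyc _ (by simp)
        rw [isCycleWord_cons] at c1
        rw [isCycleWord_append_cons] at c2
        rw [List.cons_append, c1.unique c2 hpm]
        have hnd2 := hu.1.nodup
        have := (List.nodup_flatten.1 hnd2).1 (k₁ ++ p :: k₂) (by simp)
        have := (List.perm_middle.nodup_iff.1 this)
        have := (List.nodup_cons.1 this).1
        simp only [List.mem_append] at this ⊢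
        tauto
  obtain ⟨u, hu, hu'⟩ := key l' [] rfl
  have : u = [] := by
    have h1 := hu.length_eq
    rw [← hl'.length_eq, List.length_append] at h1
    exact List.eq_nil_of_length_eq_zero (by omega)
  rw [hu', this, List.append_nil]

theorem independent (n : ℕ) : K.Independent Y n := by
  induction n with
  | zero => exact fun _ _ h => absurd h (Nat.not_lt_zero _)
  | succ n ih => exact K.independent_succ ih

/-- The value of a balanced diagram may be computed along any traversal. -/
theorem eval_eq_evalAlong {D : MarkedDiagram Y} (hD : D.Balanced) {l : List (List (Y × Bool))}
    (hl : D.IsTraversal l) : K.eval D = K.evalAlong D l :=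
  K.independent (D.active.card + 1) D hD (Nat.lt_succ_self _) _ _ D.isTraversal_trav hl

theorem eval_of_bad_eq_empty {D : MarkedDiagram Y} (hD : D.Balanced)
    {l : List (List (Y × Bool))} (hl : D.IsTraversal l) (h : D.bad l = ∅) :
    K.eval D = K.a D.ncomp := by
  rw [K.eval_eq_evalAlong hD hl, K.evalAlong_of_bad_eq_empty h, hl.length_eq]

theorem eval_eq_of_matching {Y' : Type} [DecidableEq Y'] [Finite Y'] {m : Bool} {f : Y' → Y}
    {e : Y' → Bool} {C : Finset Y'} {D : MarkedDiagram Y} {l : List (List (Y × Bool))}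
    {D' : MarkedDiagram Y'} {l' : List (List (Y' × Bool))} (h : Matching m f e C D l D' l')
    (hD : D.Balanced) (hD' : D'.Balanced) : K.eval D = K.eval D' := by
  rw [K.eval_eq_evalAlong hD h.isTraversal, K.eval_eq_evalAlong hD' h.isTraversal']
  exact K.evalAlong_eq_of_matching (K.independent D.active.card) (K.independent D'.active.card) h
    hD hD' le_rfl le_rfl

end SkeinData

/-! ## Gauss diagrams as marked diagrams -/

section Words

variable {P P' : Type*}

theorem IsCycleWord.map {σ : Equiv.Perm P} {σ' : Equiv.Perm P'} {w : List P}
    (h : IsCycleWord σ w) {g : P → P'} (hg : ∀ p ∈ w, σ' (g p) = g (σ p)) :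
    IsCycleWord σ' (w.map g) := by
  unfold IsCycleWord at *
  rw [← List.map_rotate, ← h, List.map_map, List.map_map]
  exact List.map_congr_left hg

theorem IsCycleWord.of_map {σ : Equiv.Perm P} {σ' : Equiv.Perm P'} {w : List P} {g : P → P'}
    (h : IsCycleWord σ' (w.map g)) (hg : ∀ p, σ' (g p) = g (σ p)) (hi : Function.Injective g) :
    IsCycleWord σ w := by
  unfold IsCycleWord at *
  refine List.map_injective_iff.2 hi ?_
  rw [List.map_rotate, ← h, List.map_map, List.map_map]
  exact List.map_congr_left fun p _ => (hg p).symm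

theorem IsTrav.map {σ : Equiv.Perm P} {σ' : Equiv.Perm P'} {l : List (List P)} (h : IsTrav σ l)
    (e : P ≃ P') (he : ∀ p, σ' (e p) = e (σ p)) : IsTrav σ' (l.map (List.map e)) := by
  have hf : (l.map (List.map e)).flatten = l.flatten.map e := by
    rw [← List.map_flatten]
  refine ⟨fun w hw => ?_, ?_, fun p => ?_⟩
  · obtain ⟨u, hu, rfl⟩ := List.mem_map.1 hw
    exact (h.cyc u hu).map fun p _ => he p
  · rw [hf]
    exact h.nodup.map e.injective
  · rw [hf]
    exact List.mem_map.2 ⟨e.symm p, h.mem _, by simp⟩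

theorem countP_isEmpty_map_map (l : List (List P)) (g : P → P') :
    (l.map (List.map g)).countP List.isEmpty = l.countP List.isEmpty := by
  rw [List.countP_map]
  congr 1
  funext w
  cases w <;> rfl

theorem Walk.apply_eq_iff {σ : Equiv.Perm P} {p q : P} {m : List P} (h : Walk σ p m q)
    (hq : q ∉ m) : σ p = q ↔ m = [] := by
  cases m with
  | nil => exact ⟨fun _ => rfl, fun _ => h⟩
  | cons a m =>
    refine ⟨fun e => absurd (by simp [← e, h.1]) hq, by simp⟩

end Words

/-! ### Traversals after erasing a crossing -/

namespace GaussDiagram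

section Bypass

variable {P : Type}

open scoped Classical in
theorem bypass_apply_of_ne {σ : Equiv.Perm P} {p q : P} (h : σ q ≠ p) (hq : q ≠ p) :
    bypass σ p q = σ q := by
  simp only [bypass, Equiv.Perm.mul_apply]
  exact Equiv.swap_apply_of_ne_of_ne h fun e => hq (σ.injective e)

open scoped Classical in
theorem bypass_apply_of_eq {σ : Equiv.Perm P} {p q : P} (h : σ q = p) :
    bypass σ p q = σ p := by
  simp only [bypass, Equiv.Perm.mul_apply, h]
  exact Equiv.swap_apply_left _ _

theorem walk_bypass {σ : Equiv.Perm P} {p a : P} {m : List P} (h : Walk σ a m p)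
    (hp : p ∉ a :: m) : Walk (bypass σ p) a m (σ p) := by
  induction m generalizing a with
  | nil => exact bypass_apply_of_eq h
  | cons b m ih =>
    simp only [List.mem_cons, not_or] at hp
    refine ⟨?_, ih h.2 (by simpa using hp.2)⟩
    rw [bypass_apply_of_ne (by rw [h.1]; exact Ne.symm hp.2.1) (Ne.symm hp.1), h.1]

theorem isCycleWord_filter_bypass [DecidableEq P] {σ : Equiv.Perm P} {w : List P} (h : IsCycleWord σ w)
    (hw : w.Nodup) (p : P) : IsCycleWord (bypass σ p) (w.filter (· ≠ p)) := by
  by_cases hp : p ∈ w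
  · obtain ⟨u, r, rfl⟩ := List.append_of_mem hp
    have hnd := (List.nodup_cons.1 (List.perm_middle.nodup_iff.1 hw)).1
    rw [List.mem_append, not_or] at hnd
    have hu : u.filter (· ≠ p) = u := List.filter_eq_self.2 fun q hq => by
      simpa using fun e : q = p => hnd.1 (e ▸ hq)
    have hr : r.filter (· ≠ p) = r := List.filter_eq_self.2 fun q hq => by
      simpa using fun e : q = p => hnd.2 (e ▸ hq)
    have e : (u ++ p :: r).filter (· ≠ p) = u ++ r := by
      rw [List.filter_append, List.filter_cons, hu, hr]
      simp
    rw [e, isCycleWord_append_comm]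
    rw [isCycleWord_append_cons] at h
    have hm : p ∉ r ++ u := by simp [hnd]
    generalize r ++ u = m at h hm
    cases m with
    | nil => exact isCycleWord_nil _
    | cons a m =>
      rw [isCycleWord_cons]
      have := walk_bypass h.2 hm
      rwa [h.1] at this
  · have e : w.filter (· ≠ p) = w := List.filter_eq_self.2 fun q hq => by
      simpa using fun e : q = p => hp (e ▸ hq)
    rw [e]
    refine h.of_forall_eq fun q hq => bypass_apply_of_ne ?_ ?_
    · exact fun e => hp (e ▸ h.apply_mem hq)
    · exact fun e => hp (e ▸ hq)

end Bypass

section Erase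

open scoped Classical

/-- The inclusion of the remaining crossings. -/
def eraseVal (D : GaussDiagram) (c : D.X) (x : (D.erase c).X) : D.X :=
  Subtype.val (p := fun x : D.X => x ≠ c) x

theorem eraseVal_ne (D : GaussDiagram) (c : D.X) (x : (D.erase c).X) : D.eraseVal c x ≠ c :=
  Subtype.property (p := fun x : D.X => x ≠ c) x

theorem eraseVal_injective (D : GaussDiagram) (c : D.X) : Function.Injective (D.eraseVal c) :=
  Subtype.val_injective

theorem exists_eraseVal_eq (D : GaussDiagram) {c x : D.X} (h : x ≠ c) :
    ∃ y, D.eraseVal c y = x :=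
  ⟨(⟨x, h⟩ : {x : D.X // x ≠ c}), rfl⟩

/-- The inclusion of the remaining passes. -/
def passVal (D : GaussDiagram) (c : D.X) (p : (D.erase c).X × Bool) : D.X × Bool :=
  (D.eraseVal c p.1, p.2)

/-- The word obtained by erasing the passes of the crossing `c`. -/
noncomputable def eraseWord (D : GaussDiagram) (c : D.X) (w : List (D.X × Bool)) :
    List ((D.erase c).X × Bool) :=
  w.filterMap fun p => if h : p.1 ≠ c then some ((⟨p.1, h⟩ : {x : D.X // x ≠ c}), p.2) else none

theorem passVal_injective (D : GaussDiagram) (c : D.X) : Function.Injective (D.passVal c) := by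
  rintro ⟨x, b⟩ ⟨y, b'⟩ h
  obtain ⟨h1, h2⟩ := Prod.mk.inj h
  exact Prod.ext (D.eraseVal_injective c h1) h2

theorem map_eraseWord (D : GaussDiagram) (c : D.X) (w : List (D.X × Bool)) :
    (D.eraseWord c w).map (D.passVal c) = w.filter (fun p => p.1 ≠ c) := by
  induction w with
  | nil => rfl
  | cons p w ih =>
    by_cases h : p.1 = c
    · rw [List.filter_cons_of_neg (by simpa using h), ← ih]
      simp [eraseWord, h]
    · rw [List.filter_cons_of_pos (by simpa using h), ← ih]
      simp [eraseWord, h, passVal, eraseVal]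

theorem filter_passes {X : Type} (c : X) (w : List (X × Bool)) :
    w.filter (fun p => p.1 ≠ c) = (w.filter (· ≠ (c, true))).filter (· ≠ (c, false)) := by
  rw [List.filter_filter]
  refine List.filter_congr fun p _ => ?_
  obtain ⟨x, b⟩ := p
  cases b <;> simp

theorem isTrav_eraseWord (D : GaussDiagram) (c : D.X) {l : List (List (D.X × Bool))}
    (hl : IsTrav D.next l) : IsTrav (D.erase c).next (l.map (D.eraseWord c)) := by
  have hf : ((l.map (D.eraseWord c)).flatten).map (D.passVal c) =
      l.flatten.filter (fun p => p.1 ≠ c) := by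
    rw [List.map_flatten, List.map_map, List.filter_flatten]
    congr 1
    exact List.map_congr_left fun w _ => D.map_eraseWord c w
  refine ⟨fun w hw => ?_, ?_, fun p => ?_⟩
  · obtain ⟨u, hu, rfl⟩ := List.mem_map.1 hw
    refine IsCycleWord.of_map (σ' := bypass (bypass D.next (c, true)) (c, false)) (g := D.passVal c)
      ?_ (fun p => rfl) (D.passVal_injective c)
    rw [map_eraseWord, filter_passes]
    have hnd := (List.nodup_flatten.1 hl.nodup).1 u hu
    exact isCycleWord_filter_bypass (isCycleWord_filter_bypass (hl.cyc u hu) hnd _)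
      (hnd.filter _) _
  · refine List.Nodup.of_map (D.passVal c) ?_
    rw [hf]
    exact hl.nodup.filter _
  · have : D.passVal c p ∈ ((l.map (D.eraseWord c)).flatten).map (D.passVal c) := by
      rw [hf, List.mem_filter]
      exact ⟨hl.mem _, decide_eq_true (D.eraseVal_ne c p.1)⟩
    obtain ⟨q, hq, e⟩ := List.mem_map.1 this
    exact D.passVal_injective c e ▸ hq

theorem isEmpty_eraseWord (D : GaussDiagram) (c : D.X) (w : List (D.X × Bool)) :
    (D.eraseWord c w).isEmpty = decide (∀ p ∈ w, p.1 = c) := by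
  have : (D.eraseWord c w).isEmpty = (w.filter (fun p => p.1 ≠ c)).isEmpty := by
    rw [← map_eraseWord]
    cases D.eraseWord c w <;> rfl
  rw [this]
  by_cases h : ∀ p ∈ w, p.1 = c
  · rw [decide_eq_true h, List.isEmpty_iff, List.filter_eq_nil_iff]
    simpa using h
  · rw [decide_eq_false h, ← Bool.not_eq_true, List.isEmpty_iff, List.filter_eq_nil_iff]
    simpa using h

theorem countP_eraseWord_of_notMem (D : GaussDiagram) (c : D.X) {L : List (List (D.X × Bool))}
    (h : ∀ b, (c, b) ∉ L.flatten) :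
    (L.map (D.eraseWord c)).countP List.isEmpty = L.countP List.isEmpty := by
  rw [List.countP_map]
  refine List.countP_congr fun w hw => ?_
  rw [Function.comp_apply, isEmpty_eraseWord, decide_eq_true_iff, List.isEmpty_iff]
  refine ⟨fun h' => ?_, by rintro rfl; simp⟩
  cases w with
  | nil => rfl
  | cons p w =>
    refine absurd (List.mem_flatten.2 ⟨_, hw, ?_⟩) (h p.2)
    rw [← h' p (by simp)]
    simp

/-- A word becomes empty exactly if all its passes belong to `c`. It is then a fixed pass of one
strand, or a cycle formed by both passes; these are the three correction terms in `erase`. -/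
theorem circles_erase (D : GaussDiagram) (c : D.X) {l : List (List (D.X × Bool))}
    (hl : IsTrav D.next l) (hc : l.countP List.isEmpty = D.circles) :
    (l.map (D.eraseWord c)).countP List.isEmpty = (D.erase c).circles := by
  have hnil : ∀ (m : List (D.X × Bool)) (b : Bool), (c, b) ∉ m → (c, !b) ∉ m →
      ((∀ p ∈ m, p.1 = c) ↔ m = []) := by
    intro m b h1 h2
    cases m with
    | nil => simp
    | cons p m =>
      refine ⟨fun h => ?_, by simp⟩
      exfalso
      obtain ⟨x, b'⟩ := p
      obtain rfl : x = c := h (x, b') (by simp)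
      by_cases e : b' = b
      · exact h1 (by simp [e])
      · have : b' = !b := by cases b <;> cases b' <;> simp_all
        exact h2 (by simp [this])
  have hcirc : ∀ b, (D.erase c).circles = D.circles
      + (if D.next (c, b) = (c, b) then 1 else 0)
      + (if D.next (c, !b) = (c, !b) then 1 else 0)
      + (if D.next (c, b) = (c, !b) ∧ D.next (c, !b) = (c, b) then 1 else 0) := by
    intro b
    cases b
    · have e := and_comm (a := D.next (c, true) = (c, false)) (b := D.next (c, false) = (c, true))
      simp only [erase, Bool.not_false, e]
      ring
    · rfl
  obtain ⟨p, p', hp, hcut⟩ := _root_.exists_cut (hl.mem (c, true)) (hl.mem (c, false)) (by simp)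
  obtain ⟨b, rfl, rfl⟩ : ∃ b, p = (c, b) ∧ p' = (c, !b) := by
    rcases hp with ⟨rfl, rfl⟩ | ⟨rfl, rfl⟩
    · exact ⟨true, rfl, rfl⟩
    · exact ⟨false, rfl, rfl⟩
  rw [hcirc b, ← hc]
  have hall : ∀ {L : List (List (D.X × Bool))}, (c, b) ∉ L.flatten → (c, !b) ∉ L.flatten →
      ∀ b', (c, b') ∉ L.flatten := by
    intro L h1 h2 b'
    by_cases e : b' = b
    · rwa [e]
    · have : b' = !b := by cases b <;> cases b' <;> simp_all
      rwa [this]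
  rcases hcut with ⟨L₁, u, t, r, L₂, rfl⟩ | ⟨L₁, u, r, L₂, t, s, L₃, rfl⟩
  · have hcyc := hl.cyc (u ++ (c, b) :: (t ++ (c, !b) :: r)) (by simp)
    rw [isCycleWord_append_cons, List.append_assoc, List.cons_append, walk_append] at hcyc
    have hnd := hl.nodup
    have hpm : (L₁ ++ (u ++ (c, b) :: (t ++ (c, !b) :: r)) :: L₂).flatten.Perm
        ((c, b) :: (c, !b) :: (t ++ ((r ++ u) ++ (L₁.flatten ++ L₂.flatten)))) := by
      rw [List.perm_iff_count]
      intro a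
      simp [List.count_cons]
      omega
    have hnd := hpm.nodup_iff.1 hnd
    simp only [List.nodup_cons, List.mem_cons, List.mem_append, not_or] at hnd
    obtain ⟨⟨hne, ht, ⟨hr, hu⟩, h1, h2⟩, ⟨ht', ⟨hr', hu'⟩, h1', h2'⟩, -⟩ := hnd
    have a1 : D.next (c, b) ≠ (c, b) := by
      intro e
      have := hcyc.1.apply_mem (r := (c, b))
      rw [e] at this
      have := this.2 (by simp)
      simp only [List.mem_append, List.mem_singleton] at this
      exact this.elim ht hne
    have a2 : D.next (c, !b) ≠ (c, !b) := by
      intro e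
      have := hcyc.2.apply_mem (r := (c, !b))
      rw [e] at this
      have := this.2 (by simp)
      simp only [List.mem_append, List.mem_singleton] at this
      exact this.elim (fun h => h.elim hr' hu') fun h => hne h.symm
    have a3 := hcyc.1.apply_eq_iff ht'
    have a4 := hcyc.2.apply_eq_iff (by simp [hr, hu])
    have a5 : (D.eraseWord c (u ++ (c, b) :: (t ++ (c, !b) :: r))).isEmpty =
        decide (D.next (c, b) = (c, !b) ∧ D.next (c, !b) = (c, b)) := by
      rw [isEmpty_eraseWord, decide_eq_decide, a3, a4, ← hnil t b ht ht', ← hnil (r ++ u) b (by simp [hr, hu])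
        (by simp [hr', hu'])]
      simp only [List.mem_append, List.mem_cons]
      constructor
      · intro h
        exact ⟨fun p hp => h p (by simp [hp]), fun p hp => h p (by tauto)⟩
      · rintro ⟨h, h'⟩ p (hp | rfl | hp | rfl | hp)
        · exact h' p (Or.inr hp)
        · rfl
        · exact h p hp
        · rfl
        · exact h' p (Or.inl hp)
    rw [List.map_append, List.map_cons, List.countP_append, List.countP_cons, a5,
      D.countP_eraseWord_of_notMem c (hall h1 h1'), D.countP_eraseWord_of_notMem c (hall h2 h2'),
      if_neg a1, if_neg a2, List.countP_append, List.countP_cons]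
    simp only [decide_eq_true_eq]
    simp
    omega
  · have hcyc := hl.cyc (u ++ (c, b) :: r) (by simp)
    have hcyc' := hl.cyc (t ++ (c, !b) :: s) (by simp)
    rw [isCycleWord_append_cons] at hcyc hcyc'
    have hnd := hl.nodup
    have hpm : (L₁ ++ (u ++ (c, b) :: r) :: (L₂ ++ (t ++ (c, !b) :: s) :: L₃)).flatten.Perm
        ((c, b) :: (c, !b) :: ((r ++ u) ++ ((s ++ t) ++ (L₁.flatten ++
          (L₂.flatten ++ L₃.flatten))))) := by
      rw [List.perm_iff_count]
      intro a
      simp [List.count_cons]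
      omega
    have hnd := hpm.nodup_iff.1 hnd
    simp only [List.nodup_cons, List.mem_cons, List.mem_append, not_or] at hnd
    obtain ⟨⟨hne, ⟨hr, hu⟩, ⟨hs, ht⟩, h1, h2, h3⟩,
      ⟨⟨hr', hu'⟩, ⟨hs', ht'⟩, h1', h2', h3'⟩, -⟩ := hnd
    have a1 := hcyc.apply_eq_iff (by simp [hr, hu])
    have a2 := hcyc'.apply_eq_iff (by simp [hs', ht'])
    have a3 : ¬ (D.next (c, b) = (c, !b) ∧ D.next (c, !b) = (c, b)) := by
      rintro ⟨e, -⟩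
      have := hcyc.apply_mem (r := (c, b))
      rw [e] at this
      have := this.2 (by simp)
      simp only [List.mem_append, List.mem_singleton] at this
      exact this.elim (fun h => h.elim hr' hu') fun h => hne h.symm
    have a4 : ∀ (u r : List (D.X × Bool)) (b' : Bool), (c, b) ∉ r ++ u → (c, !b) ∉ r ++ u →
        (D.eraseWord c (u ++ (c, b') :: r)).isEmpty = decide (r ++ u = []) := by
      intro u r b' h h'
      rw [isEmpty_eraseWord, decide_eq_decide, ← hnil (r ++ u) b h h']
      simp only [List.mem_append, List.mem_cons]
      constructor
      · intro h p hp
        exact h p (by tauto)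
      · rintro h p (hp | rfl | hp)
        · exact h p (Or.inr hp)
        · rfl
        · exact h p (Or.inl hp)
    rw [List.map_append, List.map_cons, List.map_append, List.map_cons, List.countP_append,
      List.countP_cons, List.countP_append, List.countP_cons,
      a4 u r b (by simp [hr, hu]) (by simp [hr', hu']),
      a4 t s (!b) (by simp [hs, ht]) (by simp [hs', ht']),
      D.countP_eraseWord_of_notMem c (hall h1 h1'), D.countP_eraseWord_of_notMem c (hall h2 h2'),
      D.countP_eraseWord_of_notMem c (hall h3 h3'), if_neg a3, List.countP_append,
      List.countP_cons, List.countP_append, List.countP_cons]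
    simp only [decide_eq_true_eq, a1, a2]
    simp
    omega

end Erase

end GaussDiagram

/-! ### Values of Gauss diagrams and the Reidemeister moves -/

namespace GaussDiagram

open scoped Classical
open MarkedDiagram

/-- A Gauss diagram as a marked diagram, all of whose crossings are active. -/
noncomputable def toMarked (D : GaussDiagram) : MarkedDiagram D.X where
  next := D.next
  flat := D.sign
  upper := fun _ => true
  active := (Set.finite_univ (α := D.X)).toFinset
  circles := D.circles

theorem mem_toMarked_active (D : GaussDiagram) (x : D.X) : x ∈ D.toMarked.active := by
  simp [toMarked]

theorem sgn_toMarked (D : GaussDiagram) (x : D.X) : D.toMarked.sgn x = D.sign x := by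
  simp [toMarked, sgn]

/-- Some traversal begins with the pass `p`, and no word begins with a pass in `Q`. -/
theorem exists_isTraversal_cons {Y : Type} [DecidableEq Y] [Finite Y] (D : MarkedDiagram Y)
    (p : Y × Bool) (Q : Set (Y × Bool)) (hp : p ∉ Q) (hQ : ∀ q, D.next q ∈ Q → q ∉ Q) :
    ∃ m L, D.IsTraversal ((p :: m) :: L) ∧ ∀ w ∈ (p :: m) :: L, ∀ q ∈ w.head?, q ∉ Q := by
  obtain ⟨l, hl⟩ := D.exists_isTraversal
  obtain ⟨w, hw, hpw⟩ := List.mem_flatten.1 (hl.1.mem p)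
  obtain ⟨L₁, L₂, rfl⟩ := List.append_of_mem hw
  obtain ⟨u, r, rfl⟩ := List.append_of_mem hpw
  have hl' : D.IsTraversal (((p :: r) ++ u) :: (L₁ ++ L₂)) :=
    hl.rotate_word.perm List.perm_middle
  suffices ∀ L L₀, D.IsTraversal (((p :: r) ++ u) :: (L₀ ++ L)) →
      (∀ w ∈ L₀, ∀ q ∈ w.head?, q ∉ Q) →
      ∃ L', D.IsTraversal (((p :: r) ++ u) :: L') ∧ ∀ w ∈ L', ∀ q ∈ w.head?, q ∉ Q by
    obtain ⟨L', h1, h2⟩ := this _ [] hl' (by simp)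
    refine ⟨r ++ u, L', h1, fun w hw => ?_⟩
    rcases List.mem_cons.1 hw with rfl | hw
    · simpa using hp
    · exact h2 w hw
  intro L
  induction L with
  | nil =>
    intro L₀ h1 h2
    exact ⟨L₀, by simpa using h1, h2⟩
  | cons w L ih =>
    intro L₀ h1 h2
    have key : ∃ u' r', w = u' ++ r' ∧ ∀ q ∈ (r' ++ u').head?, q ∉ Q := by
      cases w with
      | nil => exact ⟨[], [], rfl, by simp⟩
      | cons q m =>
        by_cases hq : q ∈ Q
        · have hc : IsCycleWord D.next (q :: m) := h1.1.cyc _ (by simp)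
          have h3 : D.next.symm q ∈ q :: m := by
            rw [← hc.apply_mem_iff]
            simp
          obtain ⟨u', r', e⟩ := List.append_of_mem h3
          refine ⟨u', D.next.symm q :: r', e, ?_⟩
          simpa using hQ (D.next.symm q) (by simpa using hq)
        · exact ⟨[], q :: m, rfl, by simpa using hq⟩
    obtain ⟨u', r', rfl, h3⟩ := key
    have h4 : D.IsTraversal (((p :: r) ++ u) :: (L₀ ++ (r' ++ u') :: L)) :=
      IsTraversal.rotate_word (L₁ := ((p :: r) ++ u) :: L₀) h1
    refine ih (L₀ ++ [r' ++ u']) (by simpa using h4) fun w hw => ?_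
    rcases List.mem_append.1 hw with hw | hw
    · exact h2 w hw
    · rw [List.mem_singleton.1 hw]
      exact h3

theorem isTraversal_erase (D : GaussDiagram) (c : D.X) {l : List (List (D.X × Bool))}
    (hl : D.toMarked.IsTraversal l) : (D.erase c).toMarked.IsTraversal (l.map (D.eraseWord c)) :=
  ⟨D.isTrav_eraseWord c hl.1, D.circles_erase c hl.1 hl.2⟩

theorem forall₂_map_right {α β : Type*} {R : α → β → Prop} (g : α → β) (l : List α)
    (h : ∀ a ∈ l, R a (g a)) : List.Forall₂ R l (l.map g) := by
  induction l with
  | nil => exact .nil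
  | cons a l ih => exact .cons (h a (by simp)) (ih fun b hb => h b (by simp [hb]))

theorem sameWord_of_map_eq {Y Y' : Type} [DecidableEq Y] [DecidableEq Y'] {f : Y' → Y}
    {C : Finset Y'} {w : List (Y × Bool)} {w' : List (Y' × Bool)}
    (h : w'.map (fun p => (f p.1, p.2)) = w.filter (fun p => p.1 ∈ Set.range f))
    (hC : ∀ y, y ∈ C) : SameWord f (fun _ => false) C w w' := by
  have e1 : passMap f (fun _ => false) = fun p => (f p.1, p.2) := by
    funext p
    simp [passMap]
  unfold SameWord
  have e2 : w'.filter (fun p => p.1 ∈ C) = w' := List.filter_eq_self.2 (by simp [hC])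
  rw [e1, e2, h]
  refine List.filter_congr fun p _ => ?_
  simp [hC]

variable {R : Type*} [CommRing R] (K : SkeinData R)

/-- The value of a Gauss diagram. -/
noncomputable def value (D : GaussDiagram) : R := K.eval D.toMarked

/-- Start at the upper pass of `c`. This start persists under all smoothings at bad crossings, so
`c` never becomes bad and plays no part in the recursion. -/
theorem value_erase {D : GaussDiagram} {c : D.X} (h : D.toMarked.Balanced)
    (h' : (D.erase c).toMarked.Balanced) : D.value K = (D.erase c).value K := by
  obtain ⟨m, L, hl, -⟩ := exists_isTraversal_cons D.toMarked (c, true) ∅ (by simp) (by simp)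
  refine K.eval_eq_of_matching (m := true) (f := D.eraseVal c) (e := fun _ => false)
    (C := (D.erase c).toMarked.active) (l := ((c, true) :: m) :: L)
    (l' := (((c, true) :: m) :: L).map (D.eraseWord c)) ?_ h h'
  exact
  { inj := D.eraseVal_injective c
    isTraversal := hl
    isTraversal' := D.isTraversal_erase c hl
    image_subset := fun x _ => D.mem_toMarked_active x
    subset := subset_rfl
    upper := fun y _ => rfl
    sgn := fun y _ => by rw [sgn_toMarked, sgn_toMarked]; rfl
    words := by
      refine forall₂_map_right _ _ fun w _ => sameWord_of_map_eq ?_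
        (mem_toMarked_active _)
      refine (D.map_eraseWord c w).trans (List.filter_congr fun p _ => ?_)
      refine decide_eq_decide.2 ⟨fun hp => D.exists_eraseVal_eq hp, ?_⟩
      rintro ⟨y, hy⟩
      rw [← hy]
      exact D.eraseVal_ne c y
    shielded := by
      refine ⟨[(c, true)], ⟨m ++ L.flatten, by simp⟩, fun x _ hx => ?_, fun x _ hx => ?_⟩
      · simp [toMarked] at hx
      · have : x = c := by
          by_contra hne
          obtain ⟨y, rfl⟩ := D.exists_eraseVal_eq hne
          exact hx (Finset.mem_image_of_mem _ (mem_toMarked_active _ y))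
        subst this
        simp [toMarked]
    shielded' := shielded_of_subset subset_rfl }

/-- The traversal starts along the upper side of the bigon, so both `c` and `d` are shielded by
their upper passes. -/
theorem value_erase_erase {D : GaussDiagram} {c d : D.X} (hcd : d ≠ c)
    (hover : D.next (c, true) = (d, true)) (d' : (D.erase c).X) (hd' : D.eraseVal c d' = d)
    (h : D.toMarked.Balanced) (h' : ((D.erase c).erase d').toMarked.Balanced) :
    D.value K = ((D.erase c).erase d').value K := by
  obtain ⟨m, L, hl, -⟩ := exists_isTraversal_cons D.toMarked (c, true) ∅ (by simp) (by simp)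
  have hm : ∃ m', m = (d, true) :: m' := by
    have := hl.1.cyc _ (List.mem_cons_self ..)
    rw [isCycleWord_cons] at this
    cases m with
    | nil =>
      have h1 : D.next (c, true) = (c, true) := this
      rw [hover] at h1
      exact absurd (congrArg Prod.fst h1) hcd
    | cons a m =>
      have h1 : D.next (c, true) = a := this.1
      exact ⟨m, by rw [← h1, hover]⟩
  obtain ⟨m, rfl⟩ := hm
  have hinj : Function.Injective fun y => D.eraseVal c ((D.erase c).eraseVal d' y) :=
    (D.eraseVal_injective c).comp ((D.erase c).eraseVal_injective d')
  have hne : ∀ y, D.eraseVal c ((D.erase c).eraseVal d' y) ≠ c ∧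
      D.eraseVal c ((D.erase c).eraseVal d' y) ≠ d := fun y =>
    ⟨D.eraseVal_ne c _, fun e => (D.erase c).eraseVal_ne d' y
      (D.eraseVal_injective c (e.trans hd'.symm))⟩
  have hex : ∀ x, x ≠ c → x ≠ d → ∃ y, D.eraseVal c ((D.erase c).eraseVal d' y) = x := by
    intro x h1 h2
    obtain ⟨y, rfl⟩ := D.exists_eraseVal_eq h1
    obtain ⟨y, rfl⟩ := (D.erase c).exists_eraseVal_eq (c := d') (x := y)
      (by rintro rfl; exact h2 hd')
    exact ⟨y, rfl⟩
  refine K.eval_eq_of_matching (m := true) (e := fun _ => false)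
    (f := fun y => D.eraseVal c ((D.erase c).eraseVal d' y))
    (C := ((D.erase c).erase d').toMarked.active)
    (l := ((c, true) :: (d, true) :: m) :: L)
    (l' := (((c, true) :: (d, true) :: m) :: L).map ((D.erase c).eraseWord d' ∘ D.eraseWord c)) ?_ h h'
  exact
  { inj := hinj
    isTraversal := hl
    isTraversal' := by
      have := (D.erase c).isTraversal_erase d' (D.isTraversal_erase c hl)
      rwa [List.map_map] at this
    image_subset := fun x _ => D.mem_toMarked_active x
    subset := subset_rfl
    upper := fun y _ => rfl
    sgn := fun y _ => by rw [sgn_toMarked, sgn_toMarked]; rfl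
    words := by
      refine forall₂_map_right _ _ fun w _ => sameWord_of_map_eq ?_
        (mem_toMarked_active _)
      have e1 := (D.erase c).map_eraseWord d' (D.eraseWord c w)
      have e2 := congrArg (List.map (D.passVal c)) e1
      rw [List.map_map] at e2
      refine e2.trans ?_
      have e3 : (D.eraseWord c w).filter (fun p => p.1 ≠ d') =
          (D.eraseWord c w).filter ((fun p => decide (p.1 ≠ d)) ∘ D.passVal c) := by
        refine List.filter_congr fun p _ => ?_
        refine decide_eq_decide.2 (not_congr ⟨fun e => ?_, fun e => ?_⟩)
        · rw [← hd', ← e]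
          rfl
        · exact D.eraseVal_injective c ((show D.eraseVal c p.1 = d from e).trans hd'.symm)
      rw [e3, ← List.filter_map, map_eraseWord, List.filter_filter]
      refine List.filter_congr fun p _ => ?_
      rw [← Bool.decide_and]
      refine decide_eq_decide.2 ⟨fun hp => hex _ hp.2 hp.1, ?_⟩
      rintro ⟨y, hy⟩
      rw [← hy]
      exact ⟨(hne y).2, (hne y).1⟩
    shielded := by
      refine ⟨[(c, true), (d, true)], ⟨m ++ L.flatten, by simp⟩, fun x _ hx => ?_,
        fun x _ hx => ?_⟩
      · simp [toMarked] at hx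
      · have : x = c ∨ x = d := by
          by_contra hh
          rw [not_or] at hh
          obtain ⟨y, rfl⟩ := hex x hh.1 hh.2
          exact hx (Finset.mem_image_of_mem _ (mem_toMarked_active _ y))
        rcases this with rfl | rfl <;> simp [toMarked]
    shielded' := shielded_of_subset subset_rfl }

/-- A crossing that is merely inactive and one that is erased leave the same words of active passes.
-/
theorem value_smooth {D : GaussDiagram} {c : D.X} (h : D.toMarked.Balanced)
    (h' : (D.smooth c).toMarked.Balanced) :
    K.eval (D.toMarked.smooth c) = (D.smooth c).value K := by
  obtain ⟨l, hl⟩ := (D.toMarked.smooth c).exists_isTraversal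
  set D₁ : GaussDiagram := { D with next := D.next * Equiv.swap (c, true) (c, false) } with hD₁
  have hl₁ : D₁.toMarked.IsTraversal l := hl
  refine K.eval_eq_of_matching (m := true) (f := D₁.eraseVal c) (e := fun _ => false)
    (C := (D₁.erase c).toMarked.active) (l := l)
    (l' := l.map (D₁.eraseWord c)) ?_
    (h.smooth (D.mem_toMarked_active c)) h'
  exact
  { inj := D₁.eraseVal_injective c
    isTraversal := hl
    isTraversal' := D₁.isTraversal_erase c hl₁
    image_subset := fun x hx => by
      obtain ⟨y, -, rfl⟩ := Finset.mem_image.1 hx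
      exact Finset.mem_erase.2 ⟨D₁.eraseVal_ne c y, D.mem_toMarked_active _⟩
    subset := subset_rfl
    upper := fun y _ => by
      rw [smooth_upper_of_ne _ (D₁.eraseVal_ne c y)]
      rfl
    sgn := fun y _ => by
      have := sgn_smooth_of_ne D.toMarked (D₁.eraseVal_ne c y)
      rw [sgn_toMarked] at this
      exact this.trans ((D₁.erase c).sgn_toMarked y).symm
    words := by
      refine forall₂_map_right _ _ fun w _ => sameWord_of_map_eq ?_
        (mem_toMarked_active _)
      refine (D₁.map_eraseWord c w).trans (List.filter_congr fun p _ => ?_)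
      refine decide_eq_decide.2 ⟨fun hp => D₁.exists_eraseVal_eq hp, ?_⟩
      rintro ⟨y, hy⟩
      rw [← hy]
      exact D₁.eraseVal_ne c y
    shielded := by
      refine shielded_of_subset fun x hx => ?_
      obtain ⟨y, rfl⟩ := D₁.exists_eraseVal_eq (Finset.mem_erase.1 hx).1
      exact Finset.mem_image_of_mem _ (mem_toMarked_active _ y)
    shielded' := shielded_of_subset subset_rfl }

theorem value_relabel {D D' : GaussDiagram} (e : D.X ≃ D'.X)
    (hsign : ∀ x, D'.sign (e x) = D.sign x)
    (hnext : ∀ x s, D'.next (e x, s) = (e (D.next (x, s)).1, (D.next (x, s)).2))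
    (hcircles : D'.circles = D.circles) (h : D.toMarked.Balanced) (h' : D'.toMarked.Balanced) :
    D'.value K = D.value K := by
  obtain ⟨l, hl⟩ := D.toMarked.exists_isTraversal
  refine K.eval_eq_of_matching (m := true) (f := e) (e := fun _ => false)
    (C := D.toMarked.active) (l := l.map (List.map (e.prodCongr (Equiv.refl Bool)))) (l' := l) ?_
    h' h
  exact
  { inj := e.injective
    isTraversal := by
      refine ⟨hl.1.map _ fun p => hnext p.1 p.2, ?_⟩
      rw [countP_isEmpty_map_map, hl.2]
      exact hcircles.symm
    isTraversal' := hl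
    image_subset := fun x _ => D'.mem_toMarked_active x
    subset := subset_rfl
    upper := fun y _ => rfl
    sgn := fun y _ => by rw [sgn_toMarked, sgn_toMarked, hsign]
    words := by
      rw [List.forall₂_map_left_iff]
      refine List.forall₂_same.2 fun w _ => sameWord_of_map_eq ?_
        (mem_toMarked_active _)
      rw [List.filter_eq_self.2]
      · rfl
      · intro p _
        simp
    shielded := shielded_of_subset fun x _ =>
      Finset.mem_image.2 ⟨e.symm x, mem_toMarked_active _ _, by simp⟩
    shielded' := shielded_of_subset subset_rfl }

/-- Exchanging the labels of the two passes amounts to keeping them and declaring the other pass the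
upper one; `e` records the exchange. -/
theorem value_switch {D : GaussDiagram} (S : Set D.X) (h : D.toMarked.Balanced)
    (h' : (D.switch S).toMarked.Balanced) :
    (D.switch S).value K = K.eval (D.toMarked.setUpper fun x => decide (x ∉ S)) := by
  obtain ⟨l, hl⟩ := D.toMarked.exists_isTraversal
  have hpass : passMap (id : D.X → D.X) (fun x => decide (x ∈ S)) = exchange S := by
    funext p
    obtain ⟨x, b⟩ := p
    by_cases hx : x ∈ S <;> simp [passMap, exchange, Function.Involutive.toPerm, hx]
  refine K.eval_eq_of_matching (m := true) (f := id) (e := fun x => decide (x ∈ S))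
    (C := D.toMarked.active) (l := l.map (List.map (exchange S))) (l' := l) ?_ h' h
  exact
  { inj := Function.injective_id
    isTraversal := by
      refine ⟨hl.1.map _ fun p => ?_, ?_⟩
      · change exchange S (D.next (exchange S (exchange S p))) = _
        rw [exchange_exchange]
        rfl
      · rw [countP_isEmpty_map_map, hl.2]
        rfl
    isTraversal' := hl
    image_subset := fun x _ => (D.switch S).mem_toMarked_active x
    subset := subset_rfl
    upper := fun y _ => by
      by_cases hy : y ∈ S <;> simp [toMarked, setUpper, hy]
    sgn := fun y _ => by
      refine ((D.switch S).sgn_toMarked y).trans ?_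
      by_cases hy : y ∈ S <;> simp [toMarked, setUpper, hy, sgn, switch]
    words := by
      rw [List.forall₂_map_left_iff]
      refine List.forall₂_same.2 fun w _ => ?_
      unfold SameWord
      rw [hpass, List.filter_eq_self.2, List.filter_eq_self.2]
      · intro p _
        exact decide_eq_true (D.mem_toMarked_active _)
      · intro p _
        exact decide_eq_true (Finset.mem_image.2 ⟨p.1, D.mem_toMarked_active _, rfl⟩)
    shielded := shielded_of_subset fun x _ =>
      Finset.mem_image.2 ⟨x, mem_toMarked_active _ _, rfl⟩
    shielded' := shielded_of_subset subset_rfl }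

theorem filter_map_swap_of_not {P : Type*} [DecidableEq P] {p q : P} {f : P → Bool}
    (hp : f p = false) (hq : f q = false) (w : List P) :
    (w.map (Equiv.swap p q)).filter f = w.filter f := by
  induction w with
  | nil => rfl
  | cons a w ih =>
    rw [List.map_cons, List.filter_cons, List.filter_cons, ih]
    by_cases h1 : a = p
    · rw [h1, Equiv.swap_apply_left, hp, hq]
      rfl
    · by_cases h2 : a = q
      · rw [h2, Equiv.swap_apply_right, hp, hq]
        rfl
      · rw [Equiv.swap_apply_of_ne_of_ne h1 h2]

theorem map_swap_of_notMem {P : Type*} [DecidableEq P] {p q : P} {w : List P} (hp : p ∉ w)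
    (hq : q ∉ w) : w.map (Equiv.swap p q) = w :=
  (List.map_congr_left fun a ha => Equiv.swap_apply_of_ne_of_ne (by rintro rfl; exact hp ha)
    (by rintro rfl; exact hq ha)).trans (List.map_id _)

/-- The passes `p` and `q` are neighbours in the word, or do not occur. -/
def Neighbours {P : Type*} (p q : P) (w : List P) : Prop :=
  (p ∉ w ∧ q ∉ w) ∨ ∃ u r, w = u ++ p :: q :: r

theorem Neighbours.map {P : Type*} [DecidableEq P] {p q a b : P} {w : List P}
    (h : Neighbours p q w) (h1 : p ≠ a) (h2 : p ≠ b) (h3 : q ≠ a) (h4 : q ≠ b) :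
    Neighbours p q (w.map (Equiv.swap a b)) := by
  have e1 : Equiv.swap a b p = p := Equiv.swap_apply_of_ne_of_ne h1 h2
  have e2 : Equiv.swap a b q = q := Equiv.swap_apply_of_ne_of_ne h3 h4
  rcases h with ⟨hp, hq⟩ | ⟨u, r, rfl⟩
  · left
    constructor
    · intro hh
      obtain ⟨z, hz, e⟩ := List.mem_map.1 hh
      exact hp ((Equiv.swap a b).injective (e.trans e1.symm) ▸ hz)
    · intro hh
      obtain ⟨z, hz, e⟩ := List.mem_map.1 hh
      exact hq ((Equiv.swap a b).injective (e.trans e2.symm) ▸ hz)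
  · right
    exact ⟨u.map (Equiv.swap a b), r.map (Equiv.swap a b), by simp [e1, e2]⟩

theorem Neighbours.filter_map_swap {P : Type*} [DecidableEq P] {p q : P} {f : P → Bool}
    {w : List P} (h : Neighbours p q w) (hw : w.Nodup) (hf : f p = false ∨ f q = false) :
    (w.map (Equiv.swap p q)).filter f = w.filter f := by
  rcases h with ⟨hp, hq⟩ | ⟨u, r, rfl⟩
  · rw [map_swap_of_notMem hp hq]
  · have hpm : (u ++ p :: q :: r).Perm (p :: q :: (u ++ r)) := by
      refine List.perm_middle.trans (List.Perm.cons _ List.perm_middle)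
    have hnd := hpm.nodup_iff.1 hw
    simp only [List.nodup_cons, List.mem_cons, List.mem_append, not_or] at hnd
    obtain ⟨⟨-, hpu, hpr⟩, ⟨hqu, hqr⟩, -⟩ := hnd
    rw [List.map_append, List.map_cons, List.map_cons, map_swap_of_notMem hpu hqu,
      map_swap_of_notMem hpr hqr, Equiv.swap_apply_left, Equiv.swap_apply_right]
    rcases hf with hf | hf <;> simp [List.filter_cons, hf]

theorem neighbours_of_isCycleWord {P : Type*} {σ : Equiv.Perm P} {p q : P} {w : List P}
    (h : IsCycleWord σ w) (hpq : σ p = q) (hne : p ≠ q) (hq : w.head? ≠ some q) :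
    Neighbours p q w := by
  by_cases hp : p ∈ w
  · right
    obtain ⟨u, r, rfl⟩ := List.append_of_mem hp
    rw [isCycleWord_append_cons] at h
    cases r with
    | nil =>
      cases u with
      | nil => exact absurd (h.symm.trans hpq) hne
      | cons x u =>
        have h1 : σ p = x := h.1
        exact absurd (by simp [← h1, hpq]) hq
    | cons x r =>
      have h1 : σ p = x := h.1
      exact ⟨u, r, by rw [← h1, hpq]⟩
  · left
    exact ⟨hp, by rwa [← hpq, h.apply_mem_iff]⟩

theorem Consecutive.exists_next {D : GaussDiagram} {ε : ℤˣ} {p q : D.X × Bool}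
    (h : D.Consecutive ε p q) : ∃ p' q', D.next p' = q' ∧
      ((p' = p ∧ q' = q) ∨ (p' = q ∧ q' = p)) := by
  rcases h with ⟨-, h⟩ | ⟨-, h⟩
  · exact ⟨p, q, h, Or.inl ⟨rfl, rfl⟩⟩
  · exact ⟨q, p, h, Or.inr ⟨rfl, rfl⟩⟩

/-- Start on the top strand, which shields `a` and `b`. On the two other strands the passes of `c`
merely trade places with passes of `a` and `b`, and the filtered words do not show those. -/
theorem value_triangle {D : GaussDiagram} {a b c : D.X} (hab : a ≠ b) (hac : a ≠ c) (hbc : b ≠ c)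
    {εt εm εb : ℤˣ} (htop : D.Consecutive εt (a, true) (b, true))
    (hmid : D.Consecutive εm (a, false) (c, true)) (hbot : D.Consecutive εb (b, false) (c, false))
    {τ : Equiv.Perm (D.X × Bool)}
    (hτ : τ = Equiv.swap (a, true) (b, true) * Equiv.swap (a, false) (c, true)
          * Equiv.swap (b, false) (c, false))
    (h : D.toMarked.Balanced)
    (h' : GaussDiagram.toMarked { D with next := τ * D.next * τ } |>.Balanced) :
    D.value K = GaussDiagram.value K { D with next := τ * D.next * τ } := by
  have hab' := hab.symm
  have hac' := hac.symm
  have hbc' := hbc.symm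
  obtain ⟨t₀, t₁, ht, ht'⟩ := htop.exists_next
  obtain ⟨m₀, m₁, hm, hm'⟩ := hmid.exists_next
  obtain ⟨b₀, b₁, hb, hb'⟩ := hbot.exists_next
  have hτ2 : ∀ p, τ (τ p) = p := by
    rintro ⟨x, s⟩
    rw [hτ]
    simp only [Equiv.Perm.mul_apply, Equiv.swap_apply_def]
    by_cases h1 : x = a
    · subst h1
      cases s <;> simp [hab, hac, hbc, hab', hac', hbc']
    by_cases h2 : x = b
    · subst h2
      cases s <;> simp [hab, hac, hbc, hab', hac', hbc']
    by_cases h3 : x = c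
    · subst h3
      cases s <;> simp [hab, hac, hbc, hab', hac', hbc']
    simp [h1, h2, h3]
  have s1 : Equiv.swap (a, true) (b, true) = Equiv.swap t₀ t₁ := by
    rcases ht' with ⟨rfl, rfl⟩ | ⟨rfl, rfl⟩
    exacts [rfl, Equiv.swap_comm _ _]
  have s2 : Equiv.swap (a, false) (c, true) = Equiv.swap m₀ m₁ := by
    rcases hm' with ⟨rfl, rfl⟩ | ⟨rfl, rfl⟩
    exacts [rfl, Equiv.swap_comm _ _]
  have s3 : Equiv.swap (b, false) (c, false) = Equiv.swap b₀ b₁ := by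
    rcases hb' with ⟨rfl, rfl⟩ | ⟨rfl, rfl⟩
    exacts [rfl, Equiv.swap_comm _ _]
  have d1 : t₀ ≠ m₁ ∧ t₀ ≠ b₁ ∧ t₀ ≠ t₁ := by
    rcases ht' with ⟨rfl, rfl⟩ | ⟨rfl, rfl⟩ <;> rcases hm' with ⟨rfl, rfl⟩ | ⟨rfl, rfl⟩ <;>
      rcases hb' with ⟨rfl, rfl⟩ | ⟨rfl, rfl⟩ <;> simp [hab, hac, hbc, hab']
  have d2 : m₀ ≠ m₁ ∧ m₀ ≠ b₁ ∧ m₀ ≠ b₀ ∧ m₁ ≠ b₀ ∧ m₁ ≠ b₁ ∧ b₀ ≠ m₁ ∧ b₀ ≠ b₁ := by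
    rcases hm' with ⟨rfl, rfl⟩ | ⟨rfl, rfl⟩ <;>
      rcases hb' with ⟨rfl, rfl⟩ | ⟨rfl, rfl⟩ <;> simp [hab, hac, hbc, hab', hac', hbc']
  -- No word may begin between two neighbouring passes of the middle or bottom strand; otherwise
  -- their exchange would take place across the ends of the word.
  obtain ⟨m, L, hl, hhead⟩ := exists_isTraversal_cons D.toMarked t₀ {m₁, b₁}
    (by simp [d1.1, d1.2.1]) (by
      intro q hq
      have hq : D.next q = m₁ ∨ D.next q = b₁ := hq
      rcases hq with hq | hq
      · rw [D.next.injective (hq.trans hm.symm)]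
        simp [d2.1, d2.2.1]
      · rw [D.next.injective (hq.trans hb.symm)]
        simp [d2])
  obtain ⟨m, rfl⟩ : ∃ m', m = t₁ :: m' := by
    have := hl.1.cyc _ (List.mem_cons_self ..)
    rw [isCycleWord_cons] at this
    cases m with
    | nil =>
      have h1 : D.next t₀ = t₀ := this
      rw [ht] at h1
      exact absurd h1.symm d1.2.2
    | cons x m =>
      have h1 : D.next t₀ = x := this.1
      exact ⟨m, by rw [← h1, ht]⟩
  set C : Finset D.X := D.toMarked.active \ {a, b} with hC
  have hmemC : ∀ x, x ∈ C ↔ x ≠ a ∧ x ≠ b := by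
    intro x
    simp [hC, mem_toMarked_active]
  set l := (t₀ :: t₁ :: m) :: L with hldef
  have hτt : τ t₀ = t₁ ∧ τ t₁ = t₀ := by
    rw [hτ]
    rcases ht' with ⟨rfl, rfl⟩ | ⟨rfl, rfl⟩ <;>
      simp [Equiv.swap_apply_def, hab, hac, hbc, hab']
  have hup : ∀ x, x ∉ C → (x, true) ∈ [t₀, t₁] := by
    intro x hx
    rw [hmemC] at hx
    have : x = a ∨ x = b := by tauto
    rcases ht' with ⟨rfl, rfl⟩ | ⟨rfl, rfl⟩ <;> rcases this with rfl | rfl <;> simp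
  have hdown : ∀ x, (x, false) ∉ [t₀, t₁] := by
    intro x
    rcases ht' with ⟨rfl, rfl⟩ | ⟨rfl, rfl⟩ <;> simp
  refine K.eval_eq_of_matching (m := true) (f := id) (e := fun _ => false) (C := C) (l := l)
    (l' := l.map (List.map τ)) ?_ h h'
  exact
  { inj := Function.injective_id
    isTraversal := hl
    isTraversal' := by
      refine ⟨hl.1.map _ fun p => ?_, ?_⟩
      · change τ (D.next (τ (τ p))) = _
        rw [hτ2]
        rfl
      · rw [countP_isEmpty_map_map, hl.2]
        rfl
    image_subset := fun x _ => D.mem_toMarked_active x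
    subset := fun x _ => D.mem_toMarked_active x
    upper := fun y _ => rfl
    sgn := fun y _ => rfl
    words := by
      refine forall₂_map_right _ _ fun w hw => ?_
      have e1 : passMap (id : D.X → D.X) (fun _ => false) = id := by
        funext p
        simp [passMap]
      unfold SameWord
      rw [e1, List.map_id, Finset.image_id]
      have hnd := (List.nodup_flatten.1 hl.1.nodup).1 w hw
      have hcyc := hl.1.cyc w hw
      have n2 : Neighbours m₀ m₁ w := neighbours_of_isCycleWord hcyc hm d2.1
        fun e => hhead w hw m₁ e (by simp)
      have n3 : Neighbours b₀ b₁ w := neighbours_of_isCycleWord hcyc hb d2.2.2.2.2.2.2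
        fun e => hhead w hw b₁ e (by simp)
      have e2 : w.map τ =
          ((w.map (Equiv.swap b₀ b₁)).map (Equiv.swap m₀ m₁)).map (Equiv.swap t₀ t₁) := by
        rw [hτ, s1, s2, s3, List.map_map, List.map_map]
        rfl
      symm
      rw [e2, filter_map_swap_of_not, Neighbours.filter_map_swap, n3.filter_map_swap hnd]
      · rcases hb' with ⟨rfl, rfl⟩ | ⟨rfl, rfl⟩ <;> simp [hmemC]
      · exact n2.map d2.2.2.1 d2.2.1 d2.2.2.2.1 d2.2.2.2.2.1
      · exact hnd.map (Equiv.injective _)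
      · rcases hm' with ⟨rfl, rfl⟩ | ⟨rfl, rfl⟩ <;> simp [hmemC]
      · rcases ht' with ⟨rfl, rfl⟩ | ⟨rfl, rfl⟩ <;> simp [hmemC]
      · rcases ht' with ⟨rfl, rfl⟩ | ⟨rfl, rfl⟩ <;> simp [hmemC]
    shielded := by
      refine ⟨[t₀, t₁], ⟨m ++ L.flatten, by simp [hldef]⟩, fun x _ hx => ?_, fun x _ hx => ?_⟩
      · exact absurd hx (hdown x)
      · rw [Finset.image_id] at hx
        exact hup x hx
    shielded' := by
      refine ⟨[t₁, t₀], ⟨m.map τ ++ (L.map (List.map τ)).flatten, by simp [hldef, hτt]⟩,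
        fun x _ hx => ?_, fun x _ hx => ?_⟩
      · have hx : (x, false) ∈ [t₁, t₀] := hx
        exact absurd (by simpa [or_comm] using hx) (hdown x)
      · have h1 : (x, true) ∈ [t₁, t₀] := by simpa [or_comm] using hup x hx
        exact h1 }

theorem Move.value_eq {D D' : GaussDiagram} (hm : Move D D') (h : D.toMarked.Balanced)
    (h' : D'.toMarked.Balanced) : D.value K = D'.value K := by
  cases hm with
  | relabel _ e h1 h2 h3 => exact (value_relabel K e h1 h2 h3 h h').symm
  | r1 c s h1 => exact value_erase K h h'
  | r2 c d hcd h1 h2 h3 => exact value_erase_erase K hcd h2 _ rfl h h'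
  | r3 a b c hab hac hbc εt εm εb κ h1 h2 h3 _ _ _ τ hτ =>
    exact value_triangle K hab hac hbc h1 h2 h3 hτ h h'

theorem value_of_isDescending {D : GaussDiagram} (h : D.toMarked.Balanced)
    (hd : D.IsDescending) : D.value K = K.a D.numComponents := by
  obtain ⟨l, ⟨h1, h2, h3⟩, h4⟩ := hd
  -- Components without crossings are absent from `l` and are added as empty words.
  have hf : (l ++ List.replicate D.circles []).flatten = l.flatten := by
    simp
  have hl : D.toMarked.IsTraversal (l ++ List.replicate D.circles []) := by
    refine ⟨⟨fun w hw => ?_, by rwa [hf], by rwa [hf]⟩, ?_⟩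
    · rcases List.mem_append.1 hw with hw | hw
      · exact (h1 w hw).2
      · rw [List.eq_of_mem_replicate hw]
        exact isCycleWord_nil _
    · rw [List.countP_append, List.countP_eq_zero.2, List.countP_replicate]
      · simp [toMarked]
      · intro w hw hw'
        exact (h1 w hw).1 (List.isEmpty_iff.1 hw')
  refine (K.eval_of_bad_eq_empty h hl (bad_eq_empty hl.1.nodup fun x _ => ?_)).trans rfl
  rw [hf]
  exact h4 x

end GaussDiagram

/-! ## Planarity -/

namespace GaussDiagram

open scoped Classical

theorem opposite_opposite (D : GaussDiagram) (h : D.HalfEdge) :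
    D.opposite (D.opposite h) = h := by
  obtain ⟨p, o⟩ := h
  cases o <;> simp [opposite]

/-- The function is constant along every face. -/
def IsFaceFunction (D : GaussDiagram) (f : D.HalfEdge → ℚ) : Prop :=
  ∀ h, f (D.rotate (D.opposite h)) = f h

/-- The sum of the values on the incoming edges equals the sum on the outgoing edges; the edge that
leaves the pass `p` is denoted by `p`. -/
def IsFlow (D : GaussDiagram) (g : D.X × Bool → ℚ) : Prop :=
  ∀ x, g (x, true) + g (x, false) = g (D.next.symm (x, true)) + g (D.next.symm (x, false))

/-- Every flow is the boundary of a combination of faces. -/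
def FlowsBound (D : GaussDiagram) : Prop :=
  ∀ g, D.IsFlow g → ∃ f, D.IsFaceFunction f ∧ ∀ p, g p = f (D.next p, false) - f (p, true)

theorem IsFaceFunction.rotate_eq {D : GaussDiagram} {f : D.HalfEdge → ℚ} (hf : D.IsFaceFunction f)
    (h : D.HalfEdge) : f (D.rotate h) = f (D.opposite h) := by
  have := hf (D.opposite h)
  rwa [opposite_opposite] at this

/-- The four corners at a positive crossing. -/
theorem IsFaceFunction.corners_pos {D : GaussDiagram} {f : D.HalfEdge → ℚ}
    (hf : D.IsFaceFunction f) {x : D.X} (hx : D.sign x = 1) :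
    f ((x, false), true) = f (D.next (x, true), false) ∧
    f ((x, false), false) = f (D.next.symm (x, true), true) ∧
    f ((x, true), false) = f (D.next (x, false), false) ∧
    f ((x, true), true) = f (D.next.symm (x, false), true) := by
  refine ⟨?_, ?_, ?_, ?_⟩
  · simpa [rotate, opposite, hx] using hf.rotate_eq ((x, true), true)
  · simpa [rotate, opposite, hx] using hf.rotate_eq ((x, true), false)
  · simpa [rotate, opposite, hx] using hf.rotate_eq ((x, false), true)
  · simpa [rotate, opposite, hx] using hf.rotate_eq ((x, false), false)

/-- The four corners at a negative crossing. -/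
theorem IsFaceFunction.corners_neg {D : GaussDiagram} {f : D.HalfEdge → ℚ}
    (hf : D.IsFaceFunction f) {x : D.X} (hx : D.sign x = -1) :
    f ((x, false), false) = f (D.next (x, true), false) ∧
    f ((x, false), true) = f (D.next.symm (x, true), true) ∧
    f ((x, true), true) = f (D.next (x, false), false) ∧
    f ((x, true), false) = f (D.next.symm (x, false), true) := by
  have hx' : ¬ (-1 : ℤˣ) = 1 := by decide
  refine ⟨?_, ?_, ?_, ?_⟩
  · simpa [rotate, opposite, hx, hx'] using hf.rotate_eq ((x, true), true)
  · simpa [rotate, opposite, hx, hx'] using hf.rotate_eq ((x, true), false)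
  · simpa [rotate, opposite, hx, hx'] using hf.rotate_eq ((x, false), true)
  · simpa [rotate, opposite, hx, hx'] using hf.rotate_eq ((x, false), false)

/-! ### Euler characteristic and rational homology -/

section Rank

variable (D : GaussDiagram)

/-- The faces. -/
abbrev Face : Type := Quot fun h k : D.HalfEdge => D.rotate (D.opposite h) = k

/-- The connected pieces. -/
abbrev Piece : Type := Quot fun x y : D.X => ∃ s t, D.next (x, s) = (y, t)

theorem piece_next (p : D.X × Bool) :
    (Quot.mk _ (D.next p).1 : D.Piece) = Quot.mk _ p.1 :=
  (Quot.sound ⟨p.2, (D.next p).2, rfl⟩).symm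

theorem piece_opposite (h : D.HalfEdge) :
    (Quot.mk _ (D.opposite h).1.1 : D.Piece) = Quot.mk _ h.1.1 := by
  obtain ⟨p, o⟩ := h
  cases o
  · have := D.piece_next (D.next.symm p)
    rw [Equiv.apply_symm_apply] at this
    exact this.symm
  · exact D.piece_next p

/-- The piece that contains a face. -/
def facePiece : D.Face → D.Piece :=
  Quot.lift (fun h => Quot.mk _ h.1.1) (by
    rintro h k rfl
    exact (D.piece_opposite h).symm)

theorem facePiece_surjective : Function.Surjective D.facePiece := by
  rintro ⟨x⟩
  exact ⟨Quot.mk _ ((x, true), true), rfl⟩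

/-- The boundary of a combination of faces. -/
noncomputable def faceBoundary : (D.Face → ℚ) →ₗ[ℚ] (D.X × Bool → ℚ) :=
  LinearMap.pi fun p =>
    (LinearMap.proj (R := ℚ) (φ := fun _ : D.Face => ℚ) (Quot.mk _ (D.next p, false))) -
      LinearMap.proj (R := ℚ) (φ := fun _ : D.Face => ℚ) (Quot.mk _ (p, true))

theorem face_rotate_opposite (h : D.HalfEdge) :
    (Quot.mk _ (D.rotate (D.opposite h)) : D.Face) = Quot.mk _ h :=
  (Quot.sound (r := fun h k : D.HalfEdge => D.rotate (D.opposite h) = k) rfl).symm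

/-- Vanishing boundary means equal values on the two sides of every edge; rotating about a crossing
then equates all its corners, hence all faces of a piece. -/
theorem ker_faceBoundary :
    LinearMap.ker D.faceBoundary = LinearMap.range (LinearMap.funLeft ℚ ℚ D.facePiece) := by
  ext f
  rw [LinearMap.mem_ker, LinearMap.mem_range]
  constructor
  · intro h
    set F : D.HalfEdge → ℚ := fun h => f (Quot.mk _ h) with hF
    have hf : D.IsFaceFunction F := fun h => congrArg f (D.face_rotate_opposite h)
    have hE : ∀ p, F (D.next p, false) = F (p, true) := fun p => sub_eq_zero.1 (congrFun h p)
    have hopp : ∀ h, F (D.opposite h) = F h := by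
      rintro ⟨p, o⟩
      cases o
      · have := hE (D.next.symm p)
        rw [Equiv.apply_symm_apply] at this
        exact this.symm
      · exact hE p
    have hrot : ∀ h, F (D.rotate h) = F h := fun h => (hf.rotate_eq h).trans (hopp h)
    have hx : ∀ (x : D.X) (b o : Bool), F ((x, b), o) = F ((x, true), true) := by
      intro x
      have h1 : ∀ h : D.HalfEdge, F (D.rotate (D.rotate h)) = F h := fun h =>
        (hrot _).trans (hrot h)
      rcases Int.units_eq_one_or (D.sign x) with hs | hs
      · have a1 := hrot ((x, true), true)
        have a2 := hrot ((x, false), true)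
        have a3 := hrot ((x, true), false)
        simp [rotate, hs] at a1 a2 a3
        intro b o
        cases b <;> cases o <;> linarith
      · have hs' : ¬ (-1 : ℤˣ) = 1 := by decide
        have a1 := hrot ((x, true), true)
        have a2 := hrot ((x, false), false)
        have a3 := hrot ((x, true), false)
        simp [rotate, hs, hs'] at a1 a2 a3
        intro b o
        cases b <;> cases o <;> linarith
    refine ⟨Quot.lift (fun x => F ((x, true), true)) ?_, ?_⟩
    · rintro x y ⟨s, t, hst⟩
      have := hE (x, s)
      rw [hst] at this
      exact ((hx y t false).symm.trans (this.trans (hx x s true))).symm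
    · funext q
      obtain ⟨⟨⟨x, b⟩, o⟩⟩ := q
      exact (hx x b o).symm
  · rintro ⟨u, rfl⟩
    funext p
    exact sub_eq_zero.2 (congrArg u (D.piece_next p))

noncomputable local instance : Fintype D.X := Fintype.ofFinite _

/-- The coboundary matrix of the graph. -/
noncomputable def edgeMatrix : Matrix (D.X × Bool) D.X ℚ :=
  Matrix.of fun p x => (if x = p.1 then 1 else 0) - (if x = (D.next p).1 then 1 else 0)

theorem edgeMatrix_mulVec (u : D.X → ℚ) (p : D.X × Bool) :
    D.edgeMatrix.mulVec u p = u p.1 - u (D.next p).1 := by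
  simp [edgeMatrix, Matrix.mulVec, dotProduct, sub_mul, Finset.sum_sub_distrib]

theorem edgeMatrix_transpose_mulVec (g : D.X × Bool → ℚ) (x : D.X) :
    D.edgeMatrix.transpose.mulVec g x = g (x, true) + g (x, false) -
      (g (D.next.symm (x, true)) + g (D.next.symm (x, false))) := by
  have key : ∀ k : D.X × Bool → ℚ, ∑ p : D.X × Bool, (if x = p.1 then k p else 0) =
      k (x, true) + k (x, false) := by
    intro k
    rw [Fintype.sum_prod_type, Finset.sum_eq_single x]
    · simp
    · intro y _ hy
      simp [hy.symm]
    · simp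
  have h2 : ∑ p : D.X × Bool, (if x = (D.next p).1 then g p else 0) =
      ∑ p : D.X × Bool, (if x = p.1 then g (D.next.symm p) else 0) :=
    Fintype.sum_equiv D.next _ _ fun p => by simp
  simp only [edgeMatrix, Matrix.mulVec, dotProduct, Matrix.transpose_apply, Matrix.of_apply,
    sub_mul, ite_mul, one_mul, zero_mul, Finset.sum_sub_distrib]
  rw [key, h2, key]

theorem mem_ker_edgeMatrix_transpose (g : D.X × Bool → ℚ) :
    g ∈ LinearMap.ker D.edgeMatrix.transpose.mulVecLin ↔ D.IsFlow g := by
  rw [LinearMap.mem_ker, funext_iff]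
  refine forall_congr' fun x => ?_
  rw [Matrix.mulVecLin_apply, edgeMatrix_transpose_mulVec]
  exact sub_eq_zero

theorem ker_edgeMatrix :
    LinearMap.ker D.edgeMatrix.mulVecLin =
      LinearMap.range (LinearMap.funLeft ℚ ℚ (Quot.mk _ : D.X → D.Piece)) := by
  ext u
  rw [LinearMap.mem_ker, LinearMap.mem_range]
  constructor
  · intro h
    refine ⟨Quot.lift u ?_, rfl⟩
    rintro x y ⟨s, t, hst⟩
    have := congrFun h (x, s)
    rw [Matrix.mulVecLin_apply, edgeMatrix_mulVec, hst] at this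
    exact sub_eq_zero.1 this
  · rintro ⟨u, rfl⟩
    funext p
    rw [Matrix.mulVecLin_apply, edgeMatrix_mulVec]
    exact sub_eq_zero.2 (congrArg u (D.piece_next p).symm)

/-- Rank and nullity for the coboundary matrix and its transpose: there are `2 * Nat.card D.X`
edges, and the rank is `Nat.card D.X - D.numPieces`, since the kernel consists of the functions
constant on pieces. -/
theorem finrank_flows :
    (Module.finrank ℚ (LinearMap.ker D.edgeMatrix.transpose.mulVecLin) : ℤ) =
      Nat.card D.X + D.numPieces := by
  have := Fintype.ofFinite D.Piece
  have h1 := LinearMap.finrank_range_add_finrank_ker D.edgeMatrix.transpose.mulVecLin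
  have h2 := LinearMap.finrank_range_add_finrank_ker D.edgeMatrix.mulVecLin
  have h3 : D.edgeMatrix.transpose.rank = D.edgeMatrix.rank := Matrix.rank_transpose _
  rw [Matrix.rank, Matrix.rank] at h3
  rw [ker_edgeMatrix, LinearMap.finrank_range_of_inj
    (LinearMap.funLeft_injective_of_surjective ℚ ℚ _ Quot.mk_surjective)] at h2
  simp only [Module.finrank_fintype_fun_eq_card, Fintype.card_prod, Fintype.card_bool] at h1 h2
  have h4 : D.numPieces = Fintype.card (Quot fun x y : D.X => ∃ s t, D.next (x, s) = (y, t)) :=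
    Nat.card_eq_fintype_card
  rw [Nat.card_eq_fintype_card]
  omega

theorem finrank_boundaries :
    (Module.finrank ℚ (LinearMap.range D.faceBoundary) : ℤ) = D.numFaces - D.numPieces := by
  have := Fintype.ofFinite D.Piece
  have := Fintype.ofFinite D.Face
  have h1 := LinearMap.finrank_range_add_finrank_ker D.faceBoundary
  rw [ker_faceBoundary, LinearMap.finrank_range_of_inj
    (LinearMap.funLeft_injective_of_surjective ℚ ℚ _ D.facePiece_surjective)] at h1
  simp only [Module.finrank_fintype_fun_eq_card] at h1
  have h2 : D.numFaces = Fintype.card D.Face := Nat.card_eq_fintype_card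
  have h3 : D.numPieces = Fintype.card D.Piece := Nat.card_eq_fintype_card
  omega

theorem range_faceBoundary_le :
    LinearMap.range D.faceBoundary ≤ LinearMap.ker D.edgeMatrix.transpose.mulVecLin := by
  rintro _ ⟨f, rfl⟩
  rw [mem_ker_edgeMatrix_transpose]
  intro x
  set F : D.HalfEdge → ℚ := fun h => f (Quot.mk _ h) with hF
  have hf : D.IsFaceFunction F := fun h => congrArg f (D.face_rotate_opposite h)
  change F (D.next (x, true), false) - F ((x, true), true) +
    (F (D.next (x, false), false) - F ((x, false), true)) =
    F (D.next (D.next.symm (x, true)), false) - F (D.next.symm (x, true), true) +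
    (F (D.next (D.next.symm (x, false)), false) - F (D.next.symm (x, false), true))
  rw [Equiv.apply_symm_apply, Equiv.apply_symm_apply]
  rcases Int.units_eq_one_or (D.sign x) with hs | hs
  · obtain ⟨h1, h2, h3, h4⟩ := hf.corners_pos hs
    linarith
  · obtain ⟨h1, h2, h3, h4⟩ := hf.corners_neg hs
    linarith

/-- A diagram is planar iff its first homology vanishes. -/
theorem isPlanar_iff_flowsBound : D.IsPlanar ↔ D.FlowsBound := by
  have h1 := D.finrank_flows
  have h2 := D.finrank_boundaries
  have h3 := D.range_faceBoundary_le
  -- For `V` crossings, `F` faces and `P` pieces, planarity reads `F - P = V + P`: boundaries and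
  -- flows have equal dimension.
  have h4 : D.IsPlanar ↔
      LinearMap.range D.faceBoundary = LinearMap.ker D.edgeMatrix.transpose.mulVecLin := by
    constructor
    · intro h
      unfold IsPlanar at h
      exact Submodule.eq_of_le_of_finrank_eq h3 (by omega)
    · intro h
      rw [h] at h2
      unfold IsPlanar
      omega
  rw [h4]
  constructor
  · intro h g hg
    have : g ∈ LinearMap.range D.faceBoundary := by
      rw [h]
      exact (D.mem_ker_edgeMatrix_transpose g).2 hg
    obtain ⟨f, rfl⟩ := this
    exact ⟨fun h => f (Quot.mk _ h), fun h => congrArg f (D.face_rotate_opposite h), fun p => rfl⟩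
  · intro h
    refine le_antisymm h3 fun g hg => ?_
    obtain ⟨f, hf, hg⟩ := h g ((D.mem_ker_edgeMatrix_transpose g).1 hg)
    refine ⟨Quot.lift f ?_, ?_⟩
    · rintro h k rfl
      exact (hf h).symm
    · funext p
      exact (hg p).symm

end Rank

/-! ### Planarity under smoothing, and vanishing of intersection numbers -/

/-- Smoothing a crossing at which the values on the edges match. -/
theorem IsFaceFunction.smooth_corners {D : GaussDiagram} {f : D.HalfEdge → ℚ}
    (hf : D.IsFaceFunction f) {x : D.X}
    (h : ∀ b, f (D.next (x, !b), false) - f ((x, !b), true) =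
      f ((x, b), false) - f (D.next.symm (x, b), true)) (b : Bool) :
    f (D.next (x, !b), false) = f ((x, b), false) ∧
      f ((x, !b), true) = f (D.next.symm (x, b), true) := by
  have h1 := h true
  have h2 := h false
  simp only [Bool.not_true, Bool.not_false] at h1 h2
  rcases Int.units_eq_one_or (D.sign x) with hs | hs
  · obtain ⟨a1, a2, a3, a4⟩ := hf.corners_pos hs
    cases b <;> simp only [Bool.not_true, Bool.not_false] <;> constructor <;> linarith
  · obtain ⟨a1, a2, a3, a4⟩ := hf.corners_neg hs
    cases b <;> simp only [Bool.not_true, Bool.not_false] <;> constructor <;> linarith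

/-- The bypassed pass subdivides an edge, and the flow on that edge is copied to both halves. -/
theorem exists_extension_bypass {P : Type} (σ : Equiv.Perm P) (q : P) (g : P → ℚ) :
    ∃ g₀ : P → ℚ, (∀ p, p ≠ q → g₀ p = g p) ∧ g₀ q = g₀ (σ.symm q) ∧
      ∀ p, p ≠ q → g₀ (σ.symm (bypass σ q p)) = g p := by
  refine ⟨fun p => if p = q then g (σ.symm q) else g p, fun p hp => if_neg hp, ?_, fun p hp => ?_⟩
  · dsimp only
    rw [if_pos rfl]
    by_cases h : σ.symm q = q
    · rw [if_pos h]
    · rw [if_neg h]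
  · dsimp only
    by_cases h : σ p = q
    · rw [bypass_apply_of_eq h, Equiv.symm_apply_apply, if_pos rfl, ← h, Equiv.symm_apply_apply]
    · rw [bypass_apply_of_ne h hp, Equiv.symm_apply_apply, if_neg hp]

theorem apply_bypass_of_eq {P : Type} {σ : Equiv.Perm P} {q : P} {A : P → ℚ} (h : A (σ q) = A q)
    (p : P) : A (bypass σ q p) = A (σ p) := by
  by_cases h1 : p = q
  · rw [h1, bypass_self, h]
  · by_cases h2 : σ p = q
    · rw [bypass_apply_of_eq h2, h, h2]
    · rw [bypass_apply_of_ne h2 h1]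

/-- A flow on the smoothed diagram is a flow on `D` that at `c` enters along each strand and leaves
along the other. It bounds a combination of faces on `D`, whose values agree where the smoothing
joins faces (`smooth_corners`), so this combination restricts. -/
theorem FlowsBound.smooth {D : GaussDiagram} (hD : D.FlowsBound) (c : D.X) :
    (D.smooth c).FlowsBound := by
  set σ₁ := D.next * Equiv.swap (c, true) (c, false) with hσ₁
  set D₁ : GaussDiagram := { D with next := σ₁ } with hD₁
  set ρ₁ := bypass σ₁ (c, true) with hρ₁
  set ρ₂ := bypass ρ₁ (c, false) with hρ₂
  have hnext : ∀ p : (D₁.erase c).X × Bool,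
      D₁.passVal c ((D₁.erase c).next p) = ρ₂ (D₁.passVal c p) := fun p => rfl
  change (D₁.erase c).FlowsBound
  intro g' hg'
  -- the flow on `D`
  obtain ⟨g₂, hg₂⟩ : ∃ g₂ : D.X × Bool → ℚ, ∀ p, g₂ (D₁.passVal c p) = g' p :=
    ⟨Function.extend (D₁.passVal c) g' 0, fun p =>
      (D₁.passVal_injective c).extend_apply _ _ _⟩
  -- The two bypasses in `erase` are undone in reverse order.
  obtain ⟨g₁, a1, a2, a3⟩ := exists_extension_bypass ρ₁ (c, false) g₂
  obtain ⟨g₀, b1, b2, b3⟩ := exists_extension_bypass σ₁ (c, true) g₁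
  have hρ₁c : ρ₁ (c, true) = (c, true) := bypass_self _ _
  have hswap : ∀ b, Equiv.swap ((c, true) : D.X × Bool) (c, false) (c, b) = (c, !b) := by
    intro b
    cases b
    · exact Equiv.swap_apply_right _ _
    · exact Equiv.swap_apply_left _ _
  have hswap' : ∀ p : D.X × Bool, p.1 ≠ c →
      Equiv.swap ((c, true) : D.X × Bool) (c, false) p = p := by
    intro p hp
    refine Equiv.swap_apply_of_ne_of_ne ?_ ?_ <;> rintro rfl <;> exact hp rfl
  have hσc : ∀ b, σ₁ (c, b) = D.next (c, !b) := fun b => by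
    rw [hσ₁, Equiv.Perm.mul_apply, hswap]
  have hσne : ∀ p : D.X × Bool, p.1 ≠ c → σ₁ p = D.next p := fun p hp => by
    rw [hσ₁, Equiv.Perm.mul_apply, hswap' p hp]
  have hc : ∀ b, g₀ (c, b) = g₀ (σ₁.symm (c, b)) := by
    intro b
    cases b
    · rw [b1 _ (by simp), a2]
      have := b3 (ρ₁.symm (c, false)) (by
        intro e
        rw [Equiv.symm_apply_eq, hρ₁c] at e
        simp at e)
      rw [← hρ₁, Equiv.apply_symm_apply] at this
      exact this.symm
    · exact b2
  have hin : ∀ p : (D₁.erase c).X × Bool,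
      g₀ (σ₁.symm (D₁.passVal c ((D₁.erase c).next p))) = g' p := by
    intro p
    have hp : (D₁.passVal c p).1 ≠ c := D₁.eraseVal_ne c p.1
    have hp2 : (D₁.passVal c ((D₁.erase c).next p)).1 ≠ c :=
      D₁.eraseVal_ne c ((D₁.erase c).next p).1
    have e1 := a3 (D₁.passVal c p) (fun e => hp (congrArg Prod.fst e))
    have e2 := b3 (ρ₁.symm (ρ₂ (D₁.passVal c p))) (by
      intro e
      rw [Equiv.symm_apply_eq, hρ₁c, ← hnext] at e
      exact hp2 (congrArg Prod.fst e))
    rw [← hρ₁, Equiv.apply_symm_apply] at e2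
    rw [hnext, e2, hρ₂, e1, hg₂]
  have hout : ∀ p : (D₁.erase c).X × Bool, g₀ (D₁.passVal c p) = g' p := by
    intro p
    have hp : (D₁.passVal c p).1 ≠ c := D₁.eraseVal_ne c p.1
    rw [b1 _ (fun e => hp (congrArg Prod.fst e)), a1 _ (fun e => hp (congrArg Prod.fst e)), hg₂]
  set g : D.X × Bool → ℚ := fun p => g₀ (Equiv.swap (c, true) (c, false) p) with hg
  have hgin : ∀ p, g (D.next.symm p) = g₀ (σ₁.symm p) := fun p => rfl
  have hgne : ∀ p : D.X × Bool, p.1 ≠ c → g p = g₀ p := fun p hp => by rw [hg]; simp only [hswap' p hp]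
  have hgc : ∀ b, g (c, b) = g₀ (c, !b) := fun b => by rw [hg]; simp only [hswap]
  have hflow : D.IsFlow g := by
    intro x
    rw [hgin, hgin]
    by_cases hx : x = c
    · rw [hx, hgc, hgc, ← hc, ← hc]
      exact add_comm _ _
    · obtain ⟨y, hy⟩ := D₁.exists_eraseVal_eq hx
      have := hg' y
      have h1 : ∀ b, g₀ (σ₁.symm (x, b)) = g' ((D₁.erase c).next.symm (y, b)) := by
        intro b
        have := hin ((D₁.erase c).next.symm (y, b))
        rw [Equiv.apply_symm_apply] at this
        rw [← this, passVal, hy]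
      have h2 : ∀ b, g (x, b) = g' (y, b) := by
        intro b
        rw [hgne _ hx, ← hout, passVal, hy]
      rw [h1, h1, h2, h2, this]
  obtain ⟨f, hf, hgf⟩ := hD g hflow
  have hin' : ∀ p, g (D.next.symm p) = f (p, false) - f (D.next.symm p, true) := by
    intro p
    rw [hgf, Equiv.apply_symm_apply]
  have hcor := fun b => hf.smooth_corners (x := c) (fun b => by
    rw [← hgf, ← hin', hgc, Bool.not_not, hgin, hc]) b
  have hA : ∀ p : D.X × Bool, p.1 ≠ c → f (ρ₂ p, false) = f (D.next p, false) := by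
    intro p hp
    have e1 : ∀ b, f (σ₁ (c, b), false) = f ((c, b), false) := fun b => by
      rw [hσc]
      exact (hcor b).1
    have e2 := fun p => apply_bypass_of_eq (σ := σ₁) (q := (c, true))
      (A := fun p => f (p, false)) (e1 true) p
    have e3 := apply_bypass_of_eq (σ := ρ₁) (q := (c, false))
      (A := fun p => f (p, false)) ((e2 _).trans (e1 false)) p
    rw [← hσne p hp]
    exact e3.trans (e2 p)
  have hB : ∀ p : D.X × Bool, p.1 ≠ c → f (D.next.symm (ρ₂ p), true) = f (p, true) := by
    intro p hp
    have e1 : ∀ b, f (D.next.symm (σ₁ (c, b)), true) = f (D.next.symm (c, b), true) := fun b => by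
      rw [hσc, Equiv.symm_apply_apply]
      exact (hcor b).2
    have e2 := fun p => apply_bypass_of_eq (σ := σ₁) (q := (c, true))
      (A := fun p => f (D.next.symm p, true)) (e1 true) p
    have e3 := apply_bypass_of_eq (σ := ρ₁) (q := (c, false))
      (A := fun p => f (D.next.symm p, true)) ((e2 _).trans (e1 false)) p
    have e4 := e3.trans (e2 p)
    rwa [hσne p hp, Equiv.symm_apply_apply] at e4
  refine ⟨fun h => f (D₁.passVal c h.1, h.2), fun h => ?_, fun p => ?_⟩
  · have hopp : ∀ h : (D₁.erase c).HalfEdge,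
        f (D₁.passVal c ((D₁.erase c).opposite h).1, ((D₁.erase c).opposite h).2) =
          f (D.opposite (D₁.passVal c h.1, h.2)) := by
      rintro ⟨p, o⟩
      cases o
      · change f (D₁.passVal c ((D₁.erase c).next.symm p), true) =
          f (D.next.symm (D₁.passVal c p), true)
        have := hB (D₁.passVal c ((D₁.erase c).next.symm p)) (D₁.eraseVal_ne c _)
        rw [← hnext, Equiv.apply_symm_apply] at this
        exact this.symm
      · exact hA (D₁.passVal c p) (D₁.eraseVal_ne c p.1)
    have hrot : ∀ h : (D₁.erase c).HalfEdge,
        f (D₁.passVal c ((D₁.erase c).rotate h).1, ((D₁.erase c).rotate h).2) =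
          f (D.rotate (D₁.passVal c h.1, h.2)) := fun h => rfl
    refine (hrot _).trans ((hf.rotate_eq _).trans ?_)
    have := hopp ((D₁.erase c).opposite h)
    rw [opposite_opposite] at this
    exact this.symm
  · dsimp only
    rw [hnext, hA _ (D₁.eraseVal_ne c p.1), ← hgf, hgne _ (D₁.eraseVal_ne c p.1), hout]

theorem IsPlanar.smooth {D : GaussDiagram} (h : D.IsPlanar) (c : D.X) : (D.smooth c).IsPlanar :=
  (isPlanar_iff_flowsBound _).2 (((isPlanar_iff_flowsBound _).1 h).smooth c)

/-- The cycle function `c₁` defines a flow, hence the boundary of some `f` on faces. Its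
intersection number with `c₂` is the total change of `f` along `c₂`, which is zero because `c₂`
closes up. -/
theorem FlowsBound.balanced {D : GaussDiagram} (hD : D.FlowsBound) : D.toMarked.Balanced := by
  intro S hS c₁ c₂ h1 h2
  have h1 : ∀ p, c₁ (D.next (exchange (S : Set D.X) p)) = c₁ p := h1
  have h2 : ∀ p, c₂ (D.next (exchange (S : Set D.X) p)) = c₂ p := h2
  have hex : ∀ x b, exchange (S : Set D.X) (x, b) = (x, if x ∈ S then !b else b) := fun x b => by
    simp [exchange, Function.Involutive.toPerm]
  set g : D.X × Bool → ℚ := fun p => c₁ (D.next p) with hg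
  have hgin : ∀ p, g (D.next.symm p) = c₁ p := fun p => by
    rw [hg]
    simp only [Equiv.apply_symm_apply]
  have hmem : ∀ x ∈ S, ∀ b, g (x, !b) = c₁ (x, b) := by
    intro x hx b
    have := h1 (x, b)
    rw [hex, if_pos hx] at this
    exact congrArg (fun k : ℤ => (k : ℚ)) this
  have hnot : ∀ x, x ∉ S → ∀ b, g (x, b) = c₁ (x, b) := by
    intro x hx b
    have := h1 (x, b)
    rw [hex, if_neg hx] at this
    exact congrArg (fun k : ℤ => (k : ℚ)) this
  have hflow : D.IsFlow g := by
    intro x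
    rw [hgin, hgin]
    by_cases hx : x ∈ S
    · have e1 := hmem x hx true
      have e2 := hmem x hx false
      simp only [Bool.not_true, Bool.not_false] at e1 e2
      rw [e1, e2, add_comm]
    · rw [hnot x hx, hnot x hx]
  obtain ⟨f, hf, hgf⟩ := hD g hflow
  have hin' : ∀ p, (c₁ p : ℚ) = f (p, false) - f (D.next.symm p, true) := by
    intro p
    rw [← hgin, hgf, Equiv.apply_symm_apply]
  have := Fintype.ofFinite D.X
  set τ := D.next * exchange (S : Set D.X) with hτ
  have hsum : ∑ p : D.X × Bool, (c₂ p : ℚ) * (f (τ p, false) - f (p, false)) = 0 := by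
    simp only [mul_sub, Finset.sum_sub_distrib]
    rw [sub_eq_zero]
    refine Fintype.sum_equiv τ _ _ fun p => ?_
    have : c₂ (τ p) = c₂ p := h2 p
    rw [this]
  -- At a smoothed crossing the path turns without crossing anything, and `f` does not change.
  have hS0 : ∀ x ∈ S, ∀ b, f (τ (x, b), false) - f ((x, b), false) = 0 := by
    intro x hx b
    have e1 : τ (x, b) = D.next (x, !b) := by
      rw [hτ, Equiv.Perm.mul_apply, hex, if_pos hx]
    rw [e1, sub_eq_zero]
    refine (hf.smooth_corners (fun b => ?_) b).1
    rw [← hgf, ← hin', hmem x hx]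
  -- Going straight on crosses the other strand, where `f` jumps by plus or minus the value of `c₁`,
  -- according to the crossing.
  have hS1 : ∀ x, x ∉ S → ∑ b, (c₂ (x, b) : ℚ) * (f (τ (x, b), false) - f ((x, b), false)) =
      ((D.sign x : ℤ) : ℚ) * (c₁ (x, true) * c₂ (x, false) - c₂ (x, true) * c₁ (x, false)) := by
    intro x hx
    have e1 : ∀ b, τ (x, b) = D.next (x, b) := fun b => by
      rw [hτ, Equiv.Perm.mul_apply, hex, if_neg hx]
    have e2 := fun b => hgf (x, b)
    have e3 := fun b => hin' (x, b)
    have e4 := hnot x hx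
    rw [Fintype.sum_bool, e1, e1]
    have t1 := e2 true
    have t2 := e2 false
    have t3 := e3 true
    have t4 := e3 false
    rw [e4] at t1 t2
    rcases Int.units_eq_one_or (D.sign x) with hs | hs
    · obtain ⟨a1, a2, a3, a4⟩ := hf.corners_pos hs
      have u1 : f (D.next (x, true), false) - f ((x, true), false) = -c₁ (x, false) := by linarith
      have u2 : f (D.next (x, false), false) - f ((x, false), false) = c₁ (x, true) := by linarith
      rw [u1, u2, hs]
      push_cast
      ring
    · obtain ⟨a1, a2, a3, a4⟩ := hf.corners_neg hs
      have u1 : f (D.next (x, true), false) - f ((x, true), false) = c₁ (x, false) := by linarith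
      have u2 : f (D.next (x, false), false) - f ((x, false), false) = -c₁ (x, true) := by linarith
      rw [u1, u2, hs]
      push_cast
      ring
  rw [Fintype.sum_prod_type] at hsum
  have hfin : ((∑ x ∈ D.toMarked.active \ S, (D.sign x : ℤ) *
      (c₁ (x, true) * c₂ (x, false) - c₂ (x, true) * c₁ (x, false)) : ℤ) : ℚ) = 0 := by
    rw [← hsum]
    push_cast
    refine Eq.trans (Finset.sum_congr rfl fun x hx => ?_) (Finset.sum_subset (Finset.subset_univ _)
      fun x _ hx => ?_)
    · exact (hS1 x (Finset.mem_sdiff.1 hx).2).symm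
    · have hx : x ∈ S := by
        by_contra hh
        exact hx (Finset.mem_sdiff.2 ⟨D.mem_toMarked_active x, hh⟩)
      refine Finset.sum_eq_zero fun b _ => ?_
      rw [hS0 x hx, mul_zero]
  exact_mod_cast hfin

theorem IsPlanar.balanced {D : GaussDiagram} (h : D.IsPlanar) : D.toMarked.Balanced :=
  ((isPlanar_iff_flowsBound _).1 h).balanced

end GaussDiagram

/-! ## Existence and uniqueness of the invariant -/

namespace GaussDiagram

open scoped Classical
open MarkedDiagram

/-- Even if crossings disappear, components do not: the first word of a traversal keeps a pass or
becomes an empty word, that is, a circle. -/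
theorem nonempty_smooth (D : GaussDiagram) (c : D.X) :
    Nonempty (D.smooth c).X ∨ 0 < (D.smooth c).circles := by
  set D₁ : GaussDiagram := { D with next := D.next * Equiv.swap (c, true) (c, false) } with hD₁
  obtain ⟨l, hl⟩ := D₁.toMarked.exists_isTraversal
  have h1 := D₁.isTraversal_erase c hl
  cases l with
  | nil => exact absurd (hl.1.mem (c, true)) (by simp)
  | cons w l =>
    rw [List.map_cons] at h1
    have h2 := h1.2
    cases hw : D₁.eraseWord c w with
    | nil =>
      right
      rw [hw, List.countP_cons] at h2
      change 0 < (D₁.erase c).toMarked.circles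
      rw [← h2]
      simp
    | cons p m => exact Or.inl ⟨p.1⟩

theorem card_smooth_lt (D : GaussDiagram) (c : D.X) : Nat.card (D.smooth c).X < Nat.card D.X :=
  Finite.card_subtype_lt (p := fun x : D.X => x ≠ c) (x := c) (by simp)

theorem sign_switch_of_mem (D : GaussDiagram) {S : Set D.X} {x : D.X} (h : x ∈ S) :
    (D.switch S).sign x = -D.sign x := if_pos h

theorem sign_switch_of_notMem (D : GaussDiagram) {S : Set D.X} {x : D.X} (h : x ∉ S) :
    (D.switch S).sign x = D.sign x := if_neg h

theorem exchange_of_mem {X : Type} {S : Set X} {x : X} (h : x ∈ S) (b : Bool) :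
    exchange S (x, b) = (x, !b) := by
  simp [exchange, Function.Involutive.toPerm, h]

theorem exchange_of_notMem {X : Type} {S : Set X} {x : X} (h : x ∉ S) (b : Bool) :
    exchange S (x, b) = (x, b) := by
  simp [exchange, Function.Involutive.toPerm, h]

theorem switch_empty (D : GaussDiagram) : D.switch ∅ = D := by
  have h : exchange (∅ : Set D.X) = 1 := by
    ext p <;> simp [exchange, Function.Involutive.toPerm]
  obtain ⟨X, sign, next, circles⟩ := D
  simp [switch, h]

theorem mk_congr {X : Type} [Finite X] {s s' : X → ℤˣ} {n n' : Equiv.Perm (X × Bool)} {k : ℕ}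
    (hs : s = s') (hn : n = n') :
    ({ X := X, sign := s, next := n, circles := k } : GaussDiagram) =
      { X := X, sign := s', next := n', circles := k } := by
  rw [hs, hn]

theorem switch_insert (D : GaussDiagram) {S : Set D.X} {x : D.X} (hx : x ∉ S) :
    D.switch (insert x S) = (D.switch S).switch ({x} : Set D.X) := by
  have h : ∀ p, exchange (insert x S) p = exchange ({x} : Set D.X) (exchange S p) := by
    rintro ⟨y, b⟩
    by_cases hy : y = x
    · subst hy
      simp [exchange, Function.Involutive.toPerm, hx]
    · by_cases hyS : y ∈ S <;> simp [exchange, Function.Involutive.toPerm, hy, hyS]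
  have h' : ∀ p, exchange (insert x S) p = exchange S (exchange ({x} : Set D.X) p) := by
    rintro ⟨y, b⟩
    by_cases hy : y = x
    · subst hy
      simp [exchange, Function.Involutive.toPerm, hx]
    · by_cases hyS : y ∈ S <;> simp [exchange, Function.Involutive.toPerm, hy, hyS]
  refine mk_congr (X := D.X) (funext fun y : D.X => ?_) (Equiv.ext fun p : D.X × Bool => ?_)
  · change (D.switch (insert x S)).sign y = ((D.switch S).switch ({x} : Set D.X)).sign y
    by_cases hy : y = x
    · subst hy
      rw [sign_switch_of_mem _ (Set.mem_insert _ _),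
        sign_switch_of_mem (D.switch S) (show y ∈ ({y} : Set D.X) from rfl),
        sign_switch_of_notMem _ hx]
    · rw [sign_switch_of_notMem (D.switch S) (show y ∉ ({x} : Set D.X) from hy)]
      by_cases hyS : y ∈ S
      · rw [sign_switch_of_mem _ (Set.mem_insert_of_mem _ hyS), sign_switch_of_mem _ hyS]
      · rw [sign_switch_of_notMem _ hyS, sign_switch_of_notMem]
        rintro (h1 | h1)
        exacts [hy h1, hyS h1]
  · change exchange (insert x S) (D.next (exchange (insert x S) p)) =
      exchange ({x} : Set D.X) (exchange S (D.next (exchange S (exchange ({x} : Set D.X) p))))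
    rw [← h' p, h]

theorem switch_switch_self (D : GaussDiagram) (x : D.X) :
    (D.switch {x}).switch ({x} : Set D.X) = D := by
  refine mk_congr (X := D.X) (k := D.circles) (s' := D.sign) (n' := D.next)
    (funext fun y : D.X => ?_) (Equiv.ext fun p : D.X × Bool => ?_)
  · change ((D.switch ({x} : Set D.X)).switch ({x} : Set D.X)).sign y = D.sign y
    by_cases hy : y ∈ ({x} : Set D.X)
    · rw [sign_switch_of_mem (D.switch _) hy, sign_switch_of_mem _ hy, neg_neg]
    · rw [sign_switch_of_notMem (D.switch _) hy, sign_switch_of_notMem _ hy]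
  · change exchange ({x} : Set D.X) (exchange ({x} : Set D.X) (D.next (exchange ({x} : Set D.X)
      (exchange ({x} : Set D.X) p)))) = D.next p
    rw [exchange_exchange, exchange_exchange]

/-- Some crossing changes make a diagram descending. -/
theorem exists_isDescending_switch (D : GaussDiagram) : ∃ S : Set D.X, (D.switch S).IsDescending := by
  obtain ⟨l, hl, hne, -⟩ := exists_isTrav D.next 0
  set S : Set D.X := {x | ¬ [(x, true), (x, false)].Sublist l.flatten} with hS
  refine ⟨S, l.map (List.map (exchange S)), ?_, fun x : D.X => ?_⟩
  · have h := hl.map (σ' := (D.switch S).next) (exchange S) (fun p => by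
      change exchange S (D.next (exchange S (exchange S p))) = _
      rw [exchange_exchange]
      rfl)
    refine ⟨fun m hm => ⟨?_, h.cyc m hm⟩, h.nodup, h.mem⟩
    obtain ⟨w, hw, rfl⟩ := List.mem_map.1 hm
    intro e
    exact hne (List.map_eq_nil_iff.1 e ▸ hw)
  · change [(x, true), (x, false)].Sublist (l.map (List.map (exchange S))).flatten
    rw [← List.map_flatten]
    by_cases hx : x ∈ S
    · have h1 := (pair_sublist_total (hl.mem (x, true)) (hl.mem (x, false))
        (by simp)).resolve_left hx
      have h2 := h1.map (exchange S)
      rwa [List.map_cons, List.map_cons, List.map_nil, exchange_of_mem hx, exchange_of_mem hx] at h2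
    · have h1 : [(x, true), (x, false)].Sublist l.flatten := not_not.1 hx
      have h2 := h1.map (exchange S)
      rwa [List.map_cons, List.map_cons, List.map_nil, exchange_of_notMem hx,
        exchange_of_notMem hx] at h2

variable {R : Type*} [CommRing R] (K : SkeinData R)

theorem value_skein {D : GaussDiagram} (h : D.IsPlanar) (c : D.X) :
    D.value K = K.combine D.toMarked c ((D.switch {c}).value K) ((D.smooth c).value K) := by
  rw [← value_smooth K h.balanced (h.smooth c).balanced,
    value_switch K {c} h.balanced (h.switch {c}).balanced]
  have : ∀ o : D.X → Bool, (∀ x, o x = true ↔ x ≠ c) →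
      D.toMarked.setUpper o = D.toMarked.flip c := by
    intro o ho
    ext1 <;> try rfl
    funext x
    by_cases hx : x = c
    · subst hx
      have := ho x
      simpa [setUpper, toMarked] using this
    · have := (ho x).2 hx
      simpa [setUpper, flip_upper_of_ne _ hx, toMarked] using this
  rw [this _ (by simp)]
  exact K.eval_skein _ (D.mem_toMarked_active c)

end GaussDiagram

namespace LinkDiagram

theorem ext_toGauss {D D' : LinkDiagram} (h : D.toGauss = D'.toGauss) : D = D' := by
  obtain ⟨G, _, _⟩ := D
  obtain ⟨G', _, _⟩ := D'
  obtain rfl : G = G' := h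
  rfl

/-- The smoothing of a crossing of a link diagram. -/
noncomputable def smooth (D : LinkDiagram) (c : D.Crossing) : LinkDiagram where
  toGauss := D.toGauss.smooth c
  planar := D.planar.smooth c
  nonempty := D.toGauss.nonempty_smooth c

theorem switch_empty (D : LinkDiagram) : D.switch ∅ = D :=
  ext_toGauss D.toGauss.switch_empty

theorem switch_insert (D : LinkDiagram) {S : Set D.Crossing} {x : D.Crossing} (hx : x ∉ S) :
    D.switch (insert x S) = (D.switch S).switch ({x} : Set D.Crossing) :=
  ext_toGauss (D.toGauss.switch_insert hx)

theorem switch_switch_self (D : LinkDiagram) (x : D.Crossing) :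
    (D.switch {x}).switch ({x} : Set D.Crossing) = D :=
  ext_toGauss (D.toGauss.switch_switch_self x)

end LinkDiagram

/-- A generalized Conway type invariant is determined by its properties. -/
theorem IsGeneralizedConwayInvariant.unique {A : Type*} {𝒜 : GeneralizedConwayAlgebra A}
    {W W' : OrientedLink → A} (hW : IsGeneralizedConwayInvariant 𝒜 W)
    (hW' : IsGeneralizedConwayInvariant 𝒜 W') : W = W' := by
  suffices ∀ D : LinkDiagram, W D.link = W' D.link by
    funext L
    obtain ⟨D⟩ := L
    exact this D
  intro D
  induction hN : Nat.card D.Crossing using Nat.strong_induction_on generalizing D with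
  | _ N ih =>
  subst hN
  -- The smoothings agree by induction, and both operations are injective in the first argument, so
  -- agreement passes through a crossing change in both directions.
  have pos : ∀ (E : LinkDiagram) (x : E.Crossing), Nat.card E.Crossing = Nat.card D.Crossing →
      E.toGauss.sign x = 1 →
      (W E.link = W' E.link ↔ W (E.switch {x}).link = W' (E.switch {x}).link) := by
    intro E x hE hx
    have h0 : W (E.smooth x).link = W' (E.smooth x).link :=
      ih _ (hE ▸ E.toGauss.card_smooth_lt x) (E.smooth x) rfl
    by_cases hs : E.toGauss.IsSelf x
    · rw [hW.self_skein E (E.smooth x) x hx rfl hs, hW'.self_skein E (E.smooth x) x hx rfl hs, h0]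
      refine ⟨fun h => ?_, fun h => by rw [h]⟩
      rw [← 𝒜.circ_circInv (W (E.switch {x}).link) (W' (E.smooth x).link), h, 𝒜.circ_circInv]
    · rw [hW.mixed_skein E (E.smooth x) x hx rfl hs, hW'.mixed_skein E (E.smooth x) x hx rfl hs, h0]
      refine ⟨fun h => ?_, fun h => by rw [h]⟩
      rw [← 𝒜.star_starInv (W (E.switch {x}).link) (W' (E.smooth x).link), h, 𝒜.star_starInv]
  have key : ∀ (E : LinkDiagram) (x : E.Crossing), Nat.card E.Crossing = Nat.card D.Crossing →
      (W E.link = W' E.link ↔ W (E.switch {x}).link = W' (E.switch {x}).link) := by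
    intro E x hE
    rcases Int.units_eq_one_or (E.toGauss.sign x) with hs | hs
    · exact pos E x hE hs
    · have h1 : (E.switch {x}).toGauss.sign x = 1 := by
        simp [LinkDiagram.switch, GaussDiagram.switch, hs]
      have := pos (E.switch {x}) x hE h1
      have e : (E.switch {x}).switch ({x} : Set (E.switch {x}).Crossing) = E :=
        E.switch_switch_self x
      refine Iff.trans ?_ this.symm
      exact (congrArg (fun G : LinkDiagram => W G.link = W' G.link) e.symm).to_iff
  obtain ⟨S, hS⟩ := D.toGauss.exists_isDescending_switch
  have hdesc : W (D.switch S).link = W' (D.switch S).link := by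
    rw [hW.descending (D.switch S) hS, hW'.descending (D.switch S) hS]
  have claim : ∀ S : Set D.Crossing, W (D.switch S).link = W' (D.switch S).link →
      W D.link = W' D.link := by
    intro S
    induction S, Set.toFinite S using Set.Finite.induction_on with
    | empty => rw [D.switch_empty]; exact id
    | insert hx _ ih' =>
      rw [D.switch_insert hx]
      exact fun h => ih' ((key (D.switch _) _ rfl).2 h)
  exact claim S hdesc

open HomflyptRing in
/-- The skein relations of the generalized Conway type invariant. -/
noncomputable def homflyptSkein : SkeinData HomflyptRing where
  v := v
  vInv := vInv
  w := w
  z := z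
  a := homflyptConwayAlgebra.a
  v_mul_vInv := v_mul_vInv
  a_eq := homflyptConwayAlgebra.a_eq

/-- The generalized Conway type invariant. -/
noncomputable def homflyptInvariant : OrientedLink → HomflyptRing :=
  Quot.lift (fun D => D.toGauss.value homflyptSkein) fun D D' h =>
    h.value_eq homflyptSkein D.planar.balanced D'.planar.balanced

theorem homflyptInvariant_link (D : LinkDiagram) :
    homflyptInvariant D.link = D.toGauss.value homflyptSkein := rfl

theorem isGeneralizedConwayInvariant_homflyptInvariant :
    IsGeneralizedConwayInvariant homflyptConwayAlgebra homflyptInvariant where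
  self_skein D D₀ c hc h₀ hs := by
    simp only [homflyptInvariant_link]
    rw [h₀, D.toGauss.value_skein homflyptSkein D.planar c]
    unfold SkeinData.combine SkeinData.kindCoeff SkeinData.switchCoeff SkeinData.smoothCoeff
    rw [D.toGauss.sgn_toMarked, hc, if_pos rfl, if_pos rfl, if_pos (show D.toGauss.toMarked.IsSelf c from hs)]
    rfl
  mixed_skein D D₀ c hc h₀ hs := by
    simp only [homflyptInvariant_link]
    rw [h₀, D.toGauss.value_skein homflyptSkein D.planar c]
    unfold SkeinData.combine SkeinData.kindCoeff SkeinData.switchCoeff SkeinData.smoothCoeff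
    rw [D.toGauss.sgn_toMarked, hc, if_pos rfl, if_pos rfl, if_neg (show ¬ D.toGauss.toMarked.IsSelf c from hs)]
    rfl
  trivial_link n hn := by
    have h : (LinkDiagram.trivial n hn).toGauss.IsDescending :=
      ⟨[], ⟨by simp, by simp, fun p => p.1.elim⟩, fun x => x.elim⟩
    have e := GaussDiagram.value_of_isDescending homflyptSkein
      (LinkDiagram.trivial n hn).planar.balanced h
    have : (LinkDiagram.trivial n hn).toGauss.numComponents = n := by
      have : IsEmpty (Quotient (Equiv.Perm.SameCycle.setoid
          (LinkDiagram.trivial n hn).toGauss.next)) :=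
        ⟨fun q => Quotient.inductionOn q fun p => p.1.elim⟩
      rw [GaussDiagram.numComponents, Nat.card_of_isEmpty, add_zero]
      rfl
    rw [this] at e
    exact e
  descending D h := GaussDiagram.value_of_isDescending homflyptSkein D.planar.balanced h

/-! ## Alternating sums over crossing changes -/

namespace MarkedDiagram

variable {Y : Type} [DecidableEq Y]

/-- Change all the crossings in `T`. -/
def flipSet (D : MarkedDiagram Y) (T : Finset Y) : MarkedDiagram Y :=
  D.setUpper fun x => if x ∈ T then !D.upper x else D.upper x

theorem flipSet_insert (D : MarkedDiagram Y) {T : Finset Y} {c : Y} (hc : c ∉ T) :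
    D.flipSet (insert c T) = (D.flip c).flipSet T := by
  ext1 <;> try rfl
  funext x
  by_cases hx : x = c
  · subst hx
    simp [flipSet, setUpper, hc]
  · simp [flipSet, setUpper, hx, flip_upper_of_ne D hx]

theorem flip_flipSet (D : MarkedDiagram Y) {T : Finset Y} {c : Y} (hc : c ∉ T) :
    (D.flipSet T).flip c = (D.flip c).flipSet T := by
  ext1 <;> try rfl
  funext x
  by_cases hx : x = c
  · subst hx
    rw [flip_upper_self]
    simp [flipSet, setUpper, hc]
  · rw [flip_upper_of_ne _ hx]
    simp [flipSet, setUpper, flip_upper_of_ne D hx]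

theorem smooth_flipSet (D : MarkedDiagram Y) {T : Finset Y} {c : Y} (hc : c ∉ T) :
    (D.flipSet T).smooth c = (D.smooth c).flipSet T := by
  ext1 <;> try rfl
  funext x
  by_cases hx : x = c
  · subst hx
    simp [flipSet, setUpper, hc, smooth]
  · rw [smooth_upper_of_ne _ hx]
    simp [flipSet, setUpper, smooth_upper_of_ne D hx]

theorem sgn_flipSet_of_notMem (D : MarkedDiagram Y) {T : Finset Y} {c : Y} (hc : c ∉ T) :
    (D.flipSet T).sgn c = D.sgn c := by
  simp [sgn, flipSet, setUpper, hc]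

theorem sgn_flipSet_of_mem (D : MarkedDiagram Y) {T : Finset Y} {c : Y} (hc : c ∈ T) :
    (D.flipSet T).sgn c = -D.sgn c := by
  rw [← sgn_flip_self]
  simp [sgn, flipSet, setUpper, hc, flip]

theorem sgn_flipSet_congr {D D' : MarkedDiagram Y} {c : Y} (h : D.sgn c = D'.sgn c)
    (T : Finset Y) : (D.flipSet T).sgn c = (D'.flipSet T).sgn c := by
  by_cases hc : c ∈ T
  · rw [sgn_flipSet_of_mem _ hc, sgn_flipSet_of_mem _ hc, h]
  · rw [sgn_flipSet_of_notMem _ hc, sgn_flipSet_of_notMem _ hc, h]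

end MarkedDiagram

namespace SkeinData

open MarkedDiagram

variable {Y : Type} [DecidableEq Y] {R : Type*} [CommRing R] (K : SkeinData R)

/-- The values of two skein relations agree if the coefficients do. -/
theorem map_evalAlong_eq {R' R'' : Type*} [CommRing R'] [CommRing R''] {K : SkeinData R} {K' : SkeinData R'}
    {f : R →+* R''} {g : R' →+* R''} (hv : f K.v = g K'.v) (hvi : f K.vInv = g K'.vInv)
    (hw : f K.w = g K'.w) (hz : f K.z = g K'.z) (ha : ∀ n, f (K.a n) = g (K'.a n))
    (D : MarkedDiagram Y) (l : List (List (Y × Bool))) :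
    f (K.evalAlong D l) = g (K'.evalAlong D l) := by
  -- Both evaluations follow the same recursion, since the bad crossing chosen depends on `D` and
  -- `l` but not on the coefficients.
  induction D, l using evalAlong.induct with
  | case1 D l h ih1 ih2 =>
    rw [evalAlong, dif_pos h, evalAlong.eq_1 K', dif_pos h]
    unfold combine switchCoeff smoothCoeff kindCoeff
    simp only [map_add, map_mul, ih1, ih2]
    split_ifs <;> simp only [map_pow, map_neg, hv, hvi, hw, hz]
  | case2 D l h =>
    rw [evalAlong, dif_neg h, evalAlong.eq_1 K', dif_neg h, ha]

/-- The alternating sum over all resolutions of the crossings in `S`. -/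
noncomputable def singularSum (D : MarkedDiagram Y) (S : Finset Y) : R :=
  ∑ T ∈ S.powerset, (∏ c ∈ S, (((D.flipSet T).sgn c : ℤ) : R)) * K.eval (D.flipSet T)

/-- The diagram with the crossing `c` made negative. -/
def negative (D : MarkedDiagram Y) (c : Y) : MarkedDiagram Y := if D.sgn c = 1 then D.flip c else D

/-- The sign turns the difference into `L₊ - L₋` whatever the sign of `c`, with `negative D c` in
the role of `L₋`. -/
theorem sgn_mul_eval_sub [Finite Y] {D : MarkedDiagram Y} {c : Y} (hc : c ∈ D.active) :
    ((D.sgn c : ℤ) : R) * (K.eval D - K.eval (D.flip c)) =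
      (K.v ^ 2 - 1) * K.eval (negative D c) + K.v * K.kindCoeff D c * K.eval (D.smooth c) := by
  have e := K.v_mul_vInv
  have h := K.eval_skein D hc
  unfold combine at h
  unfold negative
  rcases Int.units_eq_one_or (D.sgn c) with hs | hs
  · rw [hs] at h ⊢
    simp only [switchCoeff, smoothCoeff, if_true] at h
    rw [if_pos rfl, h]
    push_cast
    ring
  · have hne : ¬ (-1 : ℤˣ) = 1 := by decide
    rw [hs] at h ⊢
    simp only [switchCoeff, smoothCoeff, if_neg hne] at h
    rw [if_neg hne]
    push_cast
    linear_combination (-K.v ^ 2) * h - (K.v * K.vInv + 1) * K.eval (D.flip c) * e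
      + K.v * K.kindCoeff D c * K.eval (D.smooth c) * e

/-- The double point `c` is resolved by `sgn_mul_eval_sub` inside each resolution of the others; its
coefficients do not depend on those other resolutions. -/
theorem singularSum_insert [Finite Y] {D : MarkedDiagram Y} {S : Finset Y} {c : Y} (hcS : c ∉ S)
    (hc : c ∈ D.active) : K.singularSum D (insert c S) =
      (K.v ^ 2 - 1) * K.singularSum (negative D c) S +
        K.v * K.kindCoeff D c * K.singularSum (D.smooth c) S := by
  unfold singularSum
  rw [Finset.sum_powerset_insert hcS, ← Finset.sum_add_distrib, Finset.mul_sum, Finset.mul_sum,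
    ← Finset.sum_add_distrib]
  refine Finset.sum_congr rfl fun T hT => ?_
  have hcT : c ∉ T := fun h => hcS (Finset.mem_powerset.1 hT h)
  have hne : ∀ d ∈ S, d ≠ c := fun d hd h => hcS (h ▸ hd)
  have hprod : ∀ D' : MarkedDiagram Y, (∀ d, d ≠ c → D'.sgn d = D.sgn d) →
      ∏ d ∈ S, (((D'.flipSet T).sgn d : ℤ) : R) = ∏ d ∈ S, (((D.flipSet T).sgn d : ℤ) : R) := by
    intro D' h
    refine Finset.prod_congr rfl fun d hd => ?_
    rw [sgn_flipSet_congr (h d (hne d hd))]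
  have hneg : (negative (D.flipSet T) c) = (negative D c).flipSet T := by
    unfold negative
    rw [sgn_flipSet_of_notMem _ hcT]
    split_ifs
    · exact flip_flipSet D hcT
    · rfl
  rw [Finset.prod_insert hcS, Finset.prod_insert hcS, flipSet_insert D hcT,
    hprod (D.flip c) (fun d hd => sgn_flip_of_ne D hd),
    hprod (D.smooth c) (fun d hd => sgn_smooth_of_ne D hd),
    hprod (negative D c) (fun d hd => by
      unfold negative
      split_ifs
      · exact sgn_flip_of_ne D hd
      · rfl),
    sgn_flipSet_of_notMem _ hcT, sgn_flipSet_of_notMem _ hcT, sgn_flip_self]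
  have key := K.sgn_mul_eval_sub (D := D.flipSet T) (c := c) hc
  rw [sgn_flipSet_of_notMem _ hcT, hneg, smooth_flipSet D hcT, flip_flipSet D hcT] at key
  have e : K.kindCoeff (D.flipSet T) c = K.kindCoeff D c := rfl
  rw [e] at key
  push_cast
  linear_combination (∏ d ∈ S, (((D.flipSet T).sgn d : ℤ) : R)) * key

/-- Alternating sums over the resolutions of many crossings are small. -/
theorem singularSum_mem_pow [Finite Y] {I : Ideal R} (hv : K.v ^ 2 - 1 ∈ I) (hw : K.w ∈ I)
    (hz : K.z ∈ I) (S : Finset Y) {D : MarkedDiagram Y} (hS : S ⊆ D.active) :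
    K.singularSum D S ∈ I ^ S.card := by
  induction S using Finset.induction_on generalizing D with
  | empty => simp
  | insert c S hcS ih =>
    have hc : c ∈ D.active := hS (Finset.mem_insert_self c S)
    have hS' : S ⊆ D.active := (Finset.subset_insert c S).trans hS
    have hk : K.kindCoeff D c ∈ I := by
      unfold kindCoeff
      split_ifs
      exacts [hw, hz]
    rw [K.singularSum_insert hcS hc, Finset.card_insert_of_notMem hcS, pow_succ']
    refine add_mem (Ideal.mul_mem_mul hv (ih ?_)) (Ideal.mul_mem_mul (I.mul_mem_left _ hk) (ih ?_))
    · unfold negative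
      split_ifs
      exacts [hS', hS']
    · exact fun d hd => Finset.mem_erase.2 ⟨fun h => hcS (h ▸ hd), hS' hd⟩

end SkeinData

namespace GaussDiagram

open scoped Classical

variable {R : Type*} [CommRing R] (K : SkeinData R)

theorem sum_switch_eq_singularSum {D : GaussDiagram} (h : D.IsPlanar) (S : Finset D.X) :
    ∑ T ∈ S.powerset, (∏ c ∈ S, (((D.switch (T : Set D.X)).sign c : ℤ) : R)) *
      (D.switch (T : Set D.X)).value K = K.singularSum D.toMarked S := by
  refine Finset.sum_congr rfl fun T _ => ?_
  have e1 : ∀ o : D.X → Bool, (∀ x, o x = true ↔ x ∉ T) →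
      D.toMarked.setUpper o = D.toMarked.flipSet T := by
    intro o ho
    unfold MarkedDiagram.flipSet
    congr 1
    funext x
    by_cases hx : x ∈ T
    · have := ho x
      simpa [hx, toMarked] using this
    · have := (ho x).2 hx
      simpa [hx, toMarked] using this
  have e2 : ∀ c : D.X, (D.switch (T : Set D.X)).sign c = (D.toMarked.flipSet T).sgn c := by
    intro c
    by_cases hc : c ∈ T
    · refine (sign_switch_of_mem D (Finset.mem_coe.2 hc)).trans ?_
      rw [MarkedDiagram.sgn_flipSet_of_mem _ hc, sgn_toMarked]
    · refine (sign_switch_of_notMem D (fun hh => hc (Finset.mem_coe.1 hh))).trans ?_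
      rw [MarkedDiagram.sgn_flipSet_of_notMem _ hc, sgn_toMarked]
  rw [value_switch K _ h.balanced (h.switch _).balanced, e1 _ (by simp)]
  exact congrArg (fun k : R => k * _) (Finset.prod_congr rfl fun c _ =>
    congrArg (fun u : ℤˣ => ((u : ℤ) : R)) (e2 c))

end GaussDiagram

/-! ## The power series substituted for the variables -/

namespace MvPowerSeries

variable {σ R : Type*} [CommRing R]

/-- The power series that do not involve the variable `X i`. -/
def freeOf (R : Type*) [CommRing R] (i : σ) : Subring (MvPowerSeries σ R) where
  carrier := {f | ∀ d : σ →₀ ℕ, d i ≠ 0 → coeff d f = 0}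
  zero_mem' := fun d _ => by simp
  one_mem' := fun d hd => by
    classical
    rw [coeff_one, if_neg fun h => hd (by rw [h]; rfl)]
  add_mem' := fun {f g} hf hg d hd => by rw [map_add, hf d hd, hg d hd, add_zero]
  neg_mem' := fun {f} hf d hd => by rw [map_neg, hf d hd, neg_zero]
  mul_mem' := fun {f g} hf hg d hd => by
    classical
    rw [coeff_mul]
    refine Finset.sum_eq_zero fun p hp => ?_
    have h : p.1 i + p.2 i = d i := by
      rw [← Finset.HasAntidiagonal.mem_antidiagonal.1 hp, Finsupp.add_apply]
    by_cases h1 : p.1 i = 0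
    · rw [hg p.2 (by omega), mul_zero]
    · rw [hf p.1 h1, zero_mul]

theorem mem_freeOf {i : σ} {f : MvPowerSeries σ R} :
    f ∈ freeOf R i ↔ ∀ d : σ →₀ ℕ, d i ≠ 0 → coeff d f = 0 := Iff.rfl

theorem X_mem_freeOf {i j : σ} (h : i ≠ j) : (X i : MvPowerSeries σ R) ∈ freeOf R j := by
  classical
  intro d hd
  rw [coeff_X, if_neg]
  rintro rfl
  exact hd (Finsupp.single_eq_of_ne h.symm)

theorem eq_zero_of_mem_freeOf {i : σ} {f : MvPowerSeries σ R} (h : f ∈ freeOf R i)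
    (hX : X i ∣ f) : f = 0 := by
  ext d
  by_cases hd : d i = 0
  · rw [X_dvd_iff.1 hX d hd, map_zero]
  · rw [h d hd, map_zero]

theorem constantCoeff_eq_zero_of_X_dvd {i : σ} {f : MvPowerSeries σ R} (h : X i ∣ f) :
    constantCoeff f = 0 := by
  rw [← coeff_zero_eq_constantCoeff_apply]
  exact X_dvd_iff.1 h 0 rfl

/-- The power series all of whose terms have degree at least `n` in `X i` and `X j` together. -/
def lowIdeal (R : Type*) [CommRing R] (i j : σ) (n : ℕ) : Ideal (MvPowerSeries σ R) where
  carrier := {f | ∀ d : σ →₀ ℕ, d i + d j < n → coeff d f = 0}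
  zero_mem' := fun d _ => by simp
  add_mem' := fun {f g} hf hg d hd => by rw [map_add, hf d hd, hg d hd, add_zero]
  smul_mem' := fun c f hf d hd => by
    classical
    rw [smul_eq_mul, coeff_mul]
    refine Finset.sum_eq_zero fun p hp => ?_
    have h := Finset.HasAntidiagonal.mem_antidiagonal.1 hp
    have hi : p.1 i + p.2 i = d i := by rw [← h, Finsupp.add_apply]
    have hj : p.1 j + p.2 j = d j := by rw [← h, Finsupp.add_apply]
    rw [hf p.2 (by omega), mul_zero]

theorem lowIdeal_mul_le (i j : σ) (m n : ℕ) :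
    lowIdeal R i j m * lowIdeal R i j n ≤ lowIdeal R i j (m + n) := by
  classical
  refine Ideal.mul_le.2 fun f hf g hg d hd => ?_
  rw [coeff_mul]
  refine Finset.sum_eq_zero fun p hp => ?_
  have h := Finset.HasAntidiagonal.mem_antidiagonal.1 hp
  have hi : p.1 i + p.2 i = d i := by rw [← h, Finsupp.add_apply]
  have hj : p.1 j + p.2 j = d j := by rw [← h, Finsupp.add_apply]
  by_cases h1 : p.1 i + p.1 j < m
  · rw [hf p.1 h1, zero_mul]
  · rw [hg p.2 (by omega), mul_zero]

theorem lowIdeal_one_pow_le (i j : σ) (n : ℕ) :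
    lowIdeal R i j 1 ^ n ≤ lowIdeal R i j n := by
  induction n with
  | zero => exact fun f _ d hd => absurd hd (Nat.not_lt_zero _)
  | succ n ih =>
    rw [pow_succ]
    exact (Ideal.mul_mono_left ih).trans (lowIdeal_mul_le i j n 1)

theorem mem_lowIdeal_one_of_left {i j : σ} {f : MvPowerSeries σ R} (h : X i ∣ f) :
    f ∈ lowIdeal R i j 1 := fun d hd => X_dvd_iff.1 h d (by omega)

theorem mem_lowIdeal_one_of_right {i j : σ} {f : MvPowerSeries σ R} (h : X j ∣ f) :
    f ∈ lowIdeal R i j 1 := fun d hd => X_dvd_iff.1 h d (by omega)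

end MvPowerSeries

/-! ### The substituted series and the invariant in power series -/

namespace HomflyptRing

open MvPowerSeries

theorem coeff_expOf {g : MvPowerSeries (Fin 3) ℚ} (hg : constantCoeff g = 0) (d : Fin 3 →₀ ℕ) :
    coeff d (expOf g) = ∑ᶠ n, PowerSeries.coeff n (PowerSeries.exp ℚ) • coeff d (g ^ n) :=
  PowerSeries.coeff_subst (PowerSeries.HasSubst.of_constantCoeff_zero hg) _ _

/-- All positive powers of `g` are divisible by `X i`, so only the term `1` of the exponential can
avoid `X i`. -/
theorem X_dvd_expOf_sub_one {g : MvPowerSeries (Fin 3) ℚ} {i : Fin 3} (h : X i ∣ g) :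
    X i ∣ expOf g - 1 := by
  refine X_dvd_iff.2 fun d hd => ?_
  rw [map_sub, coeff_expOf (constantCoeff_eq_zero_of_X_dvd h), finsum_eq_single _ 0]
  · simp
  · intro n hn
    rw [X_dvd_iff.1 (dvd_pow h hn) d hd, smul_zero]

theorem expOf_mem_freeOf {g : MvPowerSeries (Fin 3) ℚ} (hg : constantCoeff g = 0) {i : Fin 3}
    (h : g ∈ freeOf ℚ i) : expOf g ∈ freeOf ℚ i := by
  intro d hd
  rw [coeff_expOf hg]
  refine finsum_eq_zero_of_forall_eq_zero fun n => ?_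
  rw [mem_freeOf.1 (pow_mem h n) d hd, smul_zero]

theorem X_dvd_expOf_neg_sub {g : MvPowerSeries (Fin 3) ℚ} {i : Fin 3} (h : X i ∣ g) :
    X i ∣ expOf (-g) - expOf g := by
  have := dvd_sub (X_dvd_expOf_sub_one ((dvd_neg).2 h)) (X_dvd_expOf_sub_one h)
  rwa [sub_sub_sub_cancel_right] at this

theorem X_dvd_wSeries : X 0 ∣ wSeries := X_dvd_expOf_neg_sub dvd_rfl

theorem X_dvd_zSeries : X 1 ∣ zSeries := X_dvd_expOf_neg_sub dvd_rfl

theorem X_dvd_vSeries_sub_one (i : Fin 3) : X i ∣ vSeries - 1 := by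
  refine X_dvd_expOf_sub_one ?_
  fin_cases i
  · exact (dvd_mul_right _ _).mul_right _
  · exact (dvd_mul_left _ _).mul_right _
  · exact dvd_mul_left _ _

theorem X_dvd_vSeries_sq_sub_one (i : Fin 3) : X i ∣ vSeries ^ 2 - 1 := by
  have : vSeries ^ 2 - 1 = (vSeries - 1) * (vSeries + 1) := by ring
  rw [this]
  exact (X_dvd_vSeries_sub_one i).mul_right _

theorem expOf_neg_sub_mem_freeOf {i j : Fin 3} (h : i ≠ j) :
    expOf (-X i) - expOf (X i) ∈ freeOf ℚ j :=
  sub_mem (expOf_mem_freeOf (by simp) (neg_mem (X_mem_freeOf h)))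
    (expOf_mem_freeOf (by simp) (X_mem_freeOf h))

theorem wSeries_mem_freeOf : wSeries ∈ freeOf ℚ 2 := expOf_neg_sub_mem_freeOf (by decide)

theorem zSeries_mem_freeOf {i : Fin 3} (h : 1 ≠ i) : zSeries ∈ freeOf ℚ i :=
  expOf_neg_sub_mem_freeOf h

theorem coeff_wSeries : coeff (Finsupp.single 0 1) wSeries = -2 := by
  have h1 := coeff_expOf_linear (-1)
  have h2 := coeff_expOf_linear 1
  simp only [map_neg, map_one, neg_mul, one_mul] at h1 h2
  rw [wSeries, map_sub, h1, h2]
  norm_num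

theorem exists_isUnit_wSeries : ∃ q, IsUnit q ∧ wSeries = X 0 * q := by
  obtain ⟨q, hq⟩ := X_dvd_wSeries
  refine ⟨q, ?_, hq⟩
  rw [isUnit_iff_constantCoeff, isUnit_iff_ne_zero]
  intro h
  have h2 := coeff_wSeries
  have h3 := coeff_add_monomial_mul (Finsupp.single (0 : Fin 3) 1) 0 q (1 : ℚ)
  rw [add_zero] at h3
  rw [hq, X, h3, coeff_zero_eq_constantCoeff_apply, h] at h2
  norm_num at h2

theorem vSeries_mul_inv : vSeries * vSeries⁻¹ = 1 :=
  MvPowerSeries.mul_inv_cancel _ (by rw [constantCoeff_vSeries]; exact one_ne_zero)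

/-- `w` is `x` times a series with constant term `-2`, a unit, and `x` divides `v ^ 2 - 1`. This
makes the values `aₙ` power series. -/
theorem exists_wSeries_mul : ∃ f, wSeries * f = vSeries⁻¹ - vSeries := by
  obtain ⟨q, ⟨u, rfl⟩, hq⟩ := exists_isUnit_wSeries
  obtain ⟨p, hp⟩ := X_dvd_vSeries_sq_sub_one 0
  refine ⟨-(↑u⁻¹ * p * vSeries⁻¹), ?_⟩
  rw [hq]
  linear_combination vSeries⁻¹ * hp - vSeries * vSeries_mul_inv
    - X 0 * p * vSeries⁻¹ * u.mul_inv

/-- The quotient of `v⁻¹ - v` by `w`. -/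
noncomputable def loopSeries : MvPowerSeries (Fin 3) ℚ := exists_wSeries_mul.choose

theorem wSeries_mul_loopSeries : wSeries * loopSeries = vSeries⁻¹ - vSeries :=
  exists_wSeries_mul.choose_spec

/-- The coefficients of the skein relations after the substitution. -/
noncomputable def seriesSkein : SkeinData (MvPowerSeries (Fin 3) ℚ) where
  v := vSeries
  vInv := vSeries⁻¹
  w := wSeries
  z := zSeries
  a n := loopSeries ^ (n - 1)
  v_mul_vInv := vSeries_mul_inv
  a_eq n hn := by
    obtain ⟨m, rfl⟩ := Nat.exists_eq_add_of_le' hn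
    simp only [Nat.add_sub_cancel, pow_succ]
    linear_combination (-loopSeries ^ m * vSeries) * wSeries_mul_loopSeries
      - loopSeries ^ m * vSeries_mul_inv

/-- The invariant with values in power series. -/
noncomputable def seriesInvariant : OrientedLink → MvPowerSeries (Fin 3) ℚ :=
  Quot.lift (fun D => D.toGauss.value seriesSkein) fun D D' h =>
    h.value_eq seriesSkein D.planar.balanced D'.planar.balanced

theorem seriesInvariant_link (D : LinkDiagram) :
    seriesInvariant D.link = D.toGauss.value seriesSkein := rfl

theorem substitution_vInv : substitution vInv = algebraMap _ SeriesField vSeries⁻¹ := by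
  have h := congrArg substitution v_mul_vInv
  have h' := congrArg (algebraMap _ SeriesField) vSeries_mul_inv
  rw [map_mul, substitution_v, map_one] at h
  rw [map_mul, map_one] at h'
  exact mul_left_cancel₀ (left_ne_zero_of_mul_eq_one h) (h.trans h'.symm)

theorem substitution_loop :
    substitution ((vInv - v) * wInv) = algebraMap _ SeriesField loopSeries := by
  have h := congrArg substitution w_mul_wInv
  have h' := congrArg (algebraMap _ SeriesField) wSeries_mul_loopSeries
  rw [map_mul, map_one, substitution_w] at h
  rw [map_mul, map_sub] at h'
  refine mul_left_cancel₀ (left_ne_zero_of_mul_eq_one h) ?_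
  rw [h', map_mul, map_sub, substitution_vInv, substitution_v]
  linear_combination (algebraMap _ SeriesField vSeries⁻¹ - algebraMap _ SeriesField vSeries) * h

-- The inverse of `w` occurs only in the `aₙ`, which become powers of `loopSeries`; the rest of the
-- recursion takes place inside the ring of power series.
open scoped Classical in
theorem substitution_homflyptInvariant (L : OrientedLink) :
    substitution (homflyptInvariant L) = algebraMap _ SeriesField (seriesInvariant L) := by
  induction L using Quot.inductionOn with
  | h D =>
    refine SkeinData.map_evalAlong_eq (K := homflyptSkein) (K' := seriesSkein) substitution_v
      substitution_vInv substitution_w substitution_z (fun n => ?_) _ _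
    change substitution (((vInv - v) * wInv) ^ (n - 1)) =
      algebraMap _ SeriesField (loopSeries ^ (n - 1))
    rw [map_pow, map_pow, substitution_loop]

/-- `L₊ - L₋` is `(v ^ 2 - 1) L₋` plus a multiple of `w` or `z`. Since the exponent of `v` is `xyt`,
each of the three variables divides `v ^ 2 - 1`. -/
theorem X_dvd_seriesInvariant_sub {D : LinkDiagram} {c : D.Crossing} {i : Fin 3}
    (hc : D.toGauss.sign c = 1) (h : X i ∣ seriesSkein.kindCoeff D.toGauss.toMarked c) :
    X i ∣ seriesInvariant D.link - seriesInvariant (D.switch {c}).link := by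
  have e := D.toGauss.value_skein seriesSkein D.planar c
  unfold SkeinData.combine SkeinData.switchCoeff SkeinData.smoothCoeff at e
  rw [D.toGauss.sgn_toMarked, hc, if_pos rfl, if_pos rfl] at e
  have e' : seriesInvariant D.link - seriesInvariant (D.switch {c}).link =
      (seriesSkein.v ^ 2 - 1) * (D.toGauss.switch {c}).value seriesSkein +
        seriesSkein.kindCoeff D.toGauss.toMarked c *
          (seriesSkein.v * (D.toGauss.smooth c).value seriesSkein) := by
    have e1 : seriesInvariant (D.switch {c}).link = (D.toGauss.switch {c}).value seriesSkein := rfl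
    rw [seriesInvariant_link, e1]
    linear_combination e
  rw [e']
  exact dvd_add ((X_dvd_vSeries_sq_sub_one i).mul_right _) (h.mul_right _)

/-- `v ^ 2 - 1`, `w` and `z` have positive degree in `x` and `y` together, so every double point
raises the least such degree by one. -/
theorem singularValue_coeff_seriesInvariant (d : Fin 3 →₀ ℕ) {D : LinkDiagram}
    {S : Finset D.Crossing} (h : d 0 + d 1 < S.card) :
    singularValue (fun L => coeff d (seriesInvariant L)) D S = 0 := by
  classical
  have hm := seriesSkein.singularSum_mem_pow (I := lowIdeal ℚ 0 1 1)
    (mem_lowIdeal_one_of_left (X_dvd_vSeries_sq_sub_one 0))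
    (mem_lowIdeal_one_of_left X_dvd_wSeries) (mem_lowIdeal_one_of_right X_dvd_zSeries) S
    (D := D.toGauss.toMarked) (fun c _ => D.toGauss.mem_toMarked_active c)
  have h0 := lowIdeal_one_pow_le 0 1 _ hm d h
  rw [← GaussDiagram.sum_switch_eq_singularSum seriesSkein D.planar, map_sum] at h0
  unfold singularValue
  rw [← h0]
  refine Finset.sum_congr rfl fun T _ => ?_
  have e : (∏ c ∈ S, (((D.toGauss.switch (T : Set D.Crossing)).sign c : ℤ) :
      MvPowerSeries (Fin 3) ℚ)) =
      C (∏ c ∈ S, (((D.toGauss.switch (T : Set D.Crossing)).sign c : ℤ) : ℚ)) := by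
    rw [map_prod]
    exact Finset.prod_congr rfl fun c _ => (map_intCast _ _).symm
  exact ((congrArg (fun k => coeff d (k * _)) e).trans (coeff_C_mul _ _ _)).symm

-- More than `d 0 + d 1` double points of either kind are in particular that many in all, so the
-- total degree serves for both bounds.
open scoped Classical in
theorem isTwoVariableVassiliev_coeff (d : Fin 3 →₀ ℕ) :
    IsTwoVariableVassiliev fun L => coeff d (seriesInvariant L) :=
  ⟨d 0 + d 1, d 0 + d 1, fun _ S h => singularValue_coeff_seriesInvariant d <|
    h.elim (fun h => h.trans_le (S.card_filter_le _)) fun h => h.trans_le (S.card_filter_le _)⟩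

end HomflyptRing

/-! ## The substitution is injective -/

namespace Polynomial

variable {R A : Type*} [CommRing R] [CommRing A]

theorem eval₂_mem_subring {g : R →+* A} {S : Subring A} (hg : ∀ r, g r ∈ S) {s : A} (hs : s ∈ S)
    (q : R[X]) : q.eval₂ g s ∈ S := by
  rw [eval₂_eq_sum_range]
  exact sum_mem fun i _ => mul_mem (hg _) (pow_mem hs i)

/-- An element divisible by `p` satisfies no polynomial equation over a ring whose nonzero elements
are not divisible by `p`. -/
theorem eq_zero_of_eval₂_eq_zero [NoZeroDivisors A] {g : R →+* A} {p s : A} (hs : s ≠ 0) (hps : p ∣ s)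
    (hg : ∀ r, p ∣ g r → r = 0) (q : R[X]) (h : q.eval₂ g s = 0) : q = 0 := by
  by_contra hq
  have hd := q.divX_mul_X_add
  rw [← hd, eval₂_add, eval₂_mul, eval₂_X, eval₂_C] at h
  -- `p` divides every term with a factor `s`, hence also the constant term. After that `s` is
  -- cancelled and the argument repeats for `q.divX`.
  have h0 : q.coeff 0 = 0 :=
    hg _ ((dvd_add_right (hps.mul_left _)).1 (h ▸ dvd_zero p))
  rw [h0, map_zero, add_zero] at h
  have := eq_zero_of_eval₂_eq_zero hs hps hg q.divX ((mul_eq_zero.1 h).resolve_right hs)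
  rw [this, h0, map_zero, zero_mul, add_zero] at hd
  exact hq hd.symm
termination_by q.degree
decreasing_by exact degree_divX_lt hq

end Polynomial

namespace LaurentPolynomial

variable {R A : Type*} [CommRing R] [CommRing A]

theorem eq_zero_of_eval₂_eq_zero {f : R →+* A} {x : Aˣ}
    (h : ∀ q : Polynomial R, q.eval₂ f (x : A) = 0 → q = 0) (p : LaurentPolynomial R)
    (hp : eval₂ f x p = 0) : p = 0 := by
  obtain ⟨n, q, hq⟩ := p.exists_T_pow
  have hq0 : q = 0 := by
    apply h
    rw [← eval₂_toLaurent, hq, map_mul, hp, zero_mul]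
  rw [hq0, map_zero] at hq
  exact ((isUnit_T (n : ℤ)).mul_left_eq_zero).1 hq.symm

end LaurentPolynomial

namespace HomflyptRing

open MvPowerSeries

/-- Only the linear term of the exponential contributes, as `n • e = e` forces `n = 1`. -/
theorem coeff_expOf_monomial {e : Fin 3 →₀ ℕ} (he : e ≠ 0) (c : ℚ) :
    coeff e (expOf (monomial e c)) = c := by
  classical
  have h0 : constantCoeff (monomial e c) = 0 := by
    rw [← coeff_zero_eq_constantCoeff_apply, coeff_monomial, if_neg he.symm]
  rw [coeff_expOf h0, finsum_eq_single _ 1]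
  · rw [pow_one, coeff_monomial_same]
    simp [PowerSeries.coeff_exp]
  · intro n hn
    rw [monomial_pow, coeff_monomial, if_neg, smul_zero]
    intro h
    obtain ⟨i, hi⟩ := Finsupp.ne_iff.1 he
    have := DFunLike.congr_fun h i
    rw [Finsupp.smul_apply, smul_eq_mul] at this
    exact hn (Nat.eq_of_mul_eq_mul_right (Nat.pos_of_ne_zero hi) (by omega))

theorem zSeries_ne_zero : zSeries ≠ 0 := by
  intro h
  have he : Finsupp.single (1 : Fin 3) 1 ≠ 0 := by simp
  have h3 := congrArg (coeff (Finsupp.single (1 : Fin 3) 1)) h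
  have e : -yy = monomial (Finsupp.single (1 : Fin 3) 1) (-1 : ℚ) := by rw [map_neg]; rfl
  rw [zSeries, map_sub, e, coeff_expOf_monomial he, yy, X, coeff_expOf_monomial he, map_zero] at h3
  norm_num at h3

theorem vSeries_sub_one_ne_zero : vSeries - 1 ≠ 0 := by
  classical
  intro h
  let e : Fin 3 →₀ ℕ := Finsupp.single 0 1 + Finsupp.single 1 1 + Finsupp.single 2 1
  have he : e ≠ 0 := fun h => by simpa [e] using DFunLike.congr_fun h 0
  have hm : xx * yy * tt = monomial e (1 : ℚ) := by
    rw [xx, yy, tt, X, X, X, monomial_mul_monomial, monomial_mul_monomial, one_mul, one_mul]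
  have h3 := congrArg (coeff e) h
  rw [vSeries, hm, map_sub, coeff_expOf_monomial he, coeff_one, if_neg he, map_zero] at h3
  norm_num at h3

/-- The substitution on `ℤ[z]`. -/
noncomputable def substZ : Polynomial ℤ →+* MvPowerSeries (Fin 3) ℚ :=
  Polynomial.eval₂RingHom (Int.castRingHom _) zSeries

/-- The substitution on `ℤ[z, w]`. -/
noncomputable def substZW : Polynomial (Polynomial ℤ) →+* MvPowerSeries (Fin 3) ℚ :=
  Polynomial.eval₂RingHom substZ wSeries

theorem substZ_mem {i : Fin 3} (h : 1 ≠ i) (q : Polynomial ℤ) : substZ q ∈ freeOf ℚ i :=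
  Polynomial.eval₂_mem_subring (fun r => intCast_mem _ r) (zSeries_mem_freeOf h) q

theorem substZW_mem (q : Polynomial (Polynomial ℤ)) : substZW q ∈ freeOf ℚ 2 :=
  Polynomial.eval₂_mem_subring (substZ_mem (by decide)) wSeries_mem_freeOf q

/-- The variables are eliminated one at a time, each by a series variable that divides its image but
is absent from the images treated before: `y` for `z`, `x` for `w`, `t` for `v - 1`. -/
theorem substZ_eq_zero {q : Polynomial ℤ} (h : substZ q = 0) : q = 0 := by
  refine Polynomial.eq_zero_of_eval₂_eq_zero zSeries_ne_zero X_dvd_zSeries (fun r hr => ?_) q h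
  have := congrArg constantCoeff (eq_zero_of_mem_freeOf (intCast_mem _ r) hr)
  rwa [map_intCast, map_zero, Int.cast_eq_zero] at this

theorem substZW_eq_zero {q : Polynomial (Polynomial ℤ)} (h : substZW q = 0) : q = 0 :=
  Polynomial.eq_zero_of_eval₂_eq_zero wSeries_ne_zero X_dvd_wSeries
    (fun r hr => substZ_eq_zero (eq_zero_of_mem_freeOf (substZ_mem (by decide) r) hr)) q h

/-- The image of `v` is a unit, so the polynomial is first rewritten in `v - 1`. -/
theorem eq_zero_of_eval₂_vSeries {q : Polynomial (Polynomial (Polynomial ℤ))}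
    (h : q.eval₂ substZW vSeries = 0) : q = 0 := by
  have key := Polynomial.eq_zero_of_eval₂_eq_zero vSeries_sub_one_ne_zero
    (X_dvd_vSeries_sub_one 2)
    (fun r hr => substZW_eq_zero (eq_zero_of_mem_freeOf (substZW_mem r) hr))
    (q.comp (Polynomial.X + Polynomial.C 1)) (by
      rw [Polynomial.eval₂_comp, Polynomial.eval₂_add, Polynomial.eval₂_X, Polynomial.eval₂_C,
        map_one, sub_add_cancel, h])
  exact Polynomial.comp_X_add_C_eq_zero_iff.1 key

/-- The substitution on `ℤ[z, w^{±1}]`. -/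
noncomputable def substLaurent : LaurentPolynomial (Polynomial ℤ) →+* SeriesField :=
  LaurentPolynomial.eval₂
    (Polynomial.eval₂RingHom (Int.castRingHom SeriesField) (algebraMap _ SeriesField zSeries))
    (Units.mk0 (algebraMap _ SeriesField wSeries)
      ((map_ne_zero_iff _ (IsFractionRing.injective _ _)).2 wSeries_ne_zero))

theorem substLaurent_toLaurent (q : Polynomial (Polynomial ℤ)) :
    substLaurent (Polynomial.toLaurent q) = algebraMap _ SeriesField (substZW q) := by
  have e : Polynomial.eval₂RingHom (Int.castRingHom SeriesField)
      (algebraMap _ SeriesField zSeries) = (algebraMap _ SeriesField).comp substZ := by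
    refine Polynomial.ringHom_ext' (RingHom.ext_int _ _) ?_
    simp [substZ]
  rw [substLaurent, LaurentPolynomial.eval₂_toLaurent, e]
  exact (Polynomial.hom_eval₂ q substZ (algebraMap _ SeriesField) wSeries).symm

theorem substitution_injective : Function.Injective substitution := by
  refine (injective_iff_map_eq_zero _).2 fun p hp => ?_
  refine LaurentPolynomial.eq_zero_of_eval₂_eq_zero (fun q hq => ?_) p hp
  replace hq : q.eval₂ substLaurent (algebraMap _ SeriesField vSeries) = 0 := hq
  -- The coefficients of `q` are Laurent polynomials in `w`; a power of `w` clears their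
  -- denominators and turns the relation into one between power series.
  obtain ⟨b, hbm, hb⟩ := IsLocalization.integerNormalization_spec
    (Submonoid.powers (Polynomial.X : Polynomial (Polynomial ℤ))) q
  set q' := IsLocalization.integerNormalization
    (Submonoid.powers (Polynomial.X : Polynomial (Polynomial ℤ))) q
  have hsm : b • q =
      Polynomial.C (Polynomial.toLaurent b) * q := by
    ext1 n
    rw [Polynomial.coeff_smul, Polynomial.coeff_C_mul, Algebra.smul_def,
      LaurentPolynomial.algebraMap_eq_toLaurent]
  have hq' : q' = 0 := by
    refine eq_zero_of_eval₂_vSeries (IsFractionRing.injective _ SeriesField ?_)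
    rw [Polynomial.hom_eval₂, map_zero]
    have e : (algebraMap _ SeriesField).comp substZW = substLaurent.comp (algebraMap _ _) :=
      RingHom.ext fun r => (substLaurent_toLaurent r).symm
    rw [e, ← Polynomial.eval₂_map, hb, hsm, Polynomial.eval₂_mul, hq, mul_zero]
  rw [hq', Polynomial.map_zero, hsm] at hb
  obtain ⟨n, rfl⟩ := hbm
  refine ((IsUnit.map Polynomial.C ?_).mul_right_eq_zero).1 hb.symm
  rw [map_pow, Polynomial.toLaurent_X]
  exact (LaurentPolynomial.isUnit_T 1).pow n

end HomflyptRing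

theorem mainTheorem2 :
    ∃ W : OrientedLink → HomflyptRing,
      IsGeneralizedConwayInvariant homflyptConwayAlgebra W ∧
      (∀ W' : OrientedLink → HomflyptRing,
        IsGeneralizedConwayInvariant homflyptConwayAlgebra W' → W' = W) ∧
      ∃ F : OrientedLink → MvPowerSeries (Fin 3) ℚ,
        (∀ L, HomflyptRing.substitution (W L) =
          algebraMap (MvPowerSeries (Fin 3) ℚ) HomflyptRing.SeriesField (F L)) ∧
        (∀ (D : LinkDiagram) (c : D.Crossing), D.toGauss.sign c = 1 → D.toGauss.IsSelf c →
          ∃ f : MvPowerSeries (Fin 3) ℚ,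
            F D.link - F (D.switch {c}).link = MvPowerSeries.X 0 * f) ∧
        (∀ (D : LinkDiagram) (c : D.Crossing), D.toGauss.sign c = 1 → ¬ D.toGauss.IsSelf c →
          ∃ g : MvPowerSeries (Fin 3) ℚ,
            F D.link - F (D.switch {c}).link = MvPowerSeries.X 1 * g) ∧
        (∀ d : Fin 3 →₀ ℕ,
          IsTwoVariableVassiliev (fun L => MvPowerSeries.coeff d (F L)) ∧
          ∀ (D : LinkDiagram) (S : Finset D.Crossing), d 0 + d 1 < S.card →
            singularValue (fun L => MvPowerSeries.coeff d (F L)) D S = 0) ∧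
        (∀ L L' : OrientedLink, F L = F L' → W L = W L') ∧
        (∀ L L' : OrientedLink,
          (∀ u : OrientedLink → ℚ, IsTwoVariableVassiliev u → u L = u L') → W L = W L') := by
  have hF : ∀ L L' : OrientedLink,
      HomflyptRing.seriesInvariant L = HomflyptRing.seriesInvariant L' →
        homflyptInvariant L = homflyptInvariant L' := fun L L' h =>
    HomflyptRing.substitution_injective (by
      rw [HomflyptRing.substitution_homflyptInvariant,
        HomflyptRing.substitution_homflyptInvariant, h])
  refine ⟨homflyptInvariant, isGeneralizedConwayInvariant_homflyptInvariant,
    fun W' h => h.unique isGeneralizedConwayInvariant_homflyptInvariant,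
    HomflyptRing.seriesInvariant, HomflyptRing.substitution_homflyptInvariant,
    fun D c hc hs => HomflyptRing.X_dvd_seriesInvariant_sub hc ?_,
    fun D c hc hs => HomflyptRing.X_dvd_seriesInvariant_sub hc ?_,
    fun d => ⟨HomflyptRing.isTwoVariableVassiliev_coeff d,
      fun D S => HomflyptRing.singularValue_coeff_seriesInvariant d⟩,
    -- The coefficients of `F` are themselves two variable Vassiliev invariants, so they agree on
    -- `L` and `L'`, and then so does `F`.
    hF, fun L L' h => hF L L'
      (MvPowerSeries.ext fun d => h _ (HomflyptRing.isTwoVariableVassiliev_coeff d))⟩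
  · rw [SkeinData.kindCoeff, if_pos (show D.toGauss.toMarked.IsSelf c from hs)]
    exact HomflyptRing.X_dvd_wSeries
  · rw [SkeinData.kindCoeff, if_neg (show ¬ D.toGauss.toMarked.IsSelf c from hs)]
    exact HomflyptRing.X_dvd_zSeries
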